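/- Let $d\in\{2,3\}$ and let $(U_{\mathbf w})_{\mathbf w\in\mathbb Z^d}$ be i.i.d. uniform on $[-1,1]^d$, with $V=\{\mathbf w+U_{\mathbf w}:\mathbf w\in\mathbb Z^d\}$. For $\mathbf x\in\mathbb R^d$ let $h(\mathbf x)$ be the point of $V$ closest to $\mathbf x$ in $\|\cdot\|_1$ among those with $d$-th coordinate strictly larger than $\mathbf x(d)$ (a.s. unique). For $\mathbf x\in V$ let $\widehat{\mathbf x}\in\mathbb Z^d$ be the (a.s. unique) vertex with $\mathbf x=\widehat{\mathbf x}+U_{\widehat{\mathbf x}}$, and let $\mathbf x^\uparrow$ be the $\|\cdot\|_1$-closest vertex of $\mathbb Z^d$ to $\mathbf x$ with $d$-th coordinate $\lfloor \mathbf x(d)\rfloor+1$. Put $B^+(\mathbf x,r)=\{\mathbf y:\|\mathbf y-\mathbf x\|_1\le r,\ \mathbf y(d)\ge \mathbf x(d)\}$ for $r>0$, and $B^+(\mathbf x,0)=\emptyset$. *Exploration.* The single path from $\mathbf u\in\mathbb Z^d$ is $g_n(\mathbf u)=h^n(\mathbf u)$. For $\mathbf u,\mathbf v\in\mathbb Z^d$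 with $\mathbf u(d)=\mathbf v(d)$, the joint exploration starts at $(g_0(\mathbf u),g_0(\mathbf v))=(\mathbf u,\mathbf v)$. At each step, if $\lfloor g_n(\mathbf u)(d)\rfloor\neq\lfloor g_n(\mathbf v)(d)\rfloor$, only the path with the smaller value moves, to its image under $h$. If the two values agree, both move by $h$, except that if one of them moves onto the current position of the other, it moves by $h^2$ instead. *Explored region.* $H_0=\emptyset$, and $H_{n+1}$ is the part, in the half space $\{\mathbf x: \mathbf x(d)\ge g_{n+1}(\mathbf u)(d)\wedge g_{n+1}(\mathbf v)(d)\}$, of the union of $H_n$ and of the sets $B^+(g_n(\mathbf w),\|h(g_n(\mathbf w))-g_n(\mathbf w)\|_1)$ over the $\mathbf w\in\{\mathbf u,\mathbf v\}$ whose path moves in step $n+1$. Call $m\in\mathbb N$ admissible if, for all $\mathbf u,\mathbf v\in\mathbb Z^d$ with $\mathbf u(d)=\mathbf v(d)$ and all $n\ge0$, a.s. $\sup\{\mathbf x(d)-\mathbf y(d):\mathbf x,\mathbf y\in H_n\}\le m-4$ (the supremum being $0$ if $H_n=\emptyset$). *Renewal steps.* Fix $\delta>0$ and $m\in\mathbb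 N$. For $\mathbf w\in\mathbb Z^d$ let $N(\mathbf w)=\{\mathbf y\in\mathbb Z^d:\mathbf y(d)\ge \mathbf w(d),\|\mathbf y-\mathbf w\|_\infty\le1\}$ and let $A(\mathbf w)$ be the event that $\mathbf y+U_{\mathbf y}\in B^+(\mathbf y,\delta)$ for all $\mathbf y\in N(\mathbf w)$. The $(n+1)$-th step of the joint exploration is an *up step* if $\lfloor g_n(\mathbf u)(d)\rfloor=\lfloor g_n(\mathbf v)(d)\rfloor$, $g_{n+1}(\mathbf u)\in B^+(g_n(\mathbf u)^\uparrow,\delta)$ and $g_{n+1}(\mathbf v)\in B^+(g_n(\mathbf v)^\uparrow,\delta)$. It is a *special up step* if moreover $E_{n+1}:=A(g_n(\mathbf u)^\uparrow)\cap A(g_n(\mathbf v)^\uparrow)$ occurs. Let $\tau_0=0$ and $$\tau_{j+1}=\inf\{n>\tau_j+m:\ \text{the last } m \text{ steps (up to the } n\text{-th) are up steps and the } n\text{-th step is a special up step}\},\qquad \inf\emptyset=\infty .$$ Let $\mathcal G_n$ be the $\sigma$-field generated by $g_j(\mathbf u),g_j(\mathbf v)$ $(0\le j\le n-1)$, by $\widehat{g_j(\mathbf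 u)},\widehat{g_j(\mathbf v)}$ $(1\le j\le n)$, by $\mathbf 1_{E_1},\dots,\mathbf 1_{E_n}$, and by the events of probability $0$. For the single path, up steps, special up steps, $\tau_j$ and $\mathcal G_n$ are defined in the same way with only $\mathbf u$ present (and no condition on the levels of two paths). **Proposition.** Admissible $m$ exist. There is $\delta_0>0$, depending only on $d$, such that for every $\delta\in(0,\delta_0)$ and every admissible $m$ there are constants $C_0,C_1>0$, depending only on $d$, $\delta$ and $m$, with the following property. For every $\mathbf u\in\mathbb Z^d$ (single path), for all $\mathbf u,\mathbf v\in\mathbb Z^d$ with $\mathbf u(d)=\mathbf v(d)$ (joint exploration), and for every $j\ge0$, the time $\tau_j$ is a stopping time for $(\mathcal G_n)_{n\ge0}$, and for all $n\ge1$ $$\mathbb P\bigl(\tau_{j+1}-\tau_j\ge n\mid\mathcal G_{\tau_j}\bigr)\le C_0e^{-C_1n}\quad\text{a.s.},$$ where $\tau_{j+1}-\tau_j\ge n$ is read as $\tau_{j+1}\ge\tau_j+n$ (so it holds if $\tau_{j+1}=\infty$). -/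

import Mathlib

open MeasureTheory ProbabilityTheory

universe u

namespace DSF

/-! ### The perturbed lattice and the map to the next vertex -/

/-- Lattice vertices of `ℤ^d`. -/
abbrev Site (d : ℕ) := Fin d → ℤ

/-- Points of `ℝ^d`; distances are measured by `l1Dist` below. -/
abbrev Pt (d : ℕ) := Fin d → ℝ

/-- A realisation `(U_w)_w` of the perturbations. -/
abbrev Env (d : ℕ) := Site d → Pt d

variable {d : ℕ}

/-- The index of the last (`d`-th) coordinate, which gives the direction of the forest. -/
def last (d : ℕ) [NeZero d] : Fin d := ⟨d - 1, Nat.sub_one_lt (NeZero.ne d)⟩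

/-- The `ℓ¹` distance. -/
noncomputable def l1Dist (x y : Pt d) : ℝ := ∑ i, |x i - y i|

/-- A lattice vertex as a point of `ℝ^d`. -/
def toPt (w : Site d) : Pt d := fun i => (w i : ℝ)

/-- The perturbed point `w + U_w`. The vertex set `V` is the range of `perturbed ξ`. -/
def perturbed (ξ : Env d) (w : Site d) : Pt d := fun i => (w i : ℝ) + ξ w i

/-- `w + U_w` is a point of `V` with `d`-th coordinate strictly above that of `x`, at the least
`ℓ¹` distance from `x` among all such points. -/
def IsNext [NeZero d] (ξ : Env d) (x : Pt d) (w : Site d) : Prop :=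
  x (last d) < perturbed ξ w (last d) ∧
    ∀ w', x (last d) < perturbed ξ w' (last d) →
      l1Dist (perturbed ξ w) x ≤ l1Dist (perturbed ξ w') x

/-- An enumeration of the lattice, used only to break ties (which have probability zero)
measurably. -/
def siteEnum (d : ℕ) (n : ℕ) : Site d := (Encodable.decode (α := Site d) n).getD 0

open Classical in
/-- The first lattice vertex, in the enumeration, with the property `p`; `0` if there is none. -/
noncomputable def firstSite (p : Site d → Prop) : Site d :=
  if h : ∃ n, p (siteEnum d n) then siteEnum d (Nat.find h) else 0

/-- The next vertex `h(x)`: the point of `V` that is closest to `x` in `ℓ¹` distance among those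
with strictly higher `d`-th coordinate. -/
noncomputable def next [NeZero d] (ξ : Env d) (x : Pt d) : Pt d :=
  perturbed ξ (firstSite (IsNext ξ x))

/-- For `x ∈ V`, the (almost surely unique) lattice vertex `x̂` with `x = x̂ + U_x̂`. -/
noncomputable def latticeSite (ξ : Env d) (x : Pt d) : Site d :=
  firstSite fun w => perturbed ξ w = x

/-! ### The single path and the joint exploration of two paths

A family of `k` paths is written `g : Fin k → ℕ → Pt d`, where `g i n` is the position of the
`i`-th path after `n` steps; `k = 1` for the single path and `k = 2` for the joint process. -/

/-- The single path `g_n(u) = h^n(u)`. -/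
noncomputable def singlePath [NeZero d] (u : Site d) (ξ : Env d) : Fin 1 → ℕ → Pt d :=
  fun _ n => (next ξ)^[n] (toPt u)

open Classical in
/-- One step of the joint exploration process: the point on the lower lattice level moves; if the
levels agree then both move, and if one of them moves onto the other, it takes one more step. -/
noncomputable def jointStep [NeZero d] (ξ : Env d) (p : Pt d × Pt d) : Pt d × Pt d :=
  if ⌊p.1 (last d)⌋ < ⌊p.2 (last d)⌋ then (next ξ p.1, p.2)
  else if ⌊p.2 (last d)⌋ < ⌊p.1 (last d)⌋ then (p.1, next ξ p.2)
  else if next ξ p.1 = p.2 then (next ξ (next ξ p.1), next ξ p.2)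
  else if next ξ p.2 = p.1 then (next ξ p.1, next ξ (next ξ p.2))
  else (next ξ p.1, next ξ p.2)

/-- The joint exploration process `(g_n(u), g_n(v))`. -/
noncomputable def jointPath [NeZero d] (u v : Site d) (ξ : Env d) : Fin 2 → ℕ → Pt d :=
  fun i n => ![((jointStep ξ)^[n] (toPt u, toPt v)).1, ((jointStep ξ)^[n] (toPt u, toPt v)).2] i

/-! ### The explored region -/

/-- The upper half `B⁺(x, r)` of the closed `ℓ¹` ball (empty for `r = 0`). -/
def upperBall [NeZero d] (x : Pt d) (r : ℝ) : Set (Pt d) :=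
  {y | 0 < r ∧ l1Dist y x ≤ r ∧ x (last d) ≤ y (last d)}

/-- The explored region `H_n`: in each step, every moving path (one whose lattice level is the
lowest) adds the upper half ball that its step leaves free of points of `V`, and the region is cut
off below the lowest of the current positions. -/
noncomputable def history [NeZero d] {k : ℕ} (ξ : Env d) (g : Fin k → ℕ → Pt d) : ℕ → Set (Pt d)
  | 0 => ∅
  | n + 1 =>
    ({x | ∃ i, (∀ j, ⌊g i n (last d)⌋ ≤ ⌊g j n (last d)⌋) ∧
        x ∈ upperBall (g i n) (l1Dist (next ξ (g i n)) (g i n))} ∪ history ξ g n) ∩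
      {x | (⨅ i, g i (n + 1) (last d)) ≤ x (last d)}

/-- The height `L(B)` of a bounded set. -/
noncomputable def height [NeZero d] (B : Set (Pt d)) : ℝ :=
  sSup {t | ∃ x ∈ B, ∃ y ∈ B, t = x (last d) - y (last d)}

/-! ### Up steps, special up steps and renewal steps -/

/-- `x^↑`: the closest lattice vertex on level `⌊x(d)⌋ + 1`, obtained by rounding the other
coordinates (see `upArrow_closest`). -/
noncomputable def upArrow [NeZero d] (x : Pt d) : Site d :=
  fun i => if i = last d then ⌊x i⌋ + 1 else round (x i)

theorem upArrow_closest [NeZero d] (x : Pt d) (w : Site d) (hw : w (last d) = ⌊x (last d)⌋ + 1) :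
    l1Dist x (toPt (upArrow x)) ≤ l1Dist x (toPt w) := by
  refine Finset.sum_le_sum fun i _ => ?_
  by_cases hi : i = last d
  · subst hi
    simp [toPt, upArrow, hw]
  · simp only [toPt, upArrow, if_neg hi]
    exact round_le (x i) (w i)

/-- The neighbourhood `N(w)` of `w` in the upper half space. -/
def nbhd [NeZero d] (w : Site d) : Set (Site d) :=
  {y | w (last d) ≤ y (last d) ∧ ∀ i, |y i - w i| ≤ 1}

/-- The event `A(w)`: every `y ∈ N(w)` has its perturbed point in `B⁺(y, δ)`. -/
def GoodAt [NeZero d] (ξ : Env d) (δ : ℝ) (w : Site d) : Prop :=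
  ∀ y ∈ nbhd w, perturbed ξ y ∈ upperBall (toPt y) δ

/-- The event `E_{n+1}`: `A(g_n^↑)` occurs for each of the paths. -/
def GoodStep [NeZero d] {k : ℕ} (ξ : Env d) (δ : ℝ) (g : Fin k → ℕ → Pt d) (n : ℕ) : Prop :=
  ∀ i, GoodAt ξ δ (upArrow (g i n))

/-- The `(n+1)`-th step is an up step. -/
def UpStep [NeZero d] {k : ℕ} (δ : ℝ) (g : Fin k → ℕ → Pt d) (n : ℕ) : Prop :=
  (∀ i j, ⌊g i n (last d)⌋ = ⌊g j n (last d)⌋) ∧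
    ∀ i, g i (n + 1) ∈ upperBall (toPt (upArrow (g i n))) δ

/-- The `(n+1)`-th step is a special up step. -/
def SpecialUpStep [NeZero d] {k : ℕ} (ξ : Env d) (δ : ℝ) (g : Fin k → ℕ → Pt d) (n : ℕ) : Prop :=
  UpStep δ g n ∧ GoodStep ξ δ g n

/-- The renewal steps `τ_j`, with value `⊤` if there is no such step: `τ_0 = 0`, and `τ_{j+1}` is
the first `n > τ_j + m` such that the steps number `n - m + 1, …, n` are up steps and step number
`n` is a special up step. -/
noncomputable def renewal [NeZero d] {k : ℕ} (ξ : Env d) (δ : ℝ) (m : ℕ) (g : Fin k → ℕ → Pt d) :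
    ℕ → ℕ∞
  | 0 => 0
  | j + 1 => sInf {t | ∃ n : ℕ, t = (n : ℕ∞) ∧ renewal ξ δ m g j + (m : ℕ∞) < (n : ℕ∞) ∧
      (∀ s, n ≤ s + m → s < n → UpStep δ g s) ∧ SpecialUpStep ξ δ g (n - 1)}

/-! ### The random model -/

/-- The perturbations `U_w`, `w ∈ ℤ^d`, are i.i.d. and uniformly distributed on `[-1, 1]^d`. -/
structure IsModel {Ω : Type*} [MeasurableSpace Ω] (P : Measure Ω) (U : Ω → Env d) : Prop where
  indep : iIndepFun (fun (w : Site d) (ω : Ω) => U ω w) P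
  uniform : ∀ w : Site d,
    MeasureTheory.pdf.IsUniform (fun ω : Ω => U ω w) (Set.Icc (-1 : Pt d) 1) P volume

/-- The number `m` is an admissible choice of `m_d`: almost surely, the height of the explored
region never exceeds `m - 4`. -/
def HeightBound [NeZero d] {Ω : Type*} [MeasurableSpace Ω] (P : Measure Ω) (U : Ω → Env d)
    (m : ℕ) : Prop :=
  ∀ u v : Site d, u (last d) = v (last d) → ∀ n : ℕ,
    ∀ᵐ ω ∂P, height (history (U ω) (jointPath u v (U ω)) n) ≤ (m : ℝ) - 4

/-! ### Measurability -/

theorem exists_siteEnum (w : Site d) : ∃ n, siteEnum d n = w :=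
  ⟨Encodable.encode w, by simp [siteEnum]⟩

theorem measurable_firstSite {α : Type*} [MeasurableSpace α] {p : α → Site d → Prop}
    (hp : ∀ w, MeasurableSet {a | p a w}) : Measurable fun a => firstSite (p a) := by
  classical
  have hE : MeasurableSet {a | ∃ n, p a (siteEnum d n)} := by
    rw [show {a | ∃ n, p a (siteEnum d n)} = ⋃ n, {a | p a (siteEnum d n)} by ext; simp]
    exact MeasurableSet.iUnion fun n => hp _
  let q : α → ℕ → Prop := fun a n => p a (siteEnum d n) ∨ ¬ ∃ n, p a (siteEnum d n)
  have hq : ∀ a, ∃ n, q a n := by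
    intro a
    by_cases h : ∃ n, p a (siteEnum d n)
    · obtain ⟨n, hn⟩ := h
      exact ⟨n, Or.inl hn⟩
    · exact ⟨0, Or.inr h⟩
  have hfind : Measurable fun a => Nat.find (hq a) :=
    measurable_find hq fun n => (hp _).union hE.compl
  have h1 : Measurable fun a => siteEnum d (Nat.find (hq a)) :=
    (measurable_of_countable (siteEnum d)).comp hfind
  have : (fun a => firstSite (p a)) =
      fun a => if a ∈ {a | ∃ n, p a (siteEnum d n)} then siteEnum d (Nat.find (hq a)) else 0 := by
    funext a
    by_cases h : ∃ n, p a (siteEnum d n)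
    · have he : Nat.find h = Nat.find (hq a) := by
        apply Nat.find_congr'
        intro n
        simp only [q, h, not_true_eq_false, or_false]
      simp only [firstSite, Set.mem_ofPred_eq, h, dif_pos, if_pos]
      exact congrArg _ he
    · simp [firstSite, h]
  rw [this]
  exact Measurable.ite hE h1 measurable_const

theorem measurable_perturbed (w : Site d) : Measurable fun ξ : Env d => perturbed ξ w :=
  measurable_pi_lambda _ fun i => by
    have h : Measurable fun ξ : Env d => ξ w i :=
      (measurable_pi_apply i).comp (measurable_pi_apply w)
    exact h.const_add (w i : ℝ)

theorem measurable_perturbed' {s : Env d → Site d} (hs : Measurable s) :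
    Measurable fun ξ : Env d => perturbed ξ (s ξ) := by
  have h : Measurable fun p : Env d × Site d => perturbed p.1 p.2 :=
    measurable_from_prod_countable_left fun w => measurable_perturbed w
  exact h.comp (measurable_id.prodMk hs)

theorem measurable_l1Dist {f g : Env d → Pt d} (hf : Measurable f) (hg : Measurable g) :
    Measurable fun ξ => l1Dist (f ξ) (g ξ) := by
  refine Finset.measurable_sum _ fun i _ => ?_
  have h : Measurable fun ξ => f ξ i - g ξ i :=
    ((measurable_pi_apply i).comp hf).sub ((measurable_pi_apply i).comp hg)
  simpa [Real.norm_eq_abs] using h.norm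

theorem measurable_next [NeZero d] {f : Env d → Pt d} (hf : Measurable f) :
    Measurable fun ξ => next ξ (f ξ) := by
  refine measurable_perturbed' (measurable_firstSite fun w => ?_)
  have hlt : ∀ w : Site d, MeasurableSet {ξ | f ξ (last d) < perturbed ξ w (last d)} := fun w =>
    measurableSet_lt ((measurable_pi_apply _).comp hf)
      ((measurable_pi_apply _).comp (measurable_perturbed w))
  have hset : {ξ | IsNext ξ (f ξ) w} = {ξ | f ξ (last d) < perturbed ξ w (last d)} ∩
      ⋂ w', ({ξ | f ξ (last d) < perturbed ξ w' (last d)}ᶜ ∪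
        {ξ | l1Dist (perturbed ξ w) (f ξ) ≤ l1Dist (perturbed ξ w') (f ξ)}) := by
    ext ξ
    simp only [IsNext, Set.mem_ofPred_eq, Set.mem_inter_iff, Set.mem_iInter, Set.mem_union,
      Set.mem_compl_iff, imp_iff_not_or]
  rw [hset]
  exact (hlt w).inter (MeasurableSet.iInter fun w' => (hlt w').compl.union
    (measurableSet_le (measurable_l1Dist (measurable_perturbed w) hf)
      (measurable_l1Dist (measurable_perturbed w') hf)))

theorem measurable_latticeSite {f : Env d → Pt d} (hf : Measurable f) :
    Measurable fun ξ => latticeSite ξ (f ξ) :=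
  measurable_firstSite fun w => measurableSet_eq_fun (measurable_perturbed w) hf

theorem measurable_singlePath [NeZero d] (u : Site d) (i : Fin 1) (n : ℕ) :
    Measurable fun ξ : Env d => singlePath u ξ i n := by
  simp only [singlePath]
  induction n with
  | zero => exact measurable_const
  | succ n ih =>
    simp only [Function.iterate_succ_apply']
    exact measurable_next ih

theorem measurable_jointStep [NeZero d] {f : Env d → Pt d × Pt d} (hf : Measurable f) :
    Measurable fun ξ => jointStep ξ (f ξ) := by
  classical
  have h1 : Measurable fun ξ => (f ξ).1 := hf.fst
  have h2 : Measurable fun ξ => (f ξ).2 := hf.snd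
  have n1 := measurable_next h1
  have n2 := measurable_next h2
  have l1 : Measurable fun ξ => ⌊(f ξ).1 (last d)⌋ :=
    Int.measurable_floor.comp ((measurable_pi_apply _).comp h1)
  have l2 : Measurable fun ξ => ⌊(f ξ).2 (last d)⌋ :=
    Int.measurable_floor.comp ((measurable_pi_apply _).comp h2)
  refine Measurable.ite (measurableSet_lt l1 l2) (n1.prodMk h2) ?_
  refine Measurable.ite (measurableSet_lt l2 l1) (h1.prodMk n2) ?_
  refine Measurable.ite (measurableSet_eq_fun n1 h2) ((measurable_next n1).prodMk n2) ?_
  exact Measurable.ite (measurableSet_eq_fun n2 h1) (n1.prodMk (measurable_next n2))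
    (n1.prodMk n2)

theorem measurable_jointPath [NeZero d] (u v : Site d) (i : Fin 2) (n : ℕ) :
    Measurable fun ξ : Env d => jointPath u v ξ i n := by
  have h : Measurable fun ξ : Env d => (jointStep ξ)^[n] (toPt u, toPt v) := by
    induction n with
    | zero => exact measurable_const
    | succ n ih =>
      simp only [Function.iterate_succ_apply']
      exact measurable_jointStep ih
  fin_cases i
  · exact h.fst
  · exact h.snd

theorem measurable_upArrow [NeZero d] : Measurable (upArrow : Pt d → Site d) := by
  refine measurable_pi_lambda _ fun i => ?_
  by_cases hi : i = last d
  · simp only [upArrow, if_pos hi]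
    exact (measurable_of_countable (fun z : ℤ => z + 1)).comp
      (Int.measurable_floor.comp (measurable_pi_apply i))
  · simp only [upArrow, if_neg hi, round_eq]
    exact Int.measurable_floor.comp ((measurable_pi_apply i).add_const _)

theorem measurableSet_goodStep [NeZero d] {k : ℕ} (δ : ℝ) {γ : Env d → Fin k → ℕ → Pt d}
    (hγ : ∀ i n, Measurable fun ξ => γ ξ i n) (n : ℕ) :
    MeasurableSet {ξ | GoodStep ξ δ (γ ξ) n} := by
  have hball : ∀ y : Site d, MeasurableSet {ξ : Env d | perturbed ξ y ∈ upperBall (toPt y) δ} := by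
    intro y
    exact (MeasurableSet.const _).inter ((measurableSet_le
      (measurable_l1Dist (measurable_perturbed y) measurable_const) measurable_const).inter
      (measurableSet_le measurable_const
        ((measurable_pi_apply _).comp (measurable_perturbed y))))
  have hset : {ξ | GoodStep ξ δ (γ ξ) n} = ⋂ i, ⋂ y : Site d,
      ({ξ | y ∈ nbhd (upArrow (γ ξ i n))}ᶜ ∪ {ξ | perturbed ξ y ∈ upperBall (toPt y) δ}) := by
    ext ξ
    simp only [GoodStep, GoodAt, Set.mem_ofPred_eq, Set.mem_iInter, Set.mem_union,
      Set.mem_compl_iff, imp_iff_not_or]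
  rw [hset]
  refine MeasurableSet.iInter fun i => MeasurableSet.iInter fun y =>
    MeasurableSet.union (MeasurableSet.compl ?_) (hball y)
  exact (measurable_upArrow.comp (hγ i n)) (Set.to_countable {w | y ∈ nbhd w}).measurableSet

/-! ### The filtration -/

/-- The `σ`-algebra `𝒢_n`, completed by the null events: it is generated by the positions `g_j`
with `j ≤ n - 1`, the lattice vertices `ĝ_j` with `1 ≤ j ≤ n`, and the events `E_1, …, E_n`. The
family of paths is given as a function `γ` of the perturbations. -/
@[reducible]
noncomputable def gAlgebra [NeZero d] {Ω : Type*} [MeasurableSpace Ω] {k : ℕ} (P : Measure Ω) (U : Ω → Env d)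
    (δ : ℝ) (γ : Env d → Fin k → ℕ → Pt d) (n : ℕ) : MeasurableSpace Ω :=
  MeasurableSpace.generateFrom {s | MeasurableSet s ∧ P s = 0} ⊔
    ⨆ j : ℕ, ⨆ _ : j < n,
      ((⨆ i, MeasurableSpace.comap (fun ω => γ (U ω) i j) inferInstance) ⊔
        (⨆ i, MeasurableSpace.comap
          (fun ω => latticeSite (U ω) (γ (U ω) i (j + 1))) inferInstance) ⊔
        MeasurableSpace.generateFrom {{ω | GoodStep (U ω) δ (γ (U ω)) j}})

/-- The filtration `(𝒢_n)`. -/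
noncomputable def gFiltration [NeZero d] {Ω : Type*} [mΩ : MeasurableSpace Ω] {k : ℕ} (P : Measure Ω)
    (U : Ω → Env d) (hU : Measurable U) (δ : ℝ) (γ : Env d → Fin k → ℕ → Pt d)
    (hγ : ∀ i n, Measurable fun ξ => γ ξ i n) : Filtration ℕ mΩ where
  seq := gAlgebra P U δ γ
  mono' := by
    intro a b hab
    refine sup_le le_sup_left (le_sup_of_le_right ?_)
    exact iSup_le fun j => iSup_le fun hj =>
      le_iSup_of_le j (le_iSup_of_le (lt_of_lt_of_le hj hab) le_rfl)
  le' := by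
    intro n
    refine sup_le (MeasurableSpace.generateFrom_le fun s hs => hs.1)
      (iSup_le fun j => iSup_le fun _ => sup_le (sup_le ?_ ?_) ?_)
    · exact iSup_le fun i => ((hγ i j).comp hU).comap_le
    · exact iSup_le fun i => ((measurable_latticeSite (hγ i (j + 1))).comp hU).comap_le
    · refine MeasurableSpace.generateFrom_le fun s hs => ?_
      rw [Set.mem_singleton_iff.1 hs]
      exact hU (measurableSet_goodStep δ hγ j)

/-- For every `j`, the renewal step `τ_j` is a stopping time for `(𝒢_n)`, and
`P(τ_{j+1} - τ_j ≥ n | 𝒢_{τ_j}) ≤ C₀ exp(-C₁ n)` almost surely for all `n ≥ 1`. -/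
def RenewalTail [NeZero d] {Ω : Type*} [MeasurableSpace Ω] {k : ℕ} (P : Measure Ω)
    (U : Ω → Env d) (hU : Measurable U) (δ : ℝ) (m : ℕ) (γ : Env d → Fin k → ℕ → Pt d)
    (hγ : ∀ i n, Measurable fun ξ => γ ξ i n) (C₀ C₁ : ℝ) : Prop :=
  ∀ j : ℕ, ∃ hτ : IsStoppingTime (gFiltration P U hU δ γ hγ)
      (fun ω => renewal (U ω) δ m (γ (U ω)) j),
    ∀ n : ℕ, 1 ≤ n →
      P⟦{ω | renewal (U ω) δ m (γ (U ω)) j + (n : ℕ∞) ≤ renewal (U ω) δ m (γ (U ω)) (j + 1)} |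
          hτ.measurableSpace⟧
        ≤ᵐ[P] fun _ => C₀ * Real.exp (-C₁ * n)

end DSF

/-!
# Exponential tails between the renewal steps of the joint exploration

Started from `u = v`, both paths of the joint exploration are the single path (`jointPath_self`),
so only the joint exploration has to be treated. Almost surely all perturbations lie in the open
cube (`Nice`), and then a step has `ℓ¹` length at most `3 d`; hence the explored region has height
at most `3 d + 1` (`height_history_le`), and `m = 3 d + 5` is admissible.

**Waiting in a fresh environment** (`exists_exponential_tail`). Suppose that, from the level of the
starting points on, all perturbations are uniform, except at two sites. Cut the space into blocks
of levels of fixed height. In the upper part of each block, around the two sites at which the paths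
enter the block, there may be a *trap* (`Trap`): the points are so close to the lattice, with
perturbations slightly decreasing in the level, that both paths go straight up, and a renewal step
occurs (`exists_endsRun_of_trap`). A trap depends only on levels that the paths have not explored
when they enter the block, so it is missed with probability at most `1 - p`, independently of the
earlier blocks (`lintegral_prod_missFactor_le`). Two things can go wrong. A path might wander so far
between its entry into the block and the trap that it misses the trap; this requires a long chain
of sites on few levels. Or the paths might climb too slowly to meet many blocks in the given time.
Both are controlled by the expected weight of chains of sites (`chainWeight`), in which a chain of
increasing heights that climbs by `c` has weight `exp (-lam * c)`. Integrating out one site after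
the other, each step contributes a factor of order `1 / lam`, which beats the number of choices for
the next site (`lintegral_chainWeight_le`). The number of blocks with long chains is estimated by a
generating function along the orbit (`blockWeight`), as the entry sites of a single path in different
blocks are not independent of the environment.

**Conditioning on the past** (`measure_inter_noRenewal_le`). Let a renewal step occur at time `t`.
The last `m` steps are up steps and the explored region is at most `m - 4` high, so the half
balls explored before these steps stay below the level `l` of the new lattice sites `w 0`, `w 1`.
If the perturbations at the other sites of level at least `l` are resampled and the new ones are
good near the two paths, then the path up to time `t` and all the data generating `𝒢_t` are
unchanged (`EndsRun.sameData`). Hence, given the environment at the remaining sites, an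
event in `𝒢_t` contained in `{τ_j = t}` is either null or has probability at least a constant `q`,
while the probability that no renewal step follows within `n` steps is at most `C exp (-c n)` by the
estimate in a fresh environment. The ratio of the two bounds gives the conditional tail.

**Stopping times.** `𝒢_n` does not contain the position after the `n`-th step, only its lattice site.
On the event `E_n` this is enough: the point of `V` near `W` can only be that of `W` itself
(`eq_of_perturbed_mem_upperBall`), so whether step `n` is a special up step is, up to a null event,
determined by the lattice sites (`endsRun_iff_endsRunData`).
-/

namespace DSF

/-! ### Elementary geometry of the perturbed lattice -/

section Geometry

variable {d : ℕ}

theorem firstSite_spec {p : Site d → Prop} (h : ∃ w, p w) : p (firstSite p) := by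
  classical
  have h' : ∃ n, p (siteEnum d n) := by
    obtain ⟨w, hw⟩ := h
    obtain ⟨n, rfl⟩ := exists_siteEnum w
    exact ⟨n, hw⟩
  rw [firstSite, dif_pos h']
  exact Nat.find_spec h'

/-- Shrinking a property without losing its first site does not change the first site. -/
theorem firstSite_eq_of_imp {p q : Site d → Prop} (hqp : ∀ w, q w → p w)
    (hq : q (firstSite p)) : firstSite q = firstSite p := by
  classical
  have h' : ∃ n, p (siteEnum d n) := by
    obtain ⟨n, hn⟩ := exists_siteEnum (firstSite p)
    exact ⟨n, hn ▸ hqp _ hq⟩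
  have hq' : q (siteEnum d (Nat.find h')) := by
    rwa [firstSite, dif_pos h'] at hq
  have h'' : ∃ n, q (siteEnum d n) := ⟨_, hq'⟩
  rw [firstSite, firstSite, dif_pos h', dif_pos h'']
  congr 1
  exact le_antisymm (Nat.find_min' _ hq') (Nat.find_min' _ (hqp _ (Nat.find_spec h'')))

theorem firstSite_eq_of_unique {p : Site d → Prop} {w : Site d} (hw : p w)
    (huniq : ∀ w', p w' → w' = w) : firstSite p = w :=
  huniq _ (firstSite_spec ⟨w, hw⟩)

theorem l1Dist_comm (x y : Pt d) : l1Dist x y = l1Dist y x :=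
  Finset.sum_congr rfl fun _ _ => abs_sub_comm _ _

theorem l1Dist_triangle (x y z : Pt d) : l1Dist x z ≤ l1Dist x y + l1Dist y z := by
  rw [l1Dist, l1Dist, l1Dist, ← Finset.sum_add_distrib]
  exact Finset.sum_le_sum fun i _ => abs_sub_le _ _ _

theorem abs_sub_le_l1Dist (x y : Pt d) (i : Fin d) : |x i - y i| ≤ l1Dist x y :=
  Finset.single_le_sum (f := fun i => |x i - y i|) (fun _ _ => abs_nonneg _) (Finset.mem_univ i)

theorem abs_sub_add_abs_sub_le_l1Dist (x y : Pt d) {i j : Fin d} (hij : i ≠ j) :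
    |x i - y i| + |x j - y j| ≤ l1Dist x y := by
  have h := Finset.sum_le_sum_of_subset_of_nonneg (f := fun i => |x i - y i|)
    (Finset.subset_univ ({i, j} : Finset (Fin d))) (fun _ _ _ => abs_nonneg _)
  rwa [Finset.sum_pair hij] at h

theorem l1Dist_le_card_mul {x y : Pt d} {c : ℝ} (h : ∀ i, |x i - y i| ≤ c) :
    l1Dist x y ≤ d * c := by
  have := Finset.sum_le_card_nsmul (Finset.univ : Finset (Fin d)) (fun i => |x i - y i|) c
    (fun i _ => h i)
  simpa [l1Dist] using this

/-- All perturbations lie in the open cube `(-1, 1)^d`; this holds almost surely. -/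
def Nice (ξ : Env d) : Prop := ∀ w i, |ξ w i| < 1

theorem Nice.abs_perturbed_sub_lt {ξ : Env d} (h : Nice ξ) (w : Site d) (i : Fin d) :
    |perturbed ξ w i - w i| < 1 := by simpa [perturbed] using h w i

variable [NeZero d]

theorem Nice.lt_perturbed {ξ : Env d} (h : Nice ξ) (w : Site d) :
    (w (last d) : ℝ) - 1 < perturbed ξ w (last d) := by
  have := abs_lt.1 (h.abs_perturbed_sub_lt w (last d)); linarith

theorem Nice.perturbed_lt {ξ : Env d} (h : Nice ξ) (w : Site d) :
    perturbed ξ w (last d) < (w (last d) : ℝ) + 1 := by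
  have := abs_lt.1 (h.abs_perturbed_sub_lt w (last d)); linarith

/-- The lattice vertex whose perturbed point is the next vertex `h(x)`. -/
noncomputable def nextSite (ξ : Env d) (x : Pt d) : Site d := firstSite (IsNext ξ x)

theorem next_eq_perturbed (ξ : Env d) (x : Pt d) : next ξ x = perturbed ξ (nextSite ξ x) := rfl

/-- A vertex two levels above `x` is always a candidate for the next vertex. -/
theorem Nice.exists_candidate {ξ : Env d} (h : Nice ξ) (x : Pt d) :
    ∃ w, x (last d) < perturbed ξ w (last d) ∧ l1Dist (perturbed ξ w) x ≤ d * 3 := by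
  let w0 : Site d := fun i => if i = last d then ⌊x i⌋ + 2 else round (x i)
  refine ⟨w0, ?_, l1Dist_le_card_mul fun i => ?_⟩
  · have h1 := h.lt_perturbed w0
    have h2 : (w0 (last d) : ℝ) = ⌊x (last d)⌋ + 2 := by simp [w0]
    have h3 := Int.lt_floor_add_one (x (last d))
    linarith
  · have h1 := abs_lt.1 (h.abs_perturbed_sub_lt w0 i)
    have h3 := Int.lt_floor_add_one (x i)
    have h4 := Int.floor_le (x i)
    have h5 := abs_le.1 (abs_sub_round (x i))
    rw [abs_le]
    by_cases hi : i = last d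
    · have h2 : (w0 i : ℝ) = ⌊x i⌋ + 2 := by simp [w0, hi]
      constructor <;> linarith
    · have h2 : (w0 i : ℝ) = round (x i) := by simp [w0, hi]
      constructor <;> linarith

theorem Nice.exists_isNext {ξ : Env d} (h : Nice ξ) (x : Pt d) : ∃ w, IsNext ξ x w := by
  obtain ⟨w0, hw0, hd0⟩ := h.exists_candidate x
  let s : Set (Site d) := {w | x (last d) < perturbed ξ w (last d) ∧
    l1Dist (perturbed ξ w) x ≤ d * 3}
  have hfin : s.Finite := by
    refine (Set.finite_Icc (fun i => ⌊x i - (d * 3 + 1)⌋) (fun i => ⌈x i + (d * 3 + 1)⌉)).subset ?_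
    intro w hw
    have key : ∀ i, |(w i : ℝ) - x i| ≤ d * 3 + 1 := fun i => by
      have h1 := (abs_sub_le_l1Dist (perturbed ξ w) x i).trans hw.2
      have h2 := h.abs_perturbed_sub_lt w i
      rw [abs_le] at *; rw [abs_lt] at h2
      constructor <;> linarith
    refine ⟨fun i => ?_, fun i => ?_⟩
    · have := abs_le.1 (key i)
      exact_mod_cast (Int.floor_le _).trans (by linarith : x i - (d * 3 + 1) ≤ (w i : ℝ))
    · have := abs_le.1 (key i)
      exact_mod_cast (by linarith : (w i : ℝ) ≤ x i + (d * 3 + 1)).trans (Int.le_ceil _)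
  obtain ⟨w, hw, hmin⟩ := Set.exists_min_image s (fun w => l1Dist (perturbed ξ w) x) hfin
    ⟨w0, hw0, hd0⟩
  refine ⟨w, hw.1, fun w' hw' => ?_⟩
  by_cases hs : l1Dist (perturbed ξ w') x ≤ d * 3
  · exact hmin w' ⟨hw', hs⟩
  · exact hw.2.trans (not_le.1 hs).le

theorem Nice.isNext_nextSite {ξ : Env d} (h : Nice ξ) (x : Pt d) : IsNext ξ x (nextSite ξ x) :=
  firstSite_spec (h.exists_isNext x)

theorem Nice.lt_next {ξ : Env d} (h : Nice ξ) (x : Pt d) : x (last d) < next ξ x (last d) :=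
  (h.isNext_nextSite x).1

theorem Nice.l1Dist_next_le {ξ : Env d} (h : Nice ξ) {x : Pt d} {w : Site d}
    (hw : x (last d) < perturbed ξ w (last d)) :
    l1Dist (next ξ x) x ≤ l1Dist (perturbed ξ w) x :=
  (h.isNext_nextSite x).2 w hw

theorem Nice.l1Dist_next_le_three_mul {ξ : Env d} (h : Nice ξ) (x : Pt d) :
    l1Dist (next ξ x) x ≤ 3 * d := by
  obtain ⟨w0, hw0, hd0⟩ := h.exists_candidate x
  linarith [h.l1Dist_next_le hw0]

theorem Nice.next_le_add {ξ : Env d} (h : Nice ξ) (x : Pt d) :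
    next ξ x (last d) ≤ x (last d) + 3 * d := by
  have h1 := (abs_sub_le_l1Dist (next ξ x) x (last d)).trans (h.l1Dist_next_le_three_mul x)
  linarith [le_abs_self (next ξ x (last d) - x (last d))]

theorem perturbed_congr {d : ℕ} {ξ ξ' : Env d} {z : Site d} (hz : ξ' z = ξ z) :
    perturbed ξ' z = perturbed ξ z := by
  funext i
  simp only [perturbed, hz]

/-- The next vertex does not change when the environment is modified at sites whose new points
are too far away (or too low) to compete, the chosen site being left alone. -/
theorem nextSite_congr {ξ ξ' : Env d} (h : Nice ξ) {x : Pt d}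
    (hy : ξ' (nextSite ξ x) = ξ (nextSite ξ x))
    (hz : ∀ z, ξ' z = ξ z ∨ perturbed ξ' z (last d) ≤ x (last d) ∨
      l1Dist (next ξ x) x < l1Dist (perturbed ξ' z) x) : nextSite ξ' x = nextSite ξ x := by
  have hp : ∀ z, ξ' z = ξ z → perturbed ξ' z = perturbed ξ z := fun z hz => perturbed_congr hz
  have hN := h.isNext_nextSite x
  have hy' := hp _ hy
  refine firstSite_eq_of_imp (fun z hzN => ?_) ⟨?_, fun z hzl => ?_⟩
  · have hle : l1Dist (perturbed ξ' z) x ≤ l1Dist (next ξ x) x := by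
      have := hzN.2 (nextSite ξ x) (by rw [hy']; exact hN.1)
      rwa [hy'] at this
    have hzz : ξ' z = ξ z := by
      rcases hz z with h1 | h1 | h1
      · exact h1
      · exact absurd hzN.1 (not_lt.2 h1)
      · exact absurd hle (not_le.2 h1)
    refine ⟨hp z hzz ▸ hzN.1, fun z' hz' => ?_⟩
    rw [← hp z hzz]
    exact hle.trans (hN.2 z' hz')
  · change x (last d) < perturbed ξ' (nextSite ξ x) (last d)
    rw [hy']; exact hN.1
  · change l1Dist (perturbed ξ' (nextSite ξ x)) x ≤ _
    rw [hy']
    rcases hz z with h1 | h1 | h1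
    · rw [hp z h1] at hzl ⊢
      exact hN.2 z hzl
    · exact absurd hzl (not_lt.2 h1)
    · exact h1.le

theorem next_congr {ξ ξ' : Env d} (h : Nice ξ) {x : Pt d}
    (hy : ξ' (nextSite ξ x) = ξ (nextSite ξ x))
    (hz : ∀ z, ξ' z = ξ z ∨ perturbed ξ' z (last d) ≤ x (last d) ∨
      l1Dist (next ξ x) x < l1Dist (perturbed ξ' z) x) : next ξ' x = next ξ x := by
  rw [next_eq_perturbed, next_eq_perturbed, nextSite_congr h hy hz, perturbed_congr hy]

/-- The step from `x` depends only on the sites of levels below `L` if `x` lies well below `L`. -/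
theorem nextSite_congr_of_level {ξ ξ' : Env d} (h : Nice ξ) (h' : Nice ξ') {L : ℤ}
    (hag : ∀ w : Site d, w (last d) < L → ξ' w = ξ w) {x : Pt d}
    (hx : x (last d) + 3 * d + 1 ≤ L) :
    nextSite ξ' x = nextSite ξ x ∧ next ξ' x = next ξ x := by
  have hy : ξ' (nextSite ξ x) = ξ (nextSite ξ x) := by
    apply hag
    have h1 := h.lt_perturbed (nextSite ξ x)
    have h2 := h.next_le_add x
    rw [next_eq_perturbed] at h2
    have : ((nextSite ξ x (last d) : ℤ) : ℝ) < L := by linarith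
    exact_mod_cast this
  have hz : ∀ z, ξ' z = ξ z ∨ perturbed ξ' z (last d) ≤ x (last d) ∨
      l1Dist (next ξ x) x < l1Dist (perturbed ξ' z) x := fun z => by
    by_cases hzL : z (last d) < L
    · exact Or.inl (hag z hzL)
    · right; right
      have h1 := h'.lt_perturbed z
      have h2 : (L : ℝ) ≤ z (last d) := by exact_mod_cast not_lt.1 hzL
      have h3 := abs_sub_le_l1Dist (perturbed ξ' z) x (last d)
      have h4 := le_abs_self (perturbed ξ' z (last d) - x (last d))
      have h5 := h.l1Dist_next_le_three_mul x
      linarith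
  exact ⟨nextSite_congr h hy hz, next_congr h hy hz⟩

/-! ### The orbit of a point and the joint exploration -/

/-- The joint exploration started from an arbitrary pair of points. -/
noncomputable def jointFrom (x : Pt d × Pt d) (ξ : Env d) : Fin 2 → ℕ → Pt d :=
  fun i n => ![((jointStep ξ)^[n] x).1, ((jointStep ξ)^[n] x).2] i

theorem jointPath_eq_jointFrom (u v : Site d) :
    (jointPath u v : Env d → Fin 2 → ℕ → Pt d) = jointFrom (toPt u, toPt v) := rfl

theorem jointFrom_add (x : Pt d × Pt d) (ξ : Env d) (i : Fin 2) (t n : ℕ) :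
    jointFrom x ξ i (t + n) = jointFrom (jointFrom x ξ 0 t, jointFrom x ξ 1 t) ξ i n := by
  simp only [jointFrom, Matrix.cons_val_zero, Matrix.cons_val_one, Prod.mk.eta,
    ← Function.iterate_add_apply, add_comm n t]

/-- The path is on the lowest lattice level, so it moves in the next step. -/
def Lowest {k : ℕ} (g : Fin k → ℕ → Pt d) (i : Fin k) (n : ℕ) : Prop :=
  ∀ j, ⌊g i n (last d)⌋ ≤ ⌊g j n (last d)⌋

theorem jointFrom_succ_of_not_lowest {x : Pt d × Pt d} {ξ : Env d} {i : Fin 2} {n : ℕ}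
    (h : ¬ Lowest (jointFrom x ξ) i n) : jointFrom x ξ i (n + 1) = jointFrom x ξ i n := by
  simp only [Lowest, Fin.forall_fin_two, jointFrom, Function.iterate_succ_apply'] at *
  generalize (jointStep ξ)^[n] x = p at *
  obtain rfl | rfl : i = 0 ∨ i = 1 := by fin_cases i <;> simp
  · have hl : ⌊p.2 (last d)⌋ < ⌊p.1 (last d)⌋ := by simpa using h
    simp [jointStep, hl, not_lt.2 hl.le]
  · have hl : ⌊p.1 (last d)⌋ < ⌊p.2 (last d)⌋ := by simpa using h
    simp [jointStep, hl]

/-- A path on the lowest level moves to its next vertex, or, if that is the position of the other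
path, to the next vertex of the other path. -/
theorem jointFrom_succ_of_lowest {x : Pt d × Pt d} {ξ : Env d} {i : Fin 2} {n : ℕ}
    (h : Lowest (jointFrom x ξ) i n) :
    jointFrom x ξ i (n + 1) = next ξ (jointFrom x ξ i n) ∨
      ∃ j, Lowest (jointFrom x ξ) j n ∧ next ξ (jointFrom x ξ i n) = jointFrom x ξ j n ∧
        jointFrom x ξ i (n + 1) = next ξ (jointFrom x ξ j n) := by
  simp only [Lowest, Fin.forall_fin_two, Fin.exists_fin_two, jointFrom,
    Function.iterate_succ_apply'] at *
  generalize (jointStep ξ)^[n] x = p at *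
  obtain rfl | rfl : i = 0 ∨ i = 1 := by fin_cases i <;> simp
  · have hl : ⌊p.1 (last d)⌋ ≤ ⌊p.2 (last d)⌋ := by simpa using h
    rcases hl.lt_or_eq with hlt | heq
    · simp [jointStep, hlt]
    · by_cases ha : next ξ p.1 = p.2
      · simp [jointStep, heq, ha]
      · by_cases hb : next ξ p.2 = p.1
        · simp [jointStep, heq, ha, hb]
        · simp [jointStep, heq, ha, hb]
  · have hl : ⌊p.2 (last d)⌋ ≤ ⌊p.1 (last d)⌋ := by simpa using h
    rcases hl.lt_or_eq with hlt | heq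
    · simp [jointStep, hlt, not_lt.2 hlt.le]
    · by_cases ha : next ξ p.1 = p.2
      · simp [jointStep, heq, ha]
      · by_cases hb : next ξ p.2 = p.1
        · simp [jointStep, heq, ha, hb]
        · simp [jointStep, heq, ha, hb]

theorem exists_lowest (x : Pt d × Pt d) (ξ : Env d) (n : ℕ) :
    ∃ i, Lowest (jointFrom x ξ) i n := by
  rcases le_total ⌊jointFrom x ξ 0 n (last d)⌋ ⌊jointFrom x ξ 1 n (last d)⌋ with h | h
  · exact ⟨0, by simpa [Lowest, Fin.forall_fin_two] using h⟩
  · exact ⟨1, by simpa [Lowest, Fin.forall_fin_two] using h⟩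

theorem jointFrom_succ_congr {x : Pt d × Pt d} {ξ ξ' : Env d} {n : ℕ}
    (hn : ∀ i, jointFrom x ξ' i n = jointFrom x ξ i n)
    (h : ∀ i, Lowest (jointFrom x ξ) i n →
      next ξ' (jointFrom x ξ i n) = next ξ (jointFrom x ξ i n)) (i : Fin 2) :
    jointFrom x ξ' i (n + 1) = jointFrom x ξ i (n + 1) := by
  simp only [Lowest, Fin.forall_fin_two] at *
  simp only [jointFrom, Function.iterate_succ_apply', Matrix.cons_val_zero,
    Matrix.cons_val_one] at *
  have hp : (jointStep ξ')^[n] x = (jointStep ξ)^[n] x := Prod.ext hn.1 hn.2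
  rw [hp]
  generalize (jointStep ξ)^[n] x = p at *
  suffices jointStep ξ' p = jointStep ξ p by rw [this]
  simp only [le_refl, true_and, and_true] at h
  rcases lt_trichotomy ⌊p.1 (last d)⌋ ⌊p.2 (last d)⌋ with hl | hl | hl
  · simp [jointStep, hl, h.1 hl.le]
  · have h1 := h.1 hl.le
    have h2 := h.2 hl.ge
    simp only [jointStep, hl, lt_irrefl, if_false, h1, h2]
    by_cases ha : next ξ p.1 = p.2
    · simp [ha, h2]
    · by_cases hb : next ξ p.2 = p.1
      · simp [ha, hb, h1]
      · simp [ha, hb]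
  · simp [jointStep, hl, not_lt.2 hl.le, h.2 hl.le]

theorem jointFrom_le_succ {ξ : Env d} (hξ : Nice ξ) (x : Pt d × Pt d) (i : Fin 2) (n : ℕ) :
    jointFrom x ξ i n (last d) ≤ jointFrom x ξ i (n + 1) (last d) := by
  by_cases h : Lowest (jointFrom x ξ) i n
  · rcases jointFrom_succ_of_lowest h with h1 | ⟨j, -, h1, h2⟩
    · rw [h1]; exact (hξ.lt_next _).le
    · rw [h2, ← h1]; exact ((hξ.lt_next _).trans (hξ.lt_next _)).le
  · rw [jointFrom_succ_of_not_lowest h]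

theorem jointFrom_lt_succ {ξ : Env d} (hξ : Nice ξ) (x : Pt d × Pt d) {i : Fin 2} {n : ℕ}
    (h : Lowest (jointFrom x ξ) i n) :
    jointFrom x ξ i n (last d) < jointFrom x ξ i (n + 1) (last d) := by
  rcases jointFrom_succ_of_lowest h with h1 | ⟨j, -, h1, h2⟩
  · rw [h1]; exact hξ.lt_next _
  · rw [h2, ← h1]; exact (hξ.lt_next _).trans (hξ.lt_next _)

theorem jointFrom_succ_le {ξ : Env d} (hξ : Nice ξ) (x : Pt d × Pt d) (i : Fin 2) (n : ℕ) :
    jointFrom x ξ i (n + 1) (last d) ≤ jointFrom x ξ i n (last d) + 6 * d := by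
  have hd : (0 : ℝ) ≤ d := Nat.cast_nonneg d
  by_cases h : Lowest (jointFrom x ξ) i n
  · have h0 := hξ.next_le_add (jointFrom x ξ i n)
    rcases jointFrom_succ_of_lowest h with h1 | ⟨j, -, h1, h2⟩
    · rw [h1]; linarith
    · rw [h2, ← h1]; linarith [hξ.next_le_add (next ξ (jointFrom x ξ i n))]
  · rw [jointFrom_succ_of_not_lowest h]; linarith

theorem jointFrom_mono {ξ : Env d} (hξ : Nice ξ) (x : Pt d × Pt d) (i : Fin 2) :
    Monotone fun n => jointFrom x ξ i n (last d) :=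
  monotone_nat_of_le_succ (jointFrom_le_succ hξ x i)

/-- The two paths stay at comparable heights. -/
theorem jointFrom_le_add {ξ : Env d} (hξ : Nice ξ) {x : Pt d × Pt d}
    (hx : ∀ i j, jointFrom x ξ i 0 (last d) ≤ jointFrom x ξ j 0 (last d) + 1) (n : ℕ)
    (i j : Fin 2) :
    jointFrom x ξ i n (last d) ≤ jointFrom x ξ j n (last d) + 1 + 6 * d := by
  have hd : (0 : ℝ) ≤ d := Nat.cast_nonneg d
  induction n with
  | zero => linarith [hx i j]
  | succ n ih =>
    have hj := jointFrom_le_succ hξ x j n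
    by_cases h : Lowest (jointFrom x ξ) i n
    · have h1 := jointFrom_succ_le hξ x i n
      have h2 : (⌊jointFrom x ξ i n (last d)⌋ : ℝ) ≤ ⌊jointFrom x ξ j n (last d)⌋ := by
        exact_mod_cast h j
      have h3 := Int.lt_floor_add_one (jointFrom x ξ i n (last d))
      have h4 := Int.floor_le (jointFrom x ξ j n (last d))
      linarith
    · rw [jointFrom_succ_of_not_lowest h]; linarith

/-- For `u = v` both paths of the joint exploration are the single path. -/
theorem jointPath_self (u : Site d) (ξ : Env d) (i : Fin 2) (n : ℕ) :
    jointPath u u ξ i n = singlePath u ξ 0 n := by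
  have h : ∀ n, (jointStep ξ)^[n] (toPt u, toPt u) =
      ((next ξ)^[n] (toPt u), (next ξ)^[n] (toPt u)) := by
    intro n
    induction n with
    | zero => rfl
    | succ n ih =>
      simp only [Function.iterate_succ_apply', ih]
      generalize (next ξ)^[n] (toPt u) = p
      by_cases hp : next ξ p = p <;> simp [jointStep, hp]
  fin_cases i <;> simp [jointPath, singlePath, h]

end Geometry

/-! ### Orbits of the next-vertex map -/

section Orbit

variable {d : ℕ}

/-- The sites `a` and `b` differ by at most `r` in every coordinate. -/
def Near (r : ℕ) (a b : Site d) : Prop := ∀ i, |b i - a i| ≤ (r : ℤ)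

theorem Near.trans {r s : ℕ} {a b c : Site d} (h : Near r a b) (h' : Near s b c) :
    Near (r + s) a c := fun i => by
  have := abs_sub_le (c i) (b i) (a i)
  have h1 := h i
  have h2 := h' i
  push_cast; linarith

variable [NeZero d]

/-- The point reached from `x` after `k` steps of `h`. -/
noncomputable def orb (ξ : Env d) (x : Pt d) (k : ℕ) : Pt d := (next ξ)^[k] x

/-- The lattice vertex of the `k`-th point of the orbit of `x`; the start `x` itself need not be a
perturbed point, and is assigned the vertex `w`. -/
noncomputable def orbSite (ξ : Env d) (x : Pt d) (w : Site d) : ℕ → Site d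
  | 0 => w
  | k + 1 => nextSite ξ (orb ξ x k)

theorem orb_zero (ξ : Env d) (x : Pt d) : orb ξ x 0 = x := rfl

theorem orb_succ (ξ : Env d) (x : Pt d) (k : ℕ) : orb ξ x (k + 1) = next ξ (orb ξ x k) :=
  Function.iterate_succ_apply' _ _ _

theorem orb_succ_eq_perturbed (ξ : Env d) (x : Pt d) (w : Site d) (k : ℕ) :
    orb ξ x (k + 1) = perturbed ξ (orbSite ξ x w (k + 1)) := orb_succ ξ x k

theorem orb_strictMono {ξ : Env d} (h : Nice ξ) (x : Pt d) :
    StrictMono fun k => orb ξ x k (last d) :=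
  strictMono_nat_of_lt_succ fun k => by rw [orb_succ]; exact h.lt_next _

theorem orb_succ_le {ξ : Env d} (h : Nice ξ) (x : Pt d) (k : ℕ) :
    orb ξ x (k + 1) (last d) ≤ orb ξ x k (last d) + 3 * d := by
  rw [orb_succ]; exact h.next_le_add _

theorem near_orbSite {ξ : Env d} (h : Nice ξ) {x : Pt d} {w : Site d}
    (hx : ∀ i, |x i - w i| ≤ 1) (k : ℕ) :
    Near (3 * d + 2) (orbSite ξ x w k) (orbSite ξ x w (k + 1)) := by
  intro i
  have h0 : |orb ξ x k i - orbSite ξ x w k i| ≤ 1 := by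
    cases k with
    | zero => exact hx i
    | succ k => rw [orb_succ_eq_perturbed ξ x w]; exact (h.abs_perturbed_sub_lt _ i).le
  have h1 : |orb ξ x (k + 1) i - orbSite ξ x w (k + 1) i| ≤ 1 := by
    rw [orb_succ_eq_perturbed ξ x w]; exact (h.abs_perturbed_sub_lt _ i).le
  have h2 : |orb ξ x (k + 1) i - orb ξ x k i| ≤ 3 * d := by
    rw [orb_succ]
    exact (abs_sub_le_l1Dist _ _ i).trans (h.l1Dist_next_le_three_mul _)
  have : |((orbSite ξ x w (k + 1) i : ℤ) : ℝ) - orbSite ξ x w k i| ≤ 3 * d + 2 := by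
    rw [abs_le] at *; constructor <;> linarith
  exact_mod_cast this

theorem near_orbSite_add {ξ : Env d} (h : Nice ξ) {x : Pt d} {w : Site d}
    (hx : ∀ i, |x i - w i| ≤ 1) (k n : ℕ) :
    Near ((3 * d + 2) * n) (orbSite ξ x w k) (orbSite ξ x w (k + n)) := by
  induction n with
  | zero => intro i; simp
  | succ n ih =>
    have := ih.trans (near_orbSite h hx (k + n))
    rwa [← Nat.mul_succ] at this

/-- The start of one of the two paths. -/
def startPt (x : Pt d × Pt d) (i : Fin 2) : Pt d := ![x.1, x.2] i

theorem jointFrom_zero (x : Pt d × Pt d) (ξ : Env d) (i : Fin 2) :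
    jointFrom x ξ i 0 = startPt x i := rfl

/-- The paths of the joint exploration run along the orbits of their starting points; a step of
the exploration makes at most two moves on either orbit, and at least one in total. -/
theorem exists_jointFrom_eq_orb (x : Pt d × Pt d) (ξ : Env d) :
    ∃ c : Fin 2 → ℕ → ℕ, (∀ i n, jointFrom x ξ i n = orb ξ (startPt x i) (c i n)) ∧
      (∀ i n, c i n ≤ 2 * n) ∧ ∀ n, n ≤ c 0 n + c 1 n := by
  have hstep : ∀ i n, ∃ e : ℕ, e ≤ 2 ∧ (Lowest (jointFrom x ξ) i n → 1 ≤ e) ∧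
      jointFrom x ξ i (n + 1) = (next ξ)^[e] (jointFrom x ξ i n) := by
    intro i n
    by_cases h : Lowest (jointFrom x ξ) i n
    · rcases jointFrom_succ_of_lowest h with h1 | ⟨j, -, h1, h2⟩
      · exact ⟨1, by norm_num, fun _ => le_rfl, h1⟩
      · exact ⟨2, le_rfl, fun _ => by norm_num, by rw [h2, ← h1]; rfl⟩
    · exact ⟨0, by norm_num, fun h' => absurd h' h, jointFrom_succ_of_not_lowest h⟩
  choose e he2 he1 hes using hstep
  refine ⟨fun i n => ∑ s ∈ Finset.range n, e i s, fun i n => ?_, fun i n => ?_, fun n => ?_⟩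
  · induction n with
    | zero => rfl
    | succ n ih =>
      beta_reduce at *
      rw [hes, ih, orb, orb, ← Function.iterate_add_apply, Finset.sum_range_succ, add_comm]
  · simpa [mul_comm] using Finset.sum_le_card_nsmul (Finset.range n) (e i) 2 fun s _ => he2 i s
  · induction n with
    | zero => simp
    | succ n ih =>
      simp only [Finset.sum_range_succ] at *
      obtain ⟨i, hi⟩ := exists_lowest x ξ n
      have := he1 i n hi
      fin_cases i <;> simp at this <;> omega

/-! ### The height of the explored region -/

theorem mem_history {ξ : Env d} (hξ : Nice ξ) (x : Pt d × Pt d) {n : ℕ} {y : Pt d}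
    (hy : y ∈ history ξ (jointFrom x ξ) n) :
    (⨅ i, jointFrom x ξ i n (last d)) ≤ y (last d) ∧
      ∀ j, y (last d) ≤ jointFrom x ξ j n (last d) + (3 * d + 1) := by
  induction n with
  | zero => exact hy.elim
  | succ n ih =>
    refine ⟨hy.2, fun j => ?_⟩
    have hj := jointFrom_le_succ hξ x j n
    rcases hy.1 with ⟨i, hi, hb⟩ | hb
    · have h1 := (abs_sub_le_l1Dist y (jointFrom x ξ i n) (last d)).trans
        (hb.2.1.trans (hξ.l1Dist_next_le_three_mul _))
      have h2 : (⌊jointFrom x ξ i n (last d)⌋ : ℝ) ≤ ⌊jointFrom x ξ j n (last d)⌋ := by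
        exact_mod_cast hi j
      have h3 := Int.lt_floor_add_one (jointFrom x ξ i n (last d))
      have h4 := Int.floor_le (jointFrom x ξ j n (last d))
      linarith [le_abs_self (y (last d) - jointFrom x ξ i n (last d))]
    · linarith [(ih hb).2 j]

theorem sub_le_of_mem_history {ξ : Env d} (hξ : Nice ξ) (x : Pt d × Pt d) {n : ℕ} {y z : Pt d}
    (hy : y ∈ history ξ (jointFrom x ξ) n) (hz : z ∈ history ξ (jointFrom x ξ) n) :
    y (last d) - z (last d) ≤ 3 * d + 1 := by
  have h1 := mem_history hξ x hy
  have h2 := mem_history hξ x hz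
  have h3 : y (last d) - (3 * d + 1) ≤ ⨅ i, jointFrom x ξ i n (last d) :=
    le_ciInf fun j => by linarith [h1.2 j]
  linarith [h2.1]

theorem height_history_le {ξ : Env d} (hξ : Nice ξ) (x : Pt d × Pt d) (n : ℕ) :
    height (history ξ (jointFrom x ξ) n) ≤ 3 * d + 1 := by
  refine Real.sSup_le ?_ (by positivity)
  rintro t ⟨y, hy, z, hz, rfl⟩
  exact sub_le_of_mem_history hξ x hy hz

theorem sub_le_height_history {ξ : Env d} (hξ : Nice ξ) (x : Pt d × Pt d) {n : ℕ} {y z : Pt d}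
    (hy : y ∈ history ξ (jointFrom x ξ) n) (hz : z ∈ history ξ (jointFrom x ξ) n) :
    y (last d) - z (last d) ≤ height (history ξ (jointFrom x ξ) n) := by
  refine le_csSup ⟨3 * d + 1, ?_⟩ ⟨y, hy, z, hz, rfl⟩
  rintro t ⟨y, hy, z, hz, rfl⟩
  exact sub_le_of_mem_history hξ x hy hz

end Orbit

/-! ### Product measures on environments -/

section Product

open scoped ENNReal

variable {d : ℕ}

open Classical in
/-- The environment that is `ξ` on the sites of `S` and `ζ` elsewhere. -/
noncomputable def glue (S : Set (Site d)) (ξ ζ : Env d) : Env d :=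
  fun w => if w ∈ S then ξ w else ζ w

theorem glue_of_mem {S : Set (Site d)} {w : Site d} (h : w ∈ S) (ξ ζ : Env d) :
    glue S ξ ζ w = ξ w := if_pos h

theorem glue_of_notMem {S : Set (Site d)} {w : Site d} (h : w ∉ S) (ξ ζ : Env d) :
    glue S ξ ζ w = ζ w := if_neg h

theorem Nice.glue {S : Set (Site d)} {ξ ζ : Env d} (h : Nice ξ) (h' : Nice ζ) :
    Nice (glue S ξ ζ) := fun w => by
  by_cases hw : w ∈ S
  · rw [glue_of_mem hw]; exact h w
  · rw [glue_of_notMem hw]; exact h' w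

theorem measurable_glue (S : Set (Site d)) :
    Measurable fun p : Env d × Env d => glue S p.1 p.2 := by
  refine measurable_pi_lambda _ fun w => ?_
  by_cases hw : w ∈ S
  · simp only [glue_of_mem hw]; exact (measurable_pi_apply w).comp measurable_fst
  · simp only [glue_of_notMem hw]; exact (measurable_pi_apply w).comp measurable_snd

/-- Resampling: taking the sites of `S` from one sample and the others from an independent
sample of the same product measure gives that product measure again. -/
theorem map_glue_prod (κ : Site d → Measure (Pt d)) [∀ w, IsProbabilityMeasure (κ w)]
    (S : Set (Site d)) :
    ((Measure.infinitePi κ).prod (Measure.infinitePi κ)).map (fun p => glue S p.1 p.2) =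
      Measure.infinitePi κ := by
  classical
  refine Measure.eq_infinitePi _ fun s t ht => ?_
  rw [Measure.map_apply (measurable_glue S)
    (MeasurableSet.pi s.countable_toSet fun _ _ => ht _)]
  have hpre : (fun p : Env d × Env d => glue S p.1 p.2) ⁻¹' (Set.pi (s : Set (Site d)) t) =
      (Set.pi ((s.filter (· ∈ S) : Finset (Site d)) : Set (Site d)) t) ×ˢ
        (Set.pi ((s.filter (· ∉ S) : Finset (Site d)) : Set (Site d)) t) := by
    ext p
    simp only [Set.mem_preimage, Set.mem_pi, Set.mem_prod, Finset.coe_filter, Set.mem_ofPred_eq,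
      Finset.mem_coe]
    constructor
    · refine fun h => ⟨fun w hw => ?_, fun w hw => ?_⟩
      · simpa only [glue_of_mem hw.2] using h w hw.1
      · simpa only [glue_of_notMem hw.2] using h w hw.1
    · rintro ⟨h1, h2⟩ w hw
      by_cases hwS : w ∈ S
      · rw [glue_of_mem hwS]; exact h1 w ⟨hw, hwS⟩
      · rw [glue_of_notMem hwS]; exact h2 w ⟨hw, hwS⟩
  rw [hpre, Measure.prod_prod, Measure.infinitePi_pi _ fun w _ => ht w,
    Measure.infinitePi_pi _ fun w _ => ht w, Finset.prod_filter_mul_prod_filter_not]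

theorem lintegral_eq_glue (κ : Site d → Measure (Pt d)) [∀ w, IsProbabilityMeasure (κ w)]
    (S : Set (Site d)) {F : Env d → ℝ≥0∞} (hF : Measurable F) :
    ∫⁻ ξ, F ξ ∂Measure.infinitePi κ =
      ∫⁻ ξ, ∫⁻ ζ, F (glue S ξ ζ) ∂Measure.infinitePi κ ∂Measure.infinitePi κ := by
  conv_lhs => rw [← map_glue_prod κ S]
  rw [lintegral_map hF (measurable_glue S)]
  exact lintegral_prod _ (hF.comp (measurable_glue S)).aemeasurable

/-- Functions of disjoint sets of sites are independent. The dependence on the sites is required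
only within the environments of full measure that are `Nice`. -/
theorem lintegral_mul_of_disjoint (κ : Site d → Measure (Pt d)) [∀ w, IsProbabilityMeasure (κ w)]
    (hκ : ∀ᵐ ξ ∂Measure.infinitePi κ, Nice ξ) (S : Set (Site d)) {f g : Env d → ℝ≥0∞}
    (hf : Measurable f) (hg : Measurable g)
    (hfS : ∀ ξ ξ', Nice ξ → Nice ξ' → (∀ w ∈ S, ξ w = ξ' w) → f ξ = f ξ')
    (hgS : ∀ ξ ξ', Nice ξ → Nice ξ' → (∀ w ∉ S, ξ w = ξ' w) → g ξ = g ξ') :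
    ∫⁻ ξ, f ξ * g ξ ∂Measure.infinitePi κ =
      (∫⁻ ξ, f ξ ∂Measure.infinitePi κ) * ∫⁻ ξ, g ξ ∂Measure.infinitePi κ := by
  rw [lintegral_eq_glue κ S (F := fun ξ => f ξ * g ξ) (hf.mul hg), ← lintegral_mul_const _ hf]
  refine lintegral_congr_ae (hκ.mono fun ξ hξ => ?_)
  change _ = f ξ * ∫⁻ ξ, g ξ ∂Measure.infinitePi κ
  rw [← lintegral_const_mul _ hg]
  refine lintegral_congr_ae (hκ.mono fun ζ hζ => ?_)
  change f (glue S ξ ζ) * g (glue S ξ ζ) = f ξ * g ζ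
  rw [hfS _ ξ (hξ.glue hζ) hξ fun w hw => glue_of_mem hw _ _,
    hgS _ ζ (hξ.glue hζ) hζ fun w hw => glue_of_notMem hw _ _]

theorem ae_nice_infinitePi (κ : Site d → Measure (Pt d)) [∀ w, IsProbabilityMeasure (κ w)]
    (hκ : ∀ w, ∀ᵐ x ∂κ w, ∀ i, |x i| < 1) : ∀ᵐ ξ ∂Measure.infinitePi κ, Nice ξ := by
  unfold Nice
  refine ae_all_iff.2 fun w => ?_
  exact (measurePreserving_eval_infinitePi κ w).quasiMeasurePreserving.ae (hκ w)

/-- The uniform distribution on `[-1, 1]^d`. -/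
noncomputable def cubeLaw (d : ℕ) : Measure (Pt d) :=
  ProbabilityTheory.cond volume (Set.Icc (-1 : Pt d) 1)

theorem volume_cube : volume (Set.Icc (-1 : Pt d) 1) = 2 ^ d := by
  rw [Real.volume_Icc_pi]
  norm_num

instance : IsProbabilityMeasure (cubeLaw d) :=
  cond_isProbabilityMeasure_of_finite (by rw [volume_cube]; positivity)
    (by rw [volume_cube]; exact ENNReal.pow_ne_top (by norm_num))

theorem ae_cubeLaw : ∀ᵐ x ∂cubeLaw d, ∀ i, |x i| < 1 := by
  have h1 : ∀ᵐ x ∂(volume : Measure (Pt d)), x ∈ Set.Icc (-1 : Pt d) 1 → ∀ i, |x i| < 1 := by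
    have h := Measure.univ_pi_Ioo_ae_eq_Icc (μ := fun _ : Fin d => (volume : Measure ℝ))
      (f := -1) (g := 1)
    filter_upwards [h.mem_iff] with x hx hxI i
    exact abs_lt.2 ((hx.2 hxI) i (Set.mem_univ i))
  rw [cubeLaw, ProbabilityTheory.cond]
  refine Measure.ae_smul_measure ?_ _
  exact (ae_restrict_iff' measurableSet_Icc).2 h1

/-- The probability that a uniform perturbation is within `η` of a given vector. -/
theorem cubeLaw_closeTo {η : ℝ} (hη : 0 ≤ η) (c : Pt d) (hc : ∀ i, |c i| + η ≤ 1) :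
    cubeLaw d {x | ∀ i, |x i - c i| ≤ η} = ENNReal.ofReal (η ^ d) := by
  have hset : {x : Pt d | ∀ i, |x i - c i| ≤ η} =
      Set.Icc (fun i => c i - η) (fun i => c i + η) := by
    ext x
    simp only [Set.mem_ofPred_eq, Set.mem_Icc, Pi.le_def, ← forall_and]
    refine forall_congr' fun i => ?_
    rw [abs_le]
    constructor <;> rintro ⟨h1, h2⟩ <;> constructor <;> linarith
  have hsub : Set.Icc (fun i => c i - η) (fun i => c i + η) ⊆ Set.Icc (-1 : Pt d) 1 := by
    refine Set.Icc_subset_Icc (fun i => ?_) fun i => ?_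
    · have := hc i; have := neg_abs_le (c i); simp only [Pi.neg_apply, Pi.one_apply]; linarith
    · have := hc i; have := le_abs_self (c i); simp only [Pi.one_apply]; linarith
  rw [hset, cubeLaw, cond_apply measurableSet_Icc, Set.inter_eq_right.2 hsub, volume_cube,
    Real.volume_Icc_pi]
  simp only [add_sub_sub_cancel, Finset.prod_const, Finset.card_univ, Fintype.card_fin]
  rw [← two_mul, ENNReal.ofReal_mul (by norm_num), mul_pow, ← mul_assoc,
    ENNReal.ofReal_ofNat, ENNReal.inv_mul_cancel (by positivity)
      (ENNReal.pow_ne_top (by norm_num)), one_mul, ENNReal.ofReal_pow hη]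

/-- The last coordinate of a uniform perturbation has density at most `1/2`. -/
theorem lintegral_cubeLaw_last_le [NeZero d] {F : ℝ → ℝ≥0∞} (hF : Measurable F) :
    ∫⁻ x, F (x (last d)) ∂cubeLaw d ≤ 2⁻¹ * ∫⁻ t, F t := by
  classical
  have hmap : (volume.restrict (Set.Icc (-1 : Pt d) 1)).map (fun x => x (last d)) =
      (2 : ℝ≥0∞) ^ (d - 1) • volume.restrict (Set.Icc (-1 : ℝ) 1) := by
    have h1 : volume.restrict (Set.Icc (-1 : Pt d) 1) =
        Measure.pi fun _ : Fin d => volume.restrict (Set.Icc (-1 : ℝ) 1) := by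
      rw [← Measure.restrict_pi_pi, Set.pi_univ_Icc]; rfl
    have h2 := Measure.pi_map_eval (fun _ : Fin d => (volume.restrict (Set.Icc (-1 : ℝ) 1)))
      (last d)
    rw [h1]
    refine h2.trans ?_
    congr 1
    simp [Finset.prod_const, Finset.card_erase_of_mem]
    norm_num
  rw [cubeLaw, ProbabilityTheory.cond, lintegral_smul_measure, volume_cube,
    ← lintegral_map hF (measurable_pi_apply (last d)), hmap, lintegral_smul_measure,
    smul_eq_mul, smul_eq_mul, ← mul_assoc]
  refine mul_le_mul' (le_of_eq ?_) (setLIntegral_le_lintegral _ _)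
  obtain ⟨k, rfl⟩ : ∃ k, d = k + 1 := ⟨d - 1, by have := NeZero.pos d; omega⟩
  rw [Nat.add_sub_cancel, pow_succ, ENNReal.mul_inv (Or.inr (by norm_num)) (Or.inr (by norm_num)),
    mul_right_comm, ENNReal.inv_mul_cancel (by positivity) (ENNReal.pow_ne_top (by norm_num)),
    one_mul]

/-- The exponential weight of an upward step. -/
noncomputable def stepWeight (lam t : ℝ) : ℝ≥0∞ :=
  if 0 < t then ENNReal.ofReal (Real.exp (-lam * t)) else 0

theorem measurable_stepWeight (lam : ℝ) : Measurable (stepWeight lam) := by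
  refine Measurable.ite measurableSet_Ioi ?_ measurable_const
  fun_prop

theorem stepWeight_le_one {lam : ℝ} (hl : 0 ≤ lam) (t : ℝ) : stepWeight lam t ≤ 1 := by
  rw [stepWeight]
  split_ifs with h
  · rw [ENNReal.ofReal_le_one, Real.exp_le_one_iff]
    nlinarith
  · exact bot_le

theorem lintegral_stepWeight {lam : ℝ} (hl : 0 < lam) :
    ∫⁻ t, stepWeight lam t = ENNReal.ofReal lam⁻¹ := by
  have h : stepWeight lam =
      (Set.Ioi (0 : ℝ)).indicator fun t => ENNReal.ofReal (Real.exp (-lam * t)) := by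
    funext t
    simp [stepWeight, Set.indicator]
  rw [h, lintegral_indicator measurableSet_Ioi, ← ofReal_integral_eq_lintegral_ofReal
    (integrableOn_exp_mul_Ioi (by linarith) 0) (Filter.Eventually.of_forall fun _ =>
      (Real.exp_pos _).le), integral_exp_mul_Ioi (by linarith)]
  simp

theorem lintegral_stepWeight_cubeLaw_le [NeZero d] {lam : ℝ} (hl : 0 < lam) (s : ℝ) :
    ∫⁻ x, stepWeight lam (s + x (last d)) ∂cubeLaw d ≤ ENNReal.ofReal (2 * lam)⁻¹ := by
  refine (lintegral_cubeLaw_last_le (F := fun t => stepWeight lam (s + t))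
    ((measurable_stepWeight lam).comp (measurable_const_add s))).trans ?_
  rw [lintegral_add_left_eq_self (fun t => stepWeight lam t) s, lintegral_stepWeight hl,
    mul_inv, ENNReal.ofReal_mul (by norm_num), ENNReal.ofReal_inv_of_pos (x := 2) (by norm_num),
    ENNReal.ofReal_ofNat]

end Product

/-! ### Generating functions along an orbit -/

section Chains

open scoped ENNReal

variable {d : ℕ}

/-- The vectors with coordinates at most `r` in absolute value. -/
noncomputable def offsets (d r : ℕ) : Finset (Site d) := Finset.Icc (fun _ => -(r : ℤ)) (fun _ => (r : ℤ))

theorem Near.sub_mem_offsets {r : ℕ} {a b : Site d} (h : Near r a b) : b - a ∈ offsets d r := by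
  rw [offsets, Finset.mem_Icc]
  exact ⟨fun i => (abs_le.1 (h i)).1, fun i => (abs_le.1 (h i)).2⟩

theorem offsets_card_pos (d r : ℕ) : 0 < (offsets d r).card :=
  Finset.card_pos.2 ⟨0, by simp [offsets, Pi.le_def]⟩

/-- A generating function for the sequences of steps that start at `a`, in which some steps are
marked as the entries into the blocks `i, i + 1, …`, with an extra factor `t` for every block `j`
that is entered at a site where the event `D j` occurs. -/
noncomputable def blockWeight (t : ℝ≥0∞) (r : ℕ) (D : ℕ → Site d → Set (Env d)) :
    ℕ → ℕ → Site d → Env d → ℝ≥0∞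
  | 0, _, _, _ => 1
  | n + 1, i, a, ξ => ∑ v ∈ offsets d r, (blockWeight t r D n i (a + v) ξ +
      (1 + (D i (a + v)).indicator (fun _ => t) ξ) * blockWeight t r D n (i + 1) (a + v) ξ)

theorem measurable_blockWeight (t : ℝ≥0∞) (r : ℕ) {D : ℕ → Site d → Set (Env d)}
    (hD : ∀ i a, MeasurableSet (D i a)) (n i : ℕ) (a : Site d) :
    Measurable (blockWeight t r D n i a) := by
  induction n generalizing i a with
  | zero => exact measurable_const
  | succ n ih =>
    change Measurable fun ξ => blockWeight t r D (n + 1) i a ξ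
    simp only [blockWeight]
    refine Finset.measurable_sum _ fun v _ => (ih _ _).add ?_
    exact (measurable_const.add (measurable_const.indicator (hD _ _))).mul (ih _ _)

theorem blockWeight_congr (t : ℝ≥0∞) (r : ℕ) {D : ℕ → Site d → Set (Env d)}
    {T : ℕ → Set (Site d)}
    (hD : ∀ i a ξ ξ', (∀ w ∈ T i, ξ w = ξ' w) → (ξ ∈ D i a ↔ ξ' ∈ D i a))
    (n i : ℕ) (a : Site d) {ξ ξ' : Env d} (h : ∀ j, i ≤ j → ∀ w ∈ T j, ξ w = ξ' w) :
    blockWeight t r D n i a ξ = blockWeight t r D n i a ξ' := by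
  classical
  induction n generalizing i a with
  | zero => rfl
  | succ n ih =>
    simp only [blockWeight]
    refine Finset.sum_congr rfl fun v _ => ?_
    rw [ih i _ h, ih (i + 1) _ fun j hj => h j (by omega)]
    simp only [Set.indicator, hD i (a + v) ξ ξ' (h i le_rfl)]

/-- If the events `D i` of different blocks are independent and have probability at most `ε`, the
expected generating function grows at most geometrically in the number of steps. -/
theorem lintegral_blockWeight_le {t ε : ℝ≥0∞} (r : ℕ) {D : ℕ → Site d → Set (Env d)}
    {T : ℕ → Set (Site d)} (hDm : ∀ i a, MeasurableSet (D i a))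
    (hD : ∀ i a ξ ξ', (∀ w ∈ T i, ξ w = ξ' w) → (ξ ∈ D i a ↔ ξ' ∈ D i a))
    (hT : ∀ i j, i < j → Disjoint (T i) (T j))
    (κ : Site d → Measure (Pt d)) [∀ w, IsProbabilityMeasure (κ w)]
    (hκ : ∀ᵐ ξ ∂Measure.infinitePi κ, Nice ξ)
    (hε : ∀ i a, Measure.infinitePi κ (D i a) ≤ ε) (htε : t * ε ≤ 1) (n i : ℕ) (a : Site d) :
    ∫⁻ ξ, blockWeight t r D n i a ξ ∂Measure.infinitePi κ ≤
      (3 * (offsets d r).card : ℝ≥0∞) ^ n := by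
  classical
  induction n generalizing i a with
  | zero => simp [blockWeight]
  | succ n ih =>
    have hm := measurable_blockWeight (d := d) t r hDm
    have hmi : ∀ b : Site d, Measurable fun ξ : Env d =>
        1 + (D i b).indicator (fun _ => t) ξ := fun b =>
      (measurable_const.indicator (hDm i b)).const_add 1
    simp only [blockWeight]
    rw [lintegral_finsetSum]
    swap
    · exact fun v _ => (hm _ _ _).add ((hmi _).mul (hm _ _ _))
    rw [pow_succ', mul_comm (3 : ℝ≥0∞) _, mul_assoc, ← nsmul_eq_mul]
    refine Finset.sum_le_card_nsmul _ _ _ fun v _ => ?_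
    rw [lintegral_add_left (hm _ _ _)]
    have hprod := lintegral_mul_of_disjoint κ hκ (T i) (hmi (a + v)) (hm n (i + 1) (a + v))
      (fun ξ ξ' _ _ h => by
        simp only [Set.indicator, hD i (a + v) ξ ξ' h])
      (fun ξ ξ' _ _ h => blockWeight_congr t r hD _ _ _ fun j hj w hw =>
        h w fun hwi => Set.disjoint_left.1 (hT i j (by omega)) hwi hw)
    rw [hprod]
    have h1 : ∫⁻ ξ, (1 + (D i (a + v)).indicator (fun _ => t) ξ) ∂Measure.infinitePi κ ≤ 2 := by
      rw [lintegral_add_left measurable_const, lintegral_const, measure_univ, mul_one,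
        lintegral_indicator (hDm _ _), setLIntegral_const]
      calc (1 : ℝ≥0∞) + t * Measure.infinitePi κ (D i (a + v)) ≤ 1 + 1 := by
            gcongr
            exact (mul_le_mul_right (hε _ _) _).trans htε
        _ = 2 := by norm_num
    calc _ ≤ (3 * (offsets d r).card : ℝ≥0∞) ^ n + 2 * (3 * (offsets d r).card : ℝ≥0∞) ^ n :=
          add_le_add (ih _ _) (mul_le_mul' h1 (ih _ _))
      _ = 3 * ((offsets d r).card * 3) ^ n := by rw [mul_comm (3 : ℝ≥0∞) _]; ring

variable [NeZero d]

open Classical in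
/-- The total weight of the chains of `n` sites of `A` that start near `a`, make steps of size at
most `r`, avoid the sites of `F`, do not visit a site twice, and have increasing heights above
`b`. A chain weighs `exp (-lam * c)` if it climbs by `c`. -/
noncomputable def chainWeight (lam : ℝ) (r : ℕ) (A : Set (Site d)) :
    ℕ → Finset (Site d) → Site d → ℝ → Env d → ℝ≥0∞
  | 0, _, _, _, _ => 1
  | n + 1, F, a, b, ξ => ∑ v ∈ offsets d r, if a + v ∈ A ∧ a + v ∉ F then
      stepWeight lam (perturbed ξ (a + v) (last d) - b) *
        chainWeight lam r A n (insert (a + v) F) (a + v) (perturbed ξ (a + v) (last d)) ξ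
      else 0

theorem measurable_chainWeight (lam : ℝ) (r : ℕ) (A : Set (Site d)) (n : ℕ)
    (F : Finset (Site d)) (a : Site d) :
    Measurable fun p : ℝ × Env d => chainWeight lam r A n F a p.1 p.2 := by
  induction n generalizing F a with
  | zero => exact measurable_const
  | succ n ih =>
    simp only [chainWeight]
    refine Finset.measurable_sum _ fun v _ => ?_
    have hh : Measurable fun p : ℝ × Env d => perturbed p.2 (a + v) (last d) :=
      (measurable_pi_apply _).comp ((measurable_perturbed _).comp measurable_snd)
    refine Measurable.ite (MeasurableSet.const _) ?_ measurable_const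
    exact ((measurable_stepWeight lam).comp (hh.sub measurable_fst)).mul
      ((ih _ _).comp (hh.prodMk measurable_snd))

theorem chainWeight_congr (lam : ℝ) (r : ℕ) (A : Set (Site d)) (n : ℕ) (F : Finset (Site d))
    (a : Site d) (b : ℝ) {ξ ξ' : Env d} (h : ∀ w ∈ A, w ∉ F → ξ w = ξ' w) :
    chainWeight lam r A n F a b ξ = chainWeight lam r A n F a b ξ' := by
  classical
  induction n generalizing F a b with
  | zero => rfl
  | succ n ih =>
    simp only [chainWeight]
    refine Finset.sum_congr rfl fun v _ => ?_
    by_cases hv : a + v ∈ A ∧ a + v ∉ F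
    · rw [if_pos hv, if_pos hv, perturbed_congr (h _ hv.1 hv.2), ih]
      exact fun w hw hwF => h w hw fun h' => hwF (Finset.mem_insert_of_mem h')
    · rw [if_neg hv, if_neg hv]

/-- The expected weight of the chains of `n` sites decays geometrically in `n`: integrating out
the height of one site after the other, every step contributes a factor `q`, except for the few
sites of `E`, whose distribution is arbitrary. -/
theorem lintegral_chainWeight_le {lam : ℝ} (hl : 0 ≤ lam) (r : ℕ) (A : Set (Site d))
    (κ : Site d → Measure (Pt d)) [∀ w, IsProbabilityMeasure (κ w)] (E : Finset (Site d))
    {q : ℝ≥0∞} (hq : q ≤ 1)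
    (hκ : ∀ w ∈ A, w ∉ E → ∀ s : ℝ, ∫⁻ x, stepWeight lam (s + x (last d)) ∂κ w ≤ q)
    (n : ℕ) (F : Finset (Site d)) (a : Site d) (b : ℝ) :
    ∫⁻ ξ, chainWeight lam r A n F a b ξ ∂Measure.infinitePi κ ≤
      (offsets d r).card ^ n * q ^ (n - (E \ F).card) := by
  classical
  induction n generalizing F a b with
  | zero => simp [chainWeight]
  | succ n ih =>
    have hterm : ∀ c : Site d, Measurable fun ξ : Env d =>
        stepWeight lam (perturbed ξ c (last d) - b) *
          chainWeight lam r A n (insert c F) c (perturbed ξ c (last d)) ξ := fun c => by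
      have hh : Measurable fun ξ : Env d => perturbed ξ c (last d) :=
        (measurable_pi_apply _).comp (measurable_perturbed _)
      exact ((measurable_stepWeight lam).comp (hh.sub measurable_const)).mul
        ((measurable_chainWeight lam r A n _ c).comp (hh.prodMk measurable_id))
    simp only [chainWeight]
    rw [lintegral_finsetSum]
    swap
    · exact fun v _ => Measurable.ite (MeasurableSet.const _) (hterm _) measurable_const
    rw [pow_succ', mul_assoc, ← nsmul_eq_mul]
    refine Finset.sum_le_card_nsmul _ _ _ fun v _ => ?_
    by_cases hv : a + v ∈ A ∧ a + v ∉ F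
    swap
    · simp only [if_neg hv, lintegral_zero]; exact bot_le
    simp only [if_pos hv]
    set c := a + v with hc
    -- integrate out all sites other than `c` first
    have h1 : ∫⁻ ξ, stepWeight lam (perturbed ξ c (last d) - b) *
          chainWeight lam r A n (insert c F) c (perturbed ξ c (last d)) ξ
            ∂Measure.infinitePi κ ≤
        (∫⁻ ξ, stepWeight lam (perturbed ξ c (last d) - b) ∂Measure.infinitePi κ) *
          ((offsets d r).card ^ n * q ^ (n - (E \ insert c F).card)) := by
      rw [lintegral_eq_glue κ {c} (hterm c)]
      refine (lintegral_mono fun ξ => ?_).trans_eq (lintegral_mul_const _ ?_)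
      · have hg : ∀ ζ : Env d, perturbed (glue {c} ξ ζ) c = perturbed ξ c := fun ζ =>
          perturbed_congr (glue_of_mem (Set.mem_singleton c) ξ ζ)
        have hcw : ∀ ζ : Env d, ∀ y : ℝ,
            chainWeight lam r A n (insert c F) c y (glue {c} ξ ζ) =
              chainWeight lam r A n (insert c F) c y ζ := fun ζ y =>
          chainWeight_congr _ _ _ _ _ _ _ fun w _ hw =>
            glue_of_notMem (fun h => hw (by rw [Set.mem_singleton_iff.1 h]; simp)) ξ ζ
        simp only [hg, hcw]
        rw [lintegral_const_mul]
        swap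
        · exact (measurable_chainWeight lam r A n _ c).comp measurable_prodMk_left
        exact mul_le_mul_right (ih _ _ _) _
      · exact (measurable_stepWeight lam).comp (((measurable_pi_apply _).comp
          (measurable_perturbed _)).sub measurable_const)
    have h2 : ∫⁻ ξ, stepWeight lam (perturbed ξ c (last d) - b) ∂Measure.infinitePi κ =
        ∫⁻ x, stepWeight lam ((c (last d) - b) + x (last d)) ∂κ c := by
      rw [← (measurePreserving_eval_infinitePi κ c).map_eq, lintegral_map]
      · refine lintegral_congr fun ξ => ?_
        simp only [perturbed, Function.eval]
        congr 1; ring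
      · exact (measurable_stepWeight lam).comp ((measurable_pi_apply _).const_add _)
      · exact measurable_pi_apply c
    refine h1.trans ?_
    rw [h2]
    by_cases hcE : c ∈ E
    · -- an exceptional site contributes a factor at most one, and is used up
      have hcard : (E \ F).card = (E \ insert c F).card + 1 := by
        rw [Finset.sdiff_insert, Finset.card_erase_of_mem (Finset.mem_sdiff.2 ⟨hcE, hv.2⟩)]
        have : 0 < (E \ F).card := Finset.card_pos.2 ⟨c, Finset.mem_sdiff.2 ⟨hcE, hv.2⟩⟩
        omega
      have h3 : ∫⁻ x, stepWeight lam ((c (last d) - b) + x (last d)) ∂κ c ≤ 1 := by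
        refine (lintegral_mono fun x => stepWeight_le_one hl _).trans ?_
        simp
      rw [hcard, Nat.add_sub_add_right]
      exact (mul_le_mul_left h3 _).trans (one_mul _).le
    · have hcard : E \ insert c F = E \ F := by
        rw [Finset.sdiff_insert, Finset.erase_eq_of_notMem]
        exact fun h => hcE (Finset.mem_sdiff.1 h).1
      rw [hcard]
      refine (mul_le_mul_left (hκ c hv.1 hcE _) _).trans ?_
      rw [mul_left_comm, ← pow_succ']
      refine mul_le_mul_right ?_ _
      exact pow_le_pow_right_of_le_one' hq (by omega)

/-- The orbit of a point is one of the chains. -/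
theorem exp_le_chainWeight (lam : ℝ) (A : Set (Site d)) {ξ : Env d} (hξ : Nice ξ) {x : Pt d}
    {w : Site d} (hx : ∀ i, |x i - w i| ≤ 1) (n k : ℕ) (F : Finset (Site d)) {b : ℝ}
    (hF : ∀ c ∈ F, perturbed ξ c (last d) ≤ b) (hb : b ≤ orb ξ x k (last d))
    (hA : ∀ j, k < j → j ≤ k + n → orbSite ξ x w j ∈ A) :
    ENNReal.ofReal (Real.exp (-lam * (orb ξ x (k + n) (last d) - b))) ≤
      if n = 0 then ENNReal.ofReal (Real.exp (-lam * (orb ξ x k (last d) - b)))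
      else chainWeight lam (3 * d + 2) A n F (orbSite ξ x w k) b ξ := by
  classical
  induction n generalizing k F b with
  | zero => simp
  | succ n ih =>
    rw [if_neg (Nat.succ_ne_zero n), chainWeight]
    have hmem := (near_orbSite hξ hx k).sub_mem_offsets
    have hadd : orbSite ξ x w k + (orbSite ξ x w (k + 1) - orbSite ξ x w k) =
        orbSite ξ x w (k + 1) := by abel
    refine le_trans ?_ (Finset.single_le_sum (f := fun v =>
      if orbSite ξ x w k + v ∈ A ∧ orbSite ξ x w k + v ∉ F then
        stepWeight lam (perturbed ξ (orbSite ξ x w k + v) (last d) - b) *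
        chainWeight lam (3 * d + 2) A n (insert (orbSite ξ x w k + v) F) (orbSite ξ x w k + v)
          (perturbed ξ (orbSite ξ x w k + v) (last d)) ξ
      else 0) (fun _ _ => bot_le) hmem)
    simp only [hadd]
    have hlt : orb ξ x k (last d) < orb ξ x (k + 1) (last d) := orb_strictMono hξ x k.lt_succ_self
    have heq := orb_succ_eq_perturbed ξ x w k
    rw [if_pos ⟨hA _ (Nat.lt_succ_self k) (by omega), fun hmF => by
      have := hF _ hmF
      rw [← heq] at this
      linarith⟩, ← heq]
    rw [stepWeight, if_pos (by linarith)]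
    have hrec := ih (k + 1) (insert (orbSite ξ x w (k + 1)) F) (b := orb ξ x (k + 1) (last d))
      (fun c hc => by
        rcases Finset.mem_insert.1 hc with rfl | hc
        · rw [← heq]
        · exact (hF c hc).trans (by linarith)) le_rfl
      (fun j hj hj' => hA j (by omega) (by omega))
    have hsplit : Real.exp (-lam * (orb ξ x (k + (n + 1)) (last d) - b)) =
        Real.exp (-lam * (orb ξ x (k + 1) (last d) - b)) *
          Real.exp (-lam * (orb ξ x (k + 1 + n) (last d) - orb ξ x (k + 1) (last d))) := by
      rw [← Real.exp_add, show k + (n + 1) = k + 1 + n by omega]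
      congr 1; ring
    rw [hsplit, ENNReal.ofReal_mul (Real.exp_pos _).le]
    refine mul_le_mul_right (hrec.trans ?_) _
    split_ifs with hn
    · subst hn; simp [chainWeight]
    · exact le_rfl

/-- The orbit of `x` enters the half space above `b` in its `k`-th point. -/
def Entry (ξ : Env d) (x : Pt d) (b : ℝ) (k : ℕ) : Prop :=
  b ≤ orb ξ x k (last d) ∧ ∀ j < k, orb ξ x j (last d) < b

theorem pow_card_le_blockWeight (t : ℝ≥0∞) (D : ℕ → Site d → Set (Env d)) {ξ : Env d}
    (hξ : Nice ξ) {x : Pt d} {w : Site d} (hx : ∀ i, |x i - w i| ≤ 1) {lv : ℕ → ℝ}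
    (hlv : ∀ i, lv i + 3 * d ≤ lv (i + 1)) (n k i : ℕ) (B : Finset ℕ)
    (hk : orb ξ x k (last d) < lv i)
    (hB : ∀ j ∈ B, i ≤ j ∧ ∃ k', k < k' ∧ k' ≤ k + n ∧ Entry ξ x (lv j) k' ∧
      ξ ∈ D j (orbSite ξ x w k')) :
    t ^ B.card ≤ blockWeight t (3 * d + 2) D n i (orbSite ξ x w k) ξ := by
  classical
  have hd : (0 : ℝ) ≤ d := Nat.cast_nonneg d
  have hmono : Monotone lv := monotone_nat_of_le_succ fun i => by linarith [hlv i]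
  induction n generalizing k i B with
  | zero =>
    have : B = ∅ := Finset.eq_empty_of_forall_notMem fun j hj => by
      obtain ⟨-, k', h1, h2, -⟩ := hB j hj
      omega
    simp [this, blockWeight]
  | succ n ih =>
    have hmem := (near_orbSite hξ hx k).sub_mem_offsets
    have hadd : orbSite ξ x w k + (orbSite ξ x w (k + 1) - orbSite ξ x w k) =
        orbSite ξ x w (k + 1) := by abel
    rw [blockWeight]
    refine le_trans ?_ (Finset.single_le_sum (f := fun v =>
      blockWeight t (3 * d + 2) D n i (orbSite ξ x w k + v) ξ +
      (1 + (D i (orbSite ξ x w k + v)).indicator (fun _ => t) ξ) *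
        blockWeight t (3 * d + 2) D n (i + 1) (orbSite ξ x w k + v) ξ)
      (fun _ _ => bot_le) hmem)
    simp only [hadd]
    by_cases hk1 : orb ξ x (k + 1) (last d) < lv i
    · refine le_trans ?_ le_self_add
      refine ih (k + 1) i B hk1 fun j hj => ?_
      obtain ⟨hij, k', h1, h2, h3, h4⟩ := hB j hj
      refine ⟨hij, k', ?_, by omega, h3, h4⟩
      rcases (Nat.succ_le_of_lt h1).lt_or_eq with h | h
      · exact h
      · exfalso
        have := h3.1
        rw [← h] at this
        linarith [hmono hij]
    · refine le_trans ?_ le_add_self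
      have hk2 : orb ξ x (k + 1) (last d) < lv (i + 1) := by
        linarith [orb_succ_le hξ x k, hlv i]
      have hrec := ih (k + 1) (i + 1) (B.erase i) hk2 fun j hj => by
        obtain ⟨hji, hj⟩ := Finset.mem_erase.1 hj
        obtain ⟨hij, k', h1, h2, h3, h4⟩ := hB j hj
        refine ⟨by omega, k', ?_, by omega, h3, h4⟩
        rcases (Nat.succ_le_of_lt h1).lt_or_eq with h | h
        · exact h
        · exfalso
          have := h3.1
          rw [← h] at this
          linarith [hmono (show i + 1 ≤ j by omega)]
      by_cases hi : i ∈ B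
      · obtain ⟨-, k', h1, h2, h3, h4⟩ := hB i hi
        have hkk : k' = k + 1 := by
          by_contra hne
          exact hk1 (h3.2 (k + 1) (by omega))
        subst hkk
        have hcard : B.card = (B.erase i).card + 1 := by
          rw [Finset.card_erase_of_mem hi]
          have : 0 < B.card := Finset.card_pos.2 ⟨i, hi⟩
          omega
        rw [hcard, pow_succ']
        refine mul_le_mul' ?_ hrec
        rw [Set.indicator_of_mem h4]
        exact le_add_self
      · rw [Finset.erase_eq_of_notMem hi] at hrec
        refine hrec.trans ?_
        refine le_trans (one_mul _).ge (mul_le_mul_left le_self_add _)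

end Chains

/-! ### Traps -/

section Trap

variable {d : ℕ} [NeZero d]

/-- The perturbation `u` of the site `y` is close to a prescribed vertical displacement, which is
at most `δ` and decreases with the level of `y`, counted from `L`. -/
def InTrap (δ : ℝ) (K : ℕ) (L : ℤ) (y : Site d) (u : Pt d) : Prop :=
  ∀ i, |u i - (if i = last d then δ / (K + 2) * (K + 1 - ((y (last d) : ℝ) - L)) else 0)| ≤
    δ / (K + 2) / (2 * d + 3)

/-- The sites on the levels `L, …, L + K` within horizontal distance `ρ` of `a`. -/
def trapSites (K : ℕ) (L : ℤ) (ρ : ℕ) (a : Site d) : Set (Site d) :=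
  {y | L ≤ y (last d) ∧ y (last d) ≤ L + K ∧ ∀ i, i ≠ last d → |y i - a i| ≤ (ρ : ℤ)}

/-- A trap around `a 0` and `a 1`: near these sites and on the levels `L, …, L + K`, the points
are close to the lattice, with vertical distances slightly below one. A path that arrives there
moves straight up. -/
def Trap (δ : ℝ) (K : ℕ) (L : ℤ) (ρ : ℕ) (a : Fin 2 → Site d) : Set (Env d) :=
  {ξ | ∀ y, (∃ j, y ∈ trapSites K L ρ (a j)) → InTrap δ K L y (ξ y)}

/-- The site `q` levels above `y`. -/
def upSite (y : Site d) (q : ℤ) : Site d := y + Pi.single (last d) q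

theorem upSite_last (y : Site d) (q : ℤ) : upSite y q (last d) = y (last d) + q := by
  simp [upSite]

theorem upSite_of_ne (y : Site d) (q : ℤ) {i : Fin d} (hi : i ≠ last d) :
    upSite y q i = y i := by
  simp [upSite, hi]

theorem upSite_upSite (y : Site d) (p q : ℤ) : upSite (upSite y p) q = upSite y (p + q) := by
  simp [upSite, add_assoc, ← Pi.single_add]

theorem eq_upSite {y z : Site d} {q : ℤ} (h : z (last d) = y (last d) + q)
    (h' : ∀ i, i ≠ last d → z i = y i) : z = upSite y q := by
  funext i
  by_cases hi : i = last d
  · rw [hi, upSite_last, h]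
  · rw [upSite_of_ne y q hi, h' i hi]

theorem upArrow_eq {x : Pt d} {y : Site d} (h0 : (y (last d) : ℝ) ≤ x (last d))
    (h1 : x (last d) < y (last d) + 1) (h : ∀ i, i ≠ last d → |x i - y i| < 1 / 2) :
    upArrow x = upSite y 1 := by
  refine eq_upSite ?_ fun i hi => ?_
  · simp only [upArrow, if_pos]
    rw [Int.floor_eq_iff.2 ⟨h0, h1⟩]
  · simp only [upArrow, if_neg hi]
    rw [round_eq, Int.floor_eq_iff]
    have := abs_lt.1 (h i hi)
    constructor <;> linarith

section InTrap

variable {δ : ℝ} {K : ℕ} {L : ℤ}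

theorem InTrap.abs_horizontal_le {ξ : Env d} {y : Site d} (h : InTrap δ K L y (ξ y)) {i : Fin d}
    (hi : i ≠ last d) : |perturbed ξ y i - y i| ≤ δ / (K + 2) / (2 * d + 3) := by
  have := h i
  simpa [hi, perturbed] using this

theorem InTrap.abs_last_le {ξ : Env d} {y : Site d} (h : InTrap δ K L y (ξ y)) :
    |perturbed ξ y (last d) - (y (last d) + δ / (K + 2) * (K + 1 - ((y (last d) : ℝ) - L)))| ≤
      δ / (K + 2) / (2 * d + 3) := by
  have := h (last d)
  simp only [if_true] at this
  convert this using 2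
  simp [perturbed]

/-- The slope `s` and the tolerance `η` of a trap: `(2 d + 3) η = s` and `(K + 2) s = δ`. -/
theorem trap_constants (hδ : 0 < δ) (d K : ℕ) :
    0 < δ / (K + 2) / (2 * d + 3) ∧
      (2 * d + 3) * (δ / (K + 2) / (2 * d + 3)) = δ / (K + 2) ∧
      (K + 2) * (δ / (K + 2)) = δ := by
  refine ⟨by positivity, ?_, ?_⟩ <;> field_simp

theorem InTrap.bounds {ξ : Env d} {y : Site d} (hδ : 0 < δ) (h : InTrap δ K L y (ξ y))
    (hL : L ≤ y (last d)) (hK : y (last d) ≤ L + K) :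
    (y (last d) : ℝ) < perturbed ξ y (last d) ∧ perturbed ξ y (last d) ≤ y (last d) + δ ∧
      l1Dist (perturbed ξ y) (toPt y) ≤ δ := by
  have h1 := abs_le.1 h.abs_last_le
  obtain ⟨hη, hη1, hs⟩ := trap_constants hδ d K
  set s := δ / (K + 2)
  set η := s / (2 * d + 3)
  have hd : (1 : ℝ) ≤ d := by exact_mod_cast NeZero.one_le
  have hL' : (L : ℝ) ≤ y (last d) := by exact_mod_cast hL
  have hK' : (y (last d) : ℝ) ≤ L + K := by exact_mod_cast hK
  have hs0 : 0 < s := by positivity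
  have h2 : s ≤ s * (K + 1 - ((y (last d) : ℝ) - L)) := by nlinarith
  have h3 : s * (K + 1 - ((y (last d) : ℝ) - L)) ≤ s * (K + 1) := by nlinarith
  have h4 : (d : ℝ) * η ≤ s := by nlinarith
  have h5 : η ≤ d * η := by nlinarith
  refine ⟨by nlinarith, by linarith, ?_⟩
  have hsum : l1Dist (perturbed ξ y) (toPt y) ≤
      ∑ i : Fin d, ((if i = last d then s * (K + 1) else 0) + η) := by
    refine Finset.sum_le_sum fun i _ => ?_
    by_cases hi : i = last d
    · subst hi
      rw [if_pos rfl, abs_le]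
      simp only [toPt]
      constructor <;> linarith
    · simpa [hi, toPt] using h.abs_horizontal_le hi
  refine hsum.trans ?_
  rw [Finset.sum_add_distrib]
  simp only [Finset.sum_ite_eq', Finset.mem_univ, if_true, Finset.sum_const, Finset.card_univ,
    Fintype.card_fin, nsmul_eq_mul]
  linarith

end InTrap

variable {δ : ℝ} {K : ℕ} {L : ℤ} {ρ : ℕ} {a : Fin 2 → Site d} {ξ : Env d}

/-- From a point inside a trap, a path moves straight up. -/
theorem nextSite_of_trap (hδ : 0 < δ) (hδ' : δ < 1 / 8) (hξ : Nice ξ) (hT : ξ ∈ Trap δ K L ρ a)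
    {y : Site d} {j : Fin 2} (hL : L ≤ y (last d)) (hK : y (last d) + 2 ≤ L + K)
    (hρ : ∀ i, i ≠ last d → |y i - a j i| + 2 ≤ (ρ : ℤ)) :
    nextSite ξ (perturbed ξ y) = upSite y 1 := by
  obtain ⟨hη, hη1, hs⟩ := trap_constants hδ d K
  have hd : (1 : ℝ) ≤ d := by exact_mod_cast NeZero.one_le
  have hyT : InTrap δ K L y (ξ y) := hT y ⟨j, hL, by linarith, fun i hi => by
    have := hρ i hi; linarith⟩
  have huT : InTrap δ K L (upSite y 1) (ξ (upSite y 1)) :=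
    hT _ ⟨j, by rw [upSite_last]; linarith, by rw [upSite_last]; linarith, fun i hi => by
      have := hρ i hi; rw [upSite_of_ne _ _ hi]; linarith⟩
  have hyb := hyT.bounds hδ hL (by linarith)
  have hub := huT.bounds hδ (by rw [upSite_last]; linarith) (by rw [upSite_last]; linarith)
  have hyl := abs_le.1 hyT.abs_last_le
  have hul := abs_le.1 huT.abs_last_le
  rw [upSite_last] at hub hul
  push_cast at hub hul
  have hlow : perturbed ξ y (last d) < perturbed ξ (upSite y 1) (last d) := by linarith
  set s := δ / (K + 2) with hsdef
  set η := s / (2 * d + 3) with hηdef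
  have hs0 : 0 < s := by positivity
  have hsδ : s ≤ δ := by nlinarith [(Nat.cast_nonneg K : (0 : ℝ) ≤ K)]
  -- the distance to the point above is less than `1 - s + 2 d η`
  have hup : l1Dist (perturbed ξ (upSite y 1)) (perturbed ξ y) ≤ 1 - s + 2 * d * η := by
    have hsum : l1Dist (perturbed ξ (upSite y 1)) (perturbed ξ y) ≤
        ∑ i : Fin d, ((if i = last d then 1 - s else 0) + 2 * η) := by
      refine Finset.sum_le_sum fun i _ => ?_
      by_cases hi : i = last d
      · subst hi
        rw [if_pos rfl, abs_le]
        constructor <;> nlinarith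
      · have h1 := abs_le.1 (hyT.abs_horizontal_le hi)
        have h2 := abs_le.1 (huT.abs_horizontal_le hi)
        rw [upSite_of_ne _ _ hi] at h2
        rw [if_neg hi, abs_le]
        constructor <;> linarith
    refine hsum.trans_eq ?_
    rw [Finset.sum_add_distrib]
    simp only [Finset.sum_ite_eq', Finset.mem_univ, if_true, Finset.sum_const, Finset.card_univ,
      Fintype.card_fin, nsmul_eq_mul]
    ring
  have hup1 : l1Dist (perturbed ξ (upSite y 1)) (perturbed ξ y) < 1 - 2 * η := by
    nlinarith
  -- every other competitor is at distance at least `1 - 2 η`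
  have key : ∀ z, perturbed ξ y (last d) < perturbed ξ z (last d) → z ≠ upSite y 1 →
      1 - 2 * η ≤ l1Dist (perturbed ξ z) (perturbed ξ y) := by
    intro z hz hzu
    by_cases hzT : L ≤ z (last d) ∧ z (last d) ≤ L + K ∧ ∀ i, i ≠ last d → |z i - a j i| ≤ (ρ : ℤ)
    · have hzI := hT z ⟨j, hzT⟩
      by_cases hcol : ∀ i, i ≠ last d → z i = y i
      · have hzb := hzI.bounds hδ hzT.1 hzT.2.1
        have hne : z (last d) ≠ y (last d) + 1 := fun h => hzu (eq_upSite h hcol)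
        have hne' : z (last d) ≠ y (last d) := fun h => by
          have : z = y := by
            funext i
            by_cases hi : i = last d
            · rw [hi, h]
            · exact hcol i hi
          rw [this] at hz
          exact lt_irrefl _ hz
        have hge : y (last d) + 2 ≤ z (last d) := by
          by_contra hlt
          have h3 : z (last d) + 1 ≤ y (last d) := by omega
          have h3' : (z (last d) : ℝ) + 1 ≤ y (last d) := by exact_mod_cast h3
          linarith
        have hge' : (y (last d) : ℝ) + 2 ≤ z (last d) := by exact_mod_cast hge
        have := abs_sub_le_l1Dist (perturbed ξ z) (perturbed ξ y) (last d)
        have := le_abs_self (perturbed ξ z (last d) - perturbed ξ y (last d))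
        linarith
      · push Not at hcol
        obtain ⟨i, hi, hne⟩ := hcol
        have h1 : (1 : ℝ) ≤ |(z i : ℝ) - y i| := by
          exact_mod_cast Int.one_le_abs (sub_ne_zero.2 hne)
        have h2 := hzI.abs_horizontal_le hi
        have h3 := hyT.abs_horizontal_le hi
        have h4 := abs_sub_le_l1Dist (perturbed ξ z) (perturbed ξ y) i
        have h5 : |(z i : ℝ) - y i| ≤ |perturbed ξ z i - z i| +
            |perturbed ξ z i - perturbed ξ y i| + |perturbed ξ y i - y i| := by
          have e : (z i : ℝ) - y i = -(perturbed ξ z i - z i) +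
            (perturbed ξ z i - perturbed ξ y i) + (perturbed ξ y i - y i) := by ring
          rw [e]
          refine (abs_add_le _ _).trans (add_le_add_left ((abs_add_le _ _).trans ?_) _)
          rw [abs_neg]
        linarith
    · have hzlow : L ≤ z (last d) := by
        by_contra hlt
        have h1 : (z (last d) : ℝ) + 1 ≤ y (last d) := by
          exact_mod_cast (by omega : z (last d) + 1 ≤ y (last d))
        linarith [hξ.perturbed_lt z]
      by_cases hzK : z (last d) ≤ L + K
      · have : ∃ i, i ≠ last d ∧ (ρ : ℤ) < |z i - a j i| := by
          by_contra hcon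
          push Not at hcon
          exact hzT ⟨hzlow, hzK, hcon⟩
        obtain ⟨i, hi, hfar⟩ := this
        have h1 : (2 : ℝ) ≤ |(z i : ℝ) - y i| := by
          have h2 := hρ i hi
          have h3 := abs_sub_le (z i) (y i) (a j i)
          have : (2 : ℤ) ≤ |z i - y i| := by linarith
          exact_mod_cast this
        have h2 := (hξ.abs_perturbed_sub_lt z i).le
        have h3 := hyT.abs_horizontal_le hi
        have h4 := abs_sub_le_l1Dist (perturbed ξ z) (perturbed ξ y) i
        have h5 : |(z i : ℝ) - y i| ≤ |perturbed ξ z i - z i| +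
            |perturbed ξ z i - perturbed ξ y i| + |perturbed ξ y i - y i| := by
          have e : (z i : ℝ) - y i = -(perturbed ξ z i - z i) +
            (perturbed ξ z i - perturbed ξ y i) + (perturbed ξ y i - y i) := by ring
          rw [e]
          refine (abs_add_le _ _).trans (add_le_add_left ((abs_add_le _ _).trans ?_) _)
          rw [abs_neg]
        linarith
      · have h1 : (y (last d) : ℝ) + 3 ≤ z (last d) := by
          exact_mod_cast (by omega : y (last d) + 3 ≤ z (last d))
        have h2 := hξ.lt_perturbed z
        have h4 := abs_sub_le_l1Dist (perturbed ξ z) (perturbed ξ y) (last d)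
        have h5 := le_abs_self (perturbed ξ z (last d) - perturbed ξ y (last d))
        linarith
  refine firstSite_eq_of_unique ⟨hlow, fun z hz => ?_⟩ fun z hz => ?_
  · by_cases hzu : z = upSite y 1
    · rw [hzu]
    · exact (hup1.trans_le (key z hz hzu)).le
  · by_contra hzu
    exact absurd (hz.2 _ hlow) (not_le.2 (hup1.trans_le (key z hz.1 hzu)))

theorem goodAt_of_trap (hδ : 0 < δ) (hT : ξ ∈ Trap δ K L ρ a)
    {y : Site d} {j : Fin 2} (hL : L ≤ y (last d)) (hK : y (last d) + 1 ≤ L + K)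
    (hρ : ∀ i, i ≠ last d → |y i - a j i| + 1 ≤ (ρ : ℤ)) : GoodAt ξ δ y := by
  rintro z ⟨hz1, hz2⟩
  have h1 := abs_le.1 (hz2 (last d))
  have hzL : L ≤ z (last d) := by linarith
  have hzK : z (last d) ≤ L + K := by linarith
  have hz : InTrap δ K L z (ξ z) := hT z ⟨j, hzL, hzK, fun i hi => by
    have := hz2 i
    have := hρ i hi
    have := abs_sub_le (z i) (y i) (a j i)
    linarith⟩
  have hb := hz.bounds hδ hzL hzK
  exact ⟨hδ, hb.2.2, hb.1.le⟩

/-- An orbit that reaches the levels of the trap inside the trap enters the half space above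
any later level inside the trap exactly at a point of that level. -/
theorem exists_entry_of_trap (hδ : 0 < δ) (hδ' : δ < 1 / 8) (hξ : Nice ξ)
    (hT : ξ ∈ Trap δ K L ρ a) {x : Pt d} {w : Site d} (hx : ∀ i, |x i - w i| ≤ 1) {j : Fin 2}
    {k n : ℕ} (hk : orbSite ξ x w k = a j) (hkL : orb ξ x k (last d) < L)
    (hn : ∃ e, k < e ∧ e ≤ k + n ∧ L ≤ orbSite ξ x w e (last d))
    (hρ : (3 * d + 2) * n + 2 ≤ ρ) (hK : 3 * d + 3 ≤ K) :
    ∃ c z, z (last d) = L + (3 * d + 1) ∧ (∀ i, i ≠ last d → |z i - a j i| + 2 ≤ (ρ : ℤ)) ∧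
      orb ξ x c = perturbed ξ z ∧
      ∀ c' < c, orb ξ x c' (last d) < (L + (3 * d + 1) : ℤ) := by
  classical
  -- the first site of the orbit on the levels of the trap
  obtain ⟨e, ⟨hke, hen, heL⟩, hmin⟩ : ∃ e, (k < e ∧ e ≤ k + n ∧ L ≤ orbSite ξ x w e (last d)) ∧
      ∀ e' < e, ¬ (k < e' ∧ e' ≤ k + n ∧ L ≤ orbSite ξ x w e' (last d)) :=
    ⟨Nat.find hn, Nat.find_spec hn, fun _ h => Nat.find_min hn h⟩
  obtain ⟨f, rfl⟩ : ∃ f, e = f + 1 := ⟨e - 1, by omega⟩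
  have hfL : orb ξ x f (last d) < L := by
    rcases (Nat.lt_succ_iff.1 hke).lt_or_eq with hkf | rfl
    · obtain ⟨f', rfl⟩ : ∃ f', f = f' + 1 := ⟨f - 1, by omega⟩
      have h1 : orbSite ξ x w (f' + 1) (last d) + 1 ≤ L := by
        have := hmin (f' + 1) (Nat.lt_succ_self _)
        by_contra hcon
        exact this ⟨hkf, by omega, by omega⟩
      have h2 : (orbSite ξ x w (f' + 1) (last d) : ℝ) + 1 ≤ L := by exact_mod_cast h1
      rw [orb_succ_eq_perturbed ξ x w]
      linarith [hξ.perturbed_lt (orbSite ξ x w (f' + 1))]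
    · exact hkL
  set y := orbSite ξ x w (f + 1) with hy
  have hoy : orb ξ x (f + 1) = perturbed ξ y := orb_succ_eq_perturbed ξ x w f
  have hyL : y (last d) ≤ L + 3 * d := by
    have h1 := orb_succ_le hξ x f
    rw [hoy] at h1
    have h2 := hξ.lt_perturbed y
    have : (y (last d) : ℝ) < L + 3 * d + 1 := by linarith
    have : y (last d) < L + 3 * d + 1 := by exact_mod_cast this
    linarith
  have hya : ∀ i, |y i - a j i| + 2 ≤ (ρ : ℤ) := fun i => by
    obtain ⟨q, hq⟩ : ∃ q, f + 1 = k + q := ⟨f + 1 - k, by omega⟩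
    have h1 := near_orbSite_add hξ hx k q i
    rw [← hq, hk] at h1
    have h2 : (3 * d + 2) * q ≤ (3 * d + 2) * n := Nat.mul_le_mul_left _ (by omega)
    have h3 : (((3 * d + 2) * q : ℕ) : ℤ) + 2 ≤ ρ := by exact_mod_cast (by omega)
    linarith
  have hcol : ∀ q : ℕ, y (last d) + q ≤ L + (3 * d + 1) →
      orb ξ x (f + 1 + q) = perturbed ξ (upSite y q) := by
    intro q
    induction q with
    | zero => intro _; simp [hoy, upSite]
    | succ q ih =>
      intro hq
      push_cast at hq
      rw [← add_assoc, orb_succ, ih (by linarith), next_eq_perturbed,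
        nextSite_of_trap hδ hδ' hξ hT (j := j), upSite_upSite]
      · push_cast; rfl
      · rw [upSite_last]; omega
      · rw [upSite_last]; omega
      · intro i hi; rw [upSite_of_ne _ _ hi]; exact hya i
  obtain ⟨p, hp⟩ : ∃ p : ℕ, (p : ℤ) + 1 = L + (3 * d + 1) - y (last d) :=
    ⟨(L + 3 * d - y (last d)).toNat, by omega⟩
  refine ⟨f + 1 + (p + 1), upSite y (p + 1 : ℕ), ?_, fun i hi => ?_, hcol _ ?_, fun c' hc' => ?_⟩
  · rw [upSite_last]; push_cast; omega
  · rw [upSite_of_ne _ _ hi]; exact hya i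
  · push_cast; omega
  · have h1 : orb ξ x c' (last d) ≤ orb ξ x (f + 1 + p) (last d) :=
      (orb_strictMono hξ x).monotone (by omega)
    rw [hcol p (by omega)] at h1
    have h2 : InTrap δ K L (upSite y p) (ξ (upSite y p)) := hT _ ⟨j, by
      rw [upSite_last]; omega, by rw [upSite_last]; omega, fun i hi => by
      rw [upSite_of_ne _ _ hi]; have := hya i; linarith⟩
    have h3 := (h2.bounds hδ (by rw [upSite_last]; omega) (by rw [upSite_last]; omega)).2.1
    have h4 : ((upSite y p (last d) : ℤ) : ℝ) + 1 = (L + (3 * d + 1) : ℤ) := by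
      rw [upSite_last]
      exact_mod_cast (by omega : y (last d) + p + 1 = L + (3 * d + 1))
    linarith

end Trap

/-! ### A trap forces a renewal step -/

section Renewal

variable {d : ℕ} [NeZero d]

/-- Step number `n` completes a run of `m` up steps, and is a special up step. -/
def EndsRun (ξ : Env d) (δ : ℝ) (m : ℕ) (g : Fin 2 → ℕ → Pt d) (n : ℕ) : Prop :=
  (∀ s, n ≤ s + m → s < n → UpStep δ g s) ∧ SpecialUpStep ξ δ g (n - 1)

variable {δ : ℝ} {K : ℕ} {L : ℤ} {ρ : ℕ} {a : Fin 2 → Site d} {ξ : Env d}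

/-- Inside a trap, on a common level, both paths go straight up. -/
theorem jointFrom_of_trap (hδ : 0 < δ) (hδ' : δ < 1 / 8) (hξ : Nice ξ) (hT : ξ ∈ Trap δ K L ρ a)
    {x : Pt d × Pt d} {z : Fin 2 → Site d} {M : ℤ} (hzM : ∀ j, z j (last d) = M) (hLM : L ≤ M)
    (hρ : ∀ j, ∀ i, i ≠ last d → |z j i - a j i| + 2 ≤ (ρ : ℤ)) {n : ℕ}
    (hn : ∀ j, jointFrom x ξ j n = perturbed ξ (z j)) (q : ℕ) (hq : M + q + 1 ≤ L + K)
    (j : Fin 2) : jointFrom x ξ j (n + q) = perturbed ξ (upSite (z j) q) := by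
  induction q generalizing j with
  | zero => simp [hn, upSite]
  | succ q ih =>
    push_cast at hq
    have hl : ∀ j, upSite (z j) q (last d) = M + q := fun j => by rw [upSite_last, hzM]
    have hb : ∀ (p : ℕ) j, M + p ≤ L + K → (((M + p : ℤ) : ℝ) <
        perturbed ξ (upSite (z j) p) (last d) ∧
        perturbed ξ (upSite (z j) p) (last d) ≤ ((M + p : ℤ) : ℝ) + δ) := fun p j hp => by
      have hup : upSite (z j) p (last d) = M + p := by rw [upSite_last, hzM]
      have hI : InTrap δ K L (upSite (z j) p) (ξ (upSite (z j) p)) :=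
        hT _ ⟨j, by omega, by omega, fun i hi => by
          rw [upSite_of_ne _ _ hi]; have := hρ j i hi; linarith⟩
      have := hI.bounds hδ (by omega) (by omega)
      rw [hup] at this
      exact ⟨this.1, this.2.1⟩
    have ih' := ih (by omega)
    have hfl : ∀ j, ⌊jointFrom x ξ j (n + q) (last d)⌋ = M + q := fun j => by
      rw [ih' j, Int.floor_eq_iff]
      have := hb q j (by omega)
      constructor <;> linarith
    have hlow : Lowest (jointFrom x ξ) j (n + q) := fun i => by rw [hfl, hfl]
    have hnx : next ξ (jointFrom x ξ j (n + q)) = perturbed ξ (upSite (z j) (q + 1 : ℕ)) := by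
      rw [ih' j, next_eq_perturbed, nextSite_of_trap hδ hδ' hξ hT (j := j), upSite_upSite]
      · push_cast; rfl
      · rw [hl]; omega
      · rw [hl]; omega
      · intro i hi; rw [upSite_of_ne _ _ hi]; exact hρ j i hi
    rcases jointFrom_succ_of_lowest hlow with h1 | ⟨i, -, h1, -⟩
    · rw [← add_assoc, h1, hnx]
    · exfalso
      have h2 := hb (q + 1) j (by push_cast; omega)
      have h3 := hb q i (by omega)
      rw [← hnx, h1, ih' i] at h2
      push_cast at h2 h3
      linarith

/-- If both paths enter the trap, then a renewal step occurs before they leave it. -/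
theorem exists_endsRun_of_trap (hδ : 0 < δ) (hδ' : δ < 1 / 8) (hξ : Nice ξ) {b : ℤ}
    (hT : ξ ∈ Trap δ K (b + (3 * d + 1)) ρ a) {x : Pt d × Pt d} {w : Fin 2 → Site d}
    (hx : ∀ j i, |startPt x j i - w j i| ≤ 1) (hxb : ∀ j, startPt x j (last d) < b)
    {k : Fin 2 → ℕ} (hk : ∀ j, Entry ξ (startPt x j) b (k j))
    (hka : ∀ j, orbSite ξ (startPt x j) (w j) (k j) = a j) {n : ℕ}
    (hn : ∀ j, ∃ e, k j < e ∧ e ≤ k j + n ∧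
      b + (3 * d + 1) ≤ orbSite ξ (startPt x j) (w j) e (last d))
    (hρ : (3 * d + 2) * n + 2 ≤ ρ) {m : ℕ} (hK : 3 * d + m + 5 ≤ K) {N : ℕ}
    (hN : ∀ j, (b : ℝ) + (6 * d + m + 7) ≤ jointFrom x ξ j N (last d)) :
    ∃ n', m < n' ∧ n' ≤ N ∧ EndsRun ξ δ m (jointFrom x ξ) n' := by
  classical
  have hent := fun j => exists_entry_of_trap hδ hδ' hξ hT (hx j) (hka j) (by
    obtain ⟨k', hk'⟩ : ∃ k', k j = k' + 1 := Nat.exists_eq_succ_of_ne_zero fun h0 => by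
      have := (hk j).1
      rw [h0, orb_zero] at this
      linarith [hxb j]
    have h1 := (hk j).2 k' (by omega)
    have h2 := orb_succ_le hξ (startPt x j) k'
    rw [hk']; push_cast; linarith) (hn j) hρ (by omega)
  choose c z hzM hzρ hc hc' using hent
  set M : ℤ := b + (3 * d + 1) + (3 * d + 1) with hM
  have hzI : ∀ j (p : ℕ), p ≤ m + 3 → InTrap δ K (b + (3 * d + 1)) (upSite (z j) p)
      (ξ (upSite (z j) p)) := fun j p hp => hT _ ⟨j, by rw [upSite_last, hzM]; omega, by
        rw [upSite_last, hzM]; omega, fun i hi => by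
          rw [upSite_of_ne _ _ hi]; have := hzρ j i hi; linarith⟩
  have hzb := fun j (p : ℕ) (hp : p ≤ m + 3) => (hzI j p hp).bounds hδ
    (by rw [upSite_last, hzM]; omega) (by rw [upSite_last, hzM]; omega)
  simp only [upSite_last, hzM] at hzb
  have hcM : ∀ j, (M : ℝ) < orb ξ (startPt x j) (c j) (last d) := fun j => by
    have := (hzb j 0 (by omega)).1
    rw [hc]
    simpa [upSite] using this
  -- the first time at which both paths have arrived on level `M`
  have hex : ∃ n, ∀ j, (M : ℝ) ≤ jointFrom x ξ j n (last d) := ⟨N, fun j => by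
    refine le_trans ?_ (hN j); rw [hM]; push_cast; linarith⟩
  set N1 := Nat.find hex with hN1
  have hN1' : ∀ n < N1, ∃ j, jointFrom x ξ j n (last d) < M := fun n hn => by
    have := Nat.find_min hex hn
    push Not at this
    exact this
  have hinv : ∀ n ≤ N1, ∀ j, ∃ C ≤ c j, jointFrom x ξ j n = orb ξ (startPt x j) C := by
    intro n
    induction n with
    | zero => exact fun _ j => ⟨0, Nat.zero_le _, rfl⟩
    | succ n ih =>
      intro hn' j
      obtain ⟨C, hC, hCe⟩ := ih (by omega) j
      by_cases hlow : Lowest (jointFrom x ξ) j n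
      swap
      · exact ⟨C, hC, by rw [jointFrom_succ_of_not_lowest hlow, hCe]⟩
      obtain ⟨i, hi⟩ := hN1' n (by omega)
      have hjM : ⌊jointFrom x ξ j n (last d)⌋ < M := (hlow i).trans_lt (Int.floor_lt.2 hi)
      have hltc : ∀ C' ≤ c j, orb ξ (startPt x j) C' (last d) < M → C' + 1 ≤ c j := by
        intro C' hC' h
        rcases hC'.lt_or_eq with h1 | h1
        · exact h1
        · rw [h1] at h
          exact absurd h (hcM j).not_gt
      have hC1 : C + 1 ≤ c j := hltc C hC (by rw [← hCe]; exact Int.floor_lt.1 hjM)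
      rcases jointFrom_succ_of_lowest hlow with h1 | ⟨i', hi', h1, h2⟩
      · exact ⟨C + 1, hC1, by rw [h1, hCe, orb_succ]⟩
      · rw [hCe, ← orb_succ] at h1
        refine ⟨C + 1 + 1, hltc _ hC1 ?_, by rw [h2, ← h1, orb_succ _ _ (C + 1)]⟩
        rw [h1]
        exact Int.floor_lt.1 ((hi' j).trans_lt hjM)
  have hat : ∀ j, jointFrom x ξ j N1 = perturbed ξ (z j) := fun j => by
    obtain ⟨C, hC, hCe⟩ := hinv N1 le_rfl j
    have h1 : (M : ℝ) ≤ jointFrom x ξ j N1 (last d) := Nat.find_spec hex j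
    rcases hC.lt_or_eq with h | h
    · have := hc' j C h
      rw [← hCe] at this
      exact absurd h1 (not_le.2 this)
    · rw [hCe, h, hc]
  have hup := fun (q : ℕ) (hq : q ≤ m + 1) => jointFrom_of_trap hδ hδ' hξ hT hzM (by omega) hzρ hat q
    (by omega)
  have harr : ∀ (q : ℕ) (hq : q ≤ m + 1) j,
      upArrow (jointFrom x ξ j (N1 + q)) = upSite (z j) (q + 1 : ℕ) := fun q hq j => by
    have h1 := hzb j q (by omega)
    push_cast at h1
    rw [hup q hq j, upArrow_eq (y := upSite (z j) q), upSite_upSite]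
    · push_cast; rfl
    · rw [upSite_last, hzM]; push_cast; linarith
    · rw [upSite_last, hzM]; push_cast; linarith
    · intro i hi
      have h2 := abs_sub_le_l1Dist (perturbed ξ (upSite (z j) q)) (toPt (upSite (z j) q)) i
      simp only [toPt] at h2
      linarith [h1.2.2]
  have hfl : ∀ (q : ℕ) (hq : q ≤ m + 1) j, ⌊jointFrom x ξ j (N1 + q) (last d)⌋ = M + q :=
    fun q hq j => by
      have h1 := hzb j q (by omega)
      rw [hup q hq j, Int.floor_eq_iff]
      constructor <;> linarith
  have hstep : ∀ q ≤ m, UpStep δ (jointFrom x ξ) (N1 + q) := fun q hq =>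
    ⟨fun i j => by rw [hfl q (by omega), hfl q (by omega)], fun j => by
      have h1 := hzb j (q + 1) (by omega)
      rw [harr q (by omega) j, add_assoc, hup (q + 1) (by omega) j]
      refine ⟨hδ, h1.2.2, ?_⟩
      simp only [toPt, upSite_last, hzM]
      exact h1.1.le⟩
  refine ⟨N1 + m + 1, by omega, ?_, ⟨fun s hs hs' => ?_, ?_⟩⟩
  · by_contra hlt
    have h1 := jointFrom_mono hξ x 0 (show N ≤ N1 + (m + 1) by omega)
    have h2 := (hzb 0 (m + 1) (by omega)).2.1
    have h3 := hN 0
    simp only [hup (m + 1) le_rfl 0] at h1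
    rw [hM] at h2
    push_cast at h1 h2
    linarith
  · obtain ⟨q, rfl⟩ : ∃ q, s = N1 + q := ⟨s - N1, by omega⟩
    exact hstep q (by omega)
  · refine ⟨hstep m le_rfl, fun j => ?_⟩
    rw [show N1 + m + 1 - 1 = N1 + m by omega, harr m (by omega) j]
    refine goodAt_of_trap hδ hT (j := j) ?_ ?_ fun i hi => ?_
    · rw [upSite_last, hzM]; omega
    · rw [upSite_last, hzM]; push_cast; omega
    · rw [upSite_of_ne _ _ hi]; have := hzρ j i hi; linarith

end Renewal

/-! ### Estimates for fresh environments -/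

section Fresh

open scoped ENNReal

variable {d : ℕ} [NeZero d]

/-- Both paths start near the sites `w 0` and `w 1`, on level `l`. -/
structure IsStart (l : ℤ) (w : Fin 2 → Site d) (x : Pt d × Pt d) : Prop where
  near : ∀ j i, |startPt x j i - w j i| ≤ 1
  le : ∀ j, (l : ℝ) ≤ startPt x j (last d)
  lt : ∀ j, startPt x j (last d) < l + 1

/-- From the level `l` on, the perturbations are uniform, except for those of `w 0` and `w 1`. -/
structure IsFresh (l : ℤ) (w : Fin 2 → Site d) (κ : Site d → Measure (Pt d)) : Prop where
  nice : ∀ y, ∀ᵐ u ∂κ y, ∀ i, |u i| < 1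
  law : ∀ y : Site d, l ≤ y (last d) → (∀ j, y ≠ w j) → κ y = cubeLaw d

/-- The number of possible displacements of the lattice site in one step. -/
noncomputable def numSteps (d : ℕ) : ℕ := (offsets d (3 * d + 2)).card

theorem numSteps_pos (d : ℕ) : 0 < numSteps d := offsets_card_pos _ _

/-- The rate in the weights of the chains. It is so large that the expected weight gains a
factor `1/4` with every site of the chain. -/
noncomputable def rate (d : ℕ) : ℝ := 2 * numSteps d

theorem rate_pos (d : ℕ) : 0 < rate d := by
  have : (0 : ℝ) < numSteps d := by exact_mod_cast numSteps_pos d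
  unfold rate; positivity

theorem numSteps_mul_rate (d : ℕ) :
    (numSteps d : ℝ≥0∞) * ENNReal.ofReal (2 * rate d)⁻¹ = 4⁻¹ := by
  have h : (0 : ℝ) < numSteps d := by exact_mod_cast numSteps_pos d
  have h4 : (4 : ℝ≥0∞)⁻¹ = ENNReal.ofReal (4⁻¹ : ℝ) := by
    rw [ENNReal.ofReal_inv_of_pos (by norm_num)]; norm_num
  rw [← ENNReal.ofReal_natCast, ← ENNReal.ofReal_mul h.le, h4]
  congr 1
  unfold rate
  field_simp
  norm_num

theorem ofReal_rate_le_one (d : ℕ) : ENNReal.ofReal (2 * rate d)⁻¹ ≤ 1 := by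
  rw [ENNReal.ofReal_le_one]
  have h : (1 : ℝ) ≤ numSteps d := by exact_mod_cast numSteps_pos d
  refine inv_le_one_of_one_le₀ ?_
  unfold rate; linarith

variable {l : ℤ} {w : Fin 2 → Site d} {x : Pt d × Pt d} {κ : Site d → Measure (Pt d)}
  [∀ y, IsProbabilityMeasure (κ y)]

/-- Markov's inequality for the weight of the chains. -/
theorem IsFresh.measure_le_chainWeight (hκ : IsFresh l w κ) {A : Set (Site d)}
    (hA : ∀ y ∈ A, l ≤ y (last d)) (E : Finset (Site d)) (hE : ∀ y ∈ A, (∃ j, y = w j) → y ∈ E)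
    (n : ℕ) (a : Site d) (b s : ℝ) :
    Measure.infinitePi κ {ξ | ENNReal.ofReal (Real.exp (-rate d * s)) ≤
      chainWeight (rate d) (3 * d + 2) A n ∅ a b ξ} ≤
      ENNReal.ofReal (Real.exp (rate d * s)) * (numSteps d ^ E.card * 4⁻¹ ^ (n - E.card)) := by
  have h0 : ENNReal.ofReal (Real.exp (-rate d * s)) ≠ 0 := by
    rw [Ne, ENNReal.ofReal_eq_zero, not_le]; exact Real.exp_pos _
  have hm : Measurable (chainWeight (rate d) (3 * d + 2) A n ∅ a b) :=
    (measurable_chainWeight _ _ A n ∅ a).comp measurable_prodMk_left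
  refine (meas_ge_le_lintegral_div hm.aemeasurable h0 ENNReal.ofReal_ne_top).trans ?_
  rw [div_eq_mul_inv, mul_comm, ← ENNReal.ofReal_inv_of_pos (Real.exp_pos _), ← Real.exp_neg,
    neg_mul, neg_neg]
  refine mul_le_mul_right ((lintegral_chainWeight_le (rate_pos d).le _ A κ E
    (ofReal_rate_le_one d) (fun y hy hyE s => ?_) n ∅ a b).trans ?_) _
  · rw [hκ.law y (hA y hy) fun j hj => hyE (hE y hy ⟨j, hj⟩)]
    exact lintegral_stepWeight_cubeLaw_le (rate_pos d) s
  · rw [Finset.sdiff_empty]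
    change (numSteps d : ℝ≥0∞) ^ n * _ ≤ _
    rcases le_total E.card n with h | h
    · conv_lhs => rw [← Nat.add_sub_of_le h, pow_add, mul_assoc, Nat.add_sub_cancel_left,
        ← mul_pow, numSteps_mul_rate]
    · rw [Nat.sub_eq_zero_of_le h, pow_zero, pow_zero, mul_one, mul_one]
      exact pow_le_pow_right₀ (by exact_mod_cast numSteps_pos d) h

theorem level_of_lt {ξ : Env d} (hξ : Nice ξ) {y : Site d} {b : ℤ}
    (h : (b : ℝ) < perturbed ξ y (last d)) : b ≤ y (last d) := by
  have h1 : (b : ℝ) < y (last d) + 1 := h.trans (hξ.perturbed_lt y)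
  have h2 : b < y (last d) + 1 := by exact_mod_cast h1
  omega

/-- It is unlikely that an orbit climbs slowly. -/
theorem measure_orb_lt_le (hx : IsStart l w x) (hκ : IsFresh l w κ) (j : Fin 2) {T : ℕ}
    (hT : 2 ≤ T) (s : ℝ) :
    Measure.infinitePi κ {ξ | Nice ξ ∧ orb ξ (startPt x j) T (last d) < l + s} ≤
      ENNReal.ofReal (Real.exp (rate d * s)) * (numSteps d ^ 2 * 4⁻¹ ^ (T - 2)) := by
  classical
  have hsub : {ξ : Env d | Nice ξ ∧ orb ξ (startPt x j) T (last d) < l + s} ⊆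
      {ξ | ENNReal.ofReal (Real.exp (-rate d * s)) ≤
        chainWeight (rate d) (3 * d + 2) {y | l ≤ y (last d)} T ∅ (w j)
          (startPt x j (last d)) ξ} := by
    rintro ξ ⟨hξ, hlt⟩
    have h := exp_le_chainWeight (rate d) {y | l ≤ y (last d)} hξ (hx.near j) T 0 ∅
      (b := startPt x j (last d)) (by simp) le_rfl fun e he _ => by
        obtain ⟨f, rfl⟩ : ∃ f, e = f + 1 := ⟨e - 1, by omega⟩
        refine level_of_lt hξ ?_
        rw [← orb_succ_eq_perturbed]
        exact (hx.le j).trans_lt (orb_strictMono hξ (startPt x j) he)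
    rw [if_neg (by omega), zero_add] at h
    refine le_trans (ENNReal.ofReal_le_ofReal (Real.exp_le_exp.2 ?_)) h
    rw [neg_mul, neg_mul, neg_le_neg_iff]
    exact mul_le_mul_of_nonneg_left (by linarith [hx.le j]) (rate_pos d).le
  refine (measure_mono hsub).trans ((hκ.measure_le_chainWeight (fun y hy => hy)
    {w 0, w 1} ?_ T _ _ s).trans ?_)
  · rintro y - ⟨i, rfl⟩
    fin_cases i <;> simp
  · have hc : ({w 0, w 1} : Finset (Site d)).card ≤ 2 := Finset.card_le_two
    refine mul_le_mul_right (mul_le_mul' (pow_le_pow_right₀ (by exact_mod_cast numSteps_pos d) hc)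
      ?_) _
    exact pow_le_pow_right_of_le_one' (by norm_num) (by omega)

/-- The event that some chain of `n` sites starts near `a` and stays on the `3 d + 1` levels
from `b` on. -/
def LongChain (n : ℕ) (b : ℤ) (a : Site d) : Set (Env d) :=
  {ξ | ENNReal.ofReal (Real.exp (-rate d * (3 * d + 1))) ≤
    chainWeight (rate d) (3 * d + 2) {y | b ≤ y (last d) ∧ y (last d) < b + (3 * d + 1)} n ∅ a b ξ}

theorem measurableSet_longChain (n : ℕ) (b : ℤ) (a : Site d) :
    MeasurableSet (LongChain n b a) :=
  measurableSet_le measurable_const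
    ((measurable_chainWeight _ _ _ n ∅ a).comp measurable_prodMk_left)

theorem longChain_congr (n : ℕ) (b : ℤ) (a : Site d) {ξ ξ' : Env d}
    (h : ∀ y : Site d, b ≤ y (last d) ∧ y (last d) < b + (3 * d + 1) → ξ y = ξ' y) :
    ξ ∈ LongChain n b a ↔ ξ' ∈ LongChain n b a := by
  have := chainWeight_congr (rate d) (3 * d + 2)
    {y | b ≤ y (last d) ∧ y (last d) < b + (3 * d + 1)} n ∅ a b fun y hy _ => h y hy
  simp only [LongChain, Set.mem_ofPred_eq, this]

theorem IsFresh.measure_longChain_le (hκ : IsFresh l w κ) {b : ℤ} (hb : l ≤ b)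
    (hw : ∀ j, w j (last d) < b) (n : ℕ) (a : Site d) :
    Measure.infinitePi κ (LongChain n b a) ≤
      ENNReal.ofReal (Real.exp (rate d * (3 * d + 1))) * 4⁻¹ ^ n := by
  have h := hκ.measure_le_chainWeight (A := {y | b ≤ y (last d) ∧ y (last d) < b + (3 * d + 1)})
    (fun y hy => hb.trans hy.1) ∅ (fun y hy ⟨j, hj⟩ => by
      have := hw j
      rw [← hj] at this
      exact absurd hy.1 (not_le.2 this)) n a b (3 * d + 1)
  simpa [LongChain] using h

/-- If there is no long chain, an orbit that enters above level `b` leaves the next `3 d + 1`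
levels quickly. -/
theorem exists_exit {ξ : Env d} (hξ : Nice ξ) {x : Pt d} {w : Site d}
    (hx : ∀ i, |x i - w i| ≤ 1) {b : ℤ} {k n : ℕ} (hn : n ≠ 0)
    (hb : (b : ℝ) ≤ orb ξ x k (last d)) (h : ξ ∉ LongChain n b (orbSite ξ x w k)) :
    ∃ e, k < e ∧ e ≤ k + n ∧ b + (3 * d + 1) ≤ orbSite ξ x w e (last d) := by
  by_contra hcon
  push Not at hcon
  refine h ?_
  have h1 := exp_le_chainWeight (rate d)
    {y | b ≤ y (last d) ∧ y (last d) < b + (3 * d + 1)} hξ hx n k ∅ (b := b) (by simp) hb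
    fun e he he' => by
      refine ⟨?_, hcon e he he'⟩
      obtain ⟨f, rfl⟩ : ∃ f, e = f + 1 := ⟨e - 1, by omega⟩
      refine level_of_lt hξ ?_
      rw [← orb_succ_eq_perturbed]
      exact hb.trans_lt (orb_strictMono hξ x he)
  rw [if_neg hn] at h1
  refine le_trans (ENNReal.ofReal_le_ofReal (Real.exp_le_exp.2 ?_)) h1
  rw [neg_mul, neg_mul, neg_le_neg_iff]
  refine mul_le_mul_of_nonneg_left ?_ (rate_pos d).le
  obtain ⟨f, hf⟩ : ∃ f, k + n = f + 1 := ⟨k + n - 1, by omega⟩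
  have h2 := hcon (k + n) (by omega) le_rfl
  have h3 : (orbSite ξ x w (k + n) (last d) : ℝ) + 1 ≤ b + (3 * d + 1) := by exact_mod_cast h2
  have h4 := hξ.perturbed_lt (orbSite ξ x w (k + n))
  rw [hf] at h3 h4 ⊢
  rw [orb_succ_eq_perturbed ξ x w]
  linarith

theorem trap_congr (δ : ℝ) (K : ℕ) (L : ℤ) (ρ : ℕ) (a : Fin 2 → Site d) {ξ ξ' : Env d}
    (h : ∀ y : Site d, L ≤ y (last d) ∧ y (last d) ≤ L + K → ξ y = ξ' y) :
    ξ ∈ Trap δ K L ρ a ↔ ξ' ∈ Trap δ K L ρ a := by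
  refine forall_congr' fun y => forall_congr' fun ⟨j, hj⟩ => ?_
  rw [h y ⟨hj.1, hj.2.1⟩]

theorem measurableSet_inTrap (δ : ℝ) (K : ℕ) (L : ℤ) (y : Site d) :
    MeasurableSet {u | InTrap δ K L y u} := by
  unfold InTrap
  rw [Set.ofPred_forall]
  refine MeasurableSet.iInter fun i => measurableSet_le ?_ measurable_const
  have h : Measurable fun u : Pt d => u i := measurable_pi_apply i
  simpa only [Real.norm_eq_abs] using (h.sub_const _).norm

theorem measurableSet_trap (δ : ℝ) (K : ℕ) (L : ℤ) (ρ : ℕ) (a : Fin 2 → Site d) :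
    MeasurableSet (Trap δ K L ρ a) := by
  unfold Trap
  rw [Set.ofPred_forall]
  refine MeasurableSet.iInter fun y => ?_
  by_cases hy : ∃ j, y ∈ trapSites K L ρ (a j)
  · simp only [hy, true_imp_iff]
    have h : Measurable fun ξ : Env d => ξ y := measurable_pi_apply y
    exact h (measurableSet_inTrap δ K L y)
  · simp [hy]

/-- A lower bound for the probability of a trap: there are at most `2 #(offsets d (K + ρ))` sites
to be controlled. -/
noncomputable def trapProb (d : ℕ) (δ : ℝ) (K ρ : ℕ) : ℝ :=
  ((δ / (K + 2) / (2 * d + 3)) ^ d) ^ (2 * (offsets d (K + ρ)).card)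

theorem IsFresh.trapProb_le (hκ : IsFresh l w κ) {δ : ℝ} (hδ : 0 < δ) (hδ' : δ < 1 / 8) {L : ℤ}
    (hL : l ≤ L) (hw : ∀ j, w j (last d) < L) (K ρ : ℕ) (a : Fin 2 → Site d) :
    ENNReal.ofReal (trapProb d δ K ρ) ≤ Measure.infinitePi κ (Trap δ K L ρ a) := by
  classical
  obtain ⟨hη, hη1, hs⟩ := trap_constants hδ d K
  have hd : (1 : ℝ) ≤ d := by exact_mod_cast NeZero.one_le
  set s := δ / (K + 2) with hsdef
  set η := s / (2 * d + 3) with hηdef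
  have hs0 : 0 < s := by positivity
  have hηs : η ≤ s := by nlinarith
  let base : Fin 2 → Site d := fun j i => if i = last d then L else a j i
  let F : Finset (Site d) := Finset.univ.biUnion fun j =>
    (offsets d (K + ρ)).image fun v => base j + v
  let G : Finset (Site d) := F.filter fun y => ∃ j, y ∈ trapSites K L ρ (a j)
  have hF : ∀ y, (∃ j, y ∈ trapSites K L ρ (a j)) → y ∈ G := fun y hy => by
    refine Finset.mem_filter.2 ⟨?_, hy⟩
    obtain ⟨j, h1, h2, h3⟩ := hy
    refine Finset.mem_biUnion.2 ⟨j, Finset.mem_univ _, Finset.mem_image.2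
      ⟨y - base j, Near.sub_mem_offsets fun i => ?_, by abel⟩⟩
    by_cases hi : i = last d
    · simp only [base, hi, if_true]
      rw [abs_le]; push_cast; constructor <;> omega
    · simp only [base, hi, if_false]
      refine (h3 i hi).trans ?_
      push_cast; omega
  have hcard : G.card ≤ 2 * (offsets d (K + ρ)).card := by
    refine (Finset.card_filter_le _ _).trans (Finset.card_biUnion_le.trans ?_)
    refine (Finset.sum_le_card_nsmul _ _ _ fun j _ => Finset.card_image_le).trans ?_
    simp
  have hset : Trap δ K L ρ a = Set.pi (G : Set (Site d)) fun y => {u | InTrap δ K L y u} := by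
    ext ξ
    simp only [Trap, Set.mem_pi, Finset.mem_coe, Set.mem_ofPred_eq]
    exact ⟨fun h y hy => h y (Finset.mem_filter.1 hy).2, fun h y hy => h y (hF y hy)⟩
  rw [hset, Measure.infinitePi_pi _ fun y _ => measurableSet_inTrap δ K L y]
  have hprod : ∀ y ∈ G, κ y {u | InTrap δ K L y u} = ENNReal.ofReal (η ^ d) := fun y hy => by
    obtain ⟨j, h1, h2, -⟩ := (Finset.mem_filter.1 hy).2
    rw [hκ.law y (hL.trans h1) fun i hi => by
      have := hw i
      rw [← hi] at this
      exact absurd h1 (not_le.2 this)]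
    refine cubeLaw_closeTo hη.le _ fun i => ?_
    have h1' : (L : ℝ) ≤ y (last d) := by exact_mod_cast h1
    have h2' : (y (last d) : ℝ) ≤ L + K := by exact_mod_cast h2
    split_ifs with hi
    · rw [abs_of_nonneg (mul_nonneg hs0.le (by linarith))]
      nlinarith
    · rw [abs_zero]; nlinarith
  rw [Finset.prod_congr rfl hprod, Finset.prod_const, ← ENNReal.ofReal_pow (by positivity)]
  refine ENNReal.ofReal_le_ofReal ?_
  have hη1' : η ≤ 1 := by nlinarith
  exact pow_le_pow_of_le_one (by positivity) (pow_le_one₀ hη.le hη1') hcard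

theorem trapProb_pos (d : ℕ) {δ : ℝ} (hδ : 0 < δ) (K ρ : ℕ) : 0 < trapProb d δ K ρ := by
  unfold trapProb; positivity

/-! ### The site at which an orbit enters a half space -/

theorem measurable_nextSite {f : Env d → Pt d} (hf : Measurable f) :
    Measurable fun ξ => nextSite ξ (f ξ) := by
  refine measurable_firstSite fun w => ?_
  have hlt : ∀ w : Site d, MeasurableSet {ξ | f ξ (last d) < perturbed ξ w (last d)} := fun w =>
    measurableSet_lt ((measurable_pi_apply _).comp hf)
      ((measurable_pi_apply _).comp (measurable_perturbed w))
  have hset : {ξ | IsNext ξ (f ξ) w} = {ξ | f ξ (last d) < perturbed ξ w (last d)} ∩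
      ⋂ w', ({ξ | f ξ (last d) < perturbed ξ w' (last d)}ᶜ ∪
        {ξ | l1Dist (perturbed ξ w) (f ξ) ≤ l1Dist (perturbed ξ w') (f ξ)}) := by
    ext ξ
    simp only [IsNext, Set.mem_ofPred_eq, Set.mem_inter_iff, Set.mem_iInter, Set.mem_union,
      Set.mem_compl_iff, imp_iff_not_or]
  rw [hset]
  exact (hlt w).inter (MeasurableSet.iInter fun w' => (hlt w').compl.union
    (measurableSet_le (measurable_l1Dist (measurable_perturbed w) hf)
      (measurable_l1Dist (measurable_perturbed w') hf)))

theorem measurable_orb (x : Pt d) (k : ℕ) : Measurable fun ξ : Env d => orb ξ x k := by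
  induction k with
  | zero => exact measurable_const
  | succ k ih =>
    simp only [orb_succ]
    exact measurable_next ih

theorem measurable_orbSite (x : Pt d) (w : Site d) (k : ℕ) :
    Measurable fun ξ : Env d => orbSite ξ x w k := by
  cases k with
  | zero => exact measurable_const
  | succ k => exact measurable_nextSite (measurable_orb x k)

/-- The first time at which the orbit of `x` has height at least `b`; `0` if there is none. -/
noncomputable def entryTime (ξ : Env d) (x : Pt d) (b : ℝ) : ℕ :=
  sInf {k | b ≤ orb ξ x k (last d)}

theorem entry_entryTime {ξ : Env d} {x : Pt d} {b : ℝ} {k : ℕ} (h : b ≤ orb ξ x k (last d)) :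
    Entry ξ x b (entryTime ξ x b) ∧ entryTime ξ x b ≤ k :=
  ⟨⟨Nat.sInf_mem (s := {k | b ≤ orb ξ x k (last d)}) ⟨k, h⟩,
    fun _ hj => not_le.1 (Nat.notMem_of_lt_sInf hj)⟩, Nat.sInf_le h⟩

theorem measurable_entryTime (x : Pt d) (b : ℝ) :
    Measurable fun ξ : Env d => entryTime ξ x b := by
  classical
  have hm : ∀ k, MeasurableSet {ξ : Env d | b ≤ orb ξ x k (last d)} := fun k =>
    measurableSet_le measurable_const ((measurable_pi_apply _).comp (measurable_orb x k))
  have hE : MeasurableSet {ξ : Env d | ∃ k, b ≤ orb ξ x k (last d)} := by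
    rw [Set.ofPred_exists]
    exact MeasurableSet.iUnion hm
  let q : Env d → ℕ → Prop := fun ξ k =>
    b ≤ orb ξ x k (last d) ∨ ¬ ∃ k, b ≤ orb ξ x k (last d)
  have hq : ∀ ξ, ∃ k, q ξ k := fun ξ => by
    by_cases h : ∃ k, b ≤ orb ξ x k (last d)
    · exact h.imp fun k hk => Or.inl hk
    · exact ⟨0, Or.inr h⟩
  have hfind : (fun ξ : Env d => entryTime ξ x b) = fun ξ => Nat.find (hq ξ) := by
    funext ξ
    by_cases h : ∃ k, b ≤ orb ξ x k (last d)
    · obtain ⟨k, hk⟩ := h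
      have h1 := entry_entryTime hk
      refine ((Nat.find_eq_iff _).2 ⟨Or.inl h1.1.1, fun j hj => ?_⟩).symm
      rintro (h2 | h2)
      · exact absurd h2 (not_le.2 (h1.1.2 j hj))
      · exact h2 ⟨k, hk⟩
    · rw [entryTime, show {k | b ≤ orb ξ x k (last d)} = ∅ from
        Set.eq_empty_of_forall_notMem fun k hk => h ⟨k, hk⟩, Nat.sInf_empty, eq_comm,
        Nat.find_eq_zero]
      exact Or.inr h
  rw [hfind]
  exact measurable_find hq fun k => (hm k).union hE.compl

/-- The lattice site of the first point of the orbit of height at least `b`. -/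
noncomputable def entrySite (ξ : Env d) (x : Pt d) (w : Site d) (b : ℝ) : Site d :=
  orbSite ξ x w (entryTime ξ x b)

theorem measurable_entrySite (x : Pt d) (w : Site d) (b : ℝ) :
    Measurable fun ξ : Env d => entrySite ξ x w b := by
  have h : Measurable fun p : Env d × ℕ => orbSite p.1 x w p.2 :=
    measurable_from_prod_countable_left fun k => measurable_orbSite x w k
  exact h.comp (measurable_id.prodMk (measurable_entryTime x b))

/-- The entry site depends only on the sites of levels below `b + 3 d + 1`. -/
theorem entrySite_congr {ξ ξ' : Env d} (h : Nice ξ) (h' : Nice ξ') {b : ℤ}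
    (hag : ∀ y : Site d, y (last d) < b + (3 * d + 1) → ξ' y = ξ y) (x : Pt d) (w : Site d) :
    entrySite ξ' x w b = entrySite ξ x w b := by
  have key : ∀ k, (∀ j < k, orb ξ x j (last d) < b) →
      orb ξ' x k = orb ξ x k ∧ orbSite ξ' x w k = orbSite ξ x w k := by
    intro k
    induction k with
    | zero => exact fun _ => ⟨rfl, rfl⟩
    | succ k ih =>
      intro hk
      have h1 := (ih fun j hj => hk j (by omega)).1
      have h2 := nextSite_congr_of_level h h' hag (x := orb ξ x k) (by
        push_cast; linarith [hk k (Nat.lt_succ_self k)])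
      simp only [orbSite, orb_succ, h1]
      exact ⟨h2.2, h2.1⟩
  by_cases hex : ∃ k, (b : ℝ) ≤ orb ξ x k (last d)
  · obtain ⟨k, hk⟩ := hex
    have hE := (entry_entryTime hk).1
    have h1 := key _ hE.2
    have h2 : (b : ℝ) ≤ orb ξ' x (entryTime ξ x b) (last d) := by rw [h1.1]; exact hE.1
    obtain ⟨hE', hle⟩ := entry_entryTime h2
    have heq : entryTime ξ' x b = entryTime ξ x b := by
      refine hle.eq_of_not_lt fun hlt => ?_
      have h3 := (key _ fun j hj => hE.2 j (hj.trans hlt)).1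
      have h4 := hE'.1
      rw [h3] at h4
      exact absurd h4 (not_le.2 (hE.2 _ hlt))
    rw [entrySite, entrySite, heq, h1.2]
  · push Not at hex
    have hall := fun k => key k fun j _ => hex j
    have heq : entryTime ξ' x b = entryTime ξ x b := by
      rw [entryTime, entryTime]
      congr 1
      ext k
      simp [(hall k).1]
    rw [entrySite, entrySite, heq, (hall _).2]

end Fresh

/-! ### The tail of the waiting time in a fresh environment -/

section Tail

open scoped ENNReal

variable {d : ℕ}

open Classical in
/-- The contribution of a block to the supermartingale that counts missed traps: a block in the
event `B` is neutral; otherwise a trap gives the factor `0`, and its absence gives `W`. -/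
noncomputable def missFactor (W : ℝ≥0∞) (B T : Set (Env d)) (ξ : Env d) : ℝ≥0∞ :=
  if ξ ∈ B then 1 else if ξ ∈ T then 0 else W

theorem measurable_missFactor (W : ℝ≥0∞) {B T : Set (Env d)} (hB : MeasurableSet B)
    (hT : MeasurableSet T) : Measurable (missFactor W B T) :=
  Measurable.ite hB measurable_const (Measurable.ite hT measurable_const measurable_const)

theorem missFactor_congr (W : ℝ≥0∞) {B T B' T' : Set (Env d)} {ξ ξ' : Env d}
    (hB : ξ ∈ B ↔ ξ' ∈ B') (hT : ξ ∈ T ↔ ξ' ∈ T') :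
    missFactor W B T ξ = missFactor W B' T' ξ' := by
  classical
  unfold missFactor
  rw [if_congr hB rfl (if_congr hT rfl rfl)]

theorem missFactor_of_mem (W : ℝ≥0∞) {B T : Set (Env d)} {ξ : Env d} (h : ξ ∈ B) :
    missFactor W B T ξ = 1 := if_pos h

theorem missFactor_of_notMem (W : ℝ≥0∞) {B T : Set (Env d)} {ξ : Env d} (h : ξ ∉ B)
    (h' : ξ ∉ T) : missFactor W B T ξ = W := by
  rw [missFactor, if_neg h, if_neg h']

theorem lintegral_missFactor_le {W : ℝ≥0∞} {μ : Measure (Env d)} {T : Set (Env d)}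
    (hT : MeasurableSet T) (hW : W * μ Tᶜ ≤ 1) : ∫⁻ ξ, missFactor W ∅ T ξ ∂μ ≤ 1 := by
  have h : missFactor W ∅ T = Tᶜ.indicator fun _ => W := by
    funext ξ
    by_cases hξ : ξ ∈ T <;> simp [missFactor, hξ]
  rw [h, lintegral_indicator hT.compl, setLIntegral_const]
  exact hW

/-- Traps in successive layers, at locations that are found before the layer is explored, are
missed independently. -/
theorem lintegral_prod_missFactor_le [NeZero d] (κ : Site d → Measure (Pt d))
    [∀ y, IsProbabilityMeasure (κ y)] (hκ : ∀ᵐ ξ ∂Measure.infinitePi κ, Nice ξ) {M : ℕ → ℤ}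
    (hM : Monotone M) {B : ℕ → Set (Env d)} (hBm : ∀ i, MeasurableSet (B i))
    {loc : ℕ → Env d → Fin 2 → Site d} (hlm : ∀ i, Measurable (loc i))
    (hB : ∀ i ξ ξ', Nice ξ → Nice ξ' → (∀ y : Site d, y (last d) < M i → ξ' y = ξ y) →
      (ξ' ∈ B i ↔ ξ ∈ B i) ∧ loc i ξ' = loc i ξ)
    {T : ℕ → (Fin 2 → Site d) → Set (Env d)} (hTm : ∀ i a, MeasurableSet (T i a))
    (hT : ∀ i a ξ ξ', (∀ y : Site d, M i ≤ y (last d) ∧ y (last d) < M (i + 1) → ξ' y = ξ y) →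
      (ξ' ∈ T i a ↔ ξ ∈ T i a))
    {W : ℝ≥0∞} (hW : ∀ i a, W * Measure.infinitePi κ (T i a)ᶜ ≤ 1) (n : ℕ) :
    ∫⁻ ξ, ∏ i ∈ Finset.range n, missFactor W (B i) {ξ | ξ ∈ T i (loc i ξ)} ξ
      ∂Measure.infinitePi κ ≤ 1 := by
  classical
  have hTlm : ∀ i, MeasurableSet {ξ | ξ ∈ T i (loc i ξ)} := fun i => by
    have : {ξ | ξ ∈ T i (loc i ξ)} = ⋃ a, loc i ⁻¹' {a} ∩ T i a := by
      ext ξ; simp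
    rw [this]
    exact MeasurableSet.iUnion fun a => (hlm i (measurableSet_singleton a)).inter (hTm i a)
  have hXm : ∀ i, Measurable (missFactor W (B i) {ξ | ξ ∈ T i (loc i ξ)}) := fun i =>
    measurable_missFactor W (hBm i) (hTlm i)
  induction n with
  | zero => simp
  | succ n ih =>
    rw [lintegral_eq_glue κ {y | y (last d) < M n} (Finset.measurable_prod _ fun i _ => hXm i)]
    refine (lintegral_mono_ae (hκ.mono fun ξ hξ => ?_)).trans ih
    have h1 : ∀ᵐ ζ ∂Measure.infinitePi κ, ∏ i ∈ Finset.range (n + 1),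
        missFactor W (B i) {ξ | ξ ∈ T i (loc i ξ)} (glue {y | y (last d) < M n} ξ ζ) =
        (∏ i ∈ Finset.range n, missFactor W (B i) {ξ | ξ ∈ T i (loc i ξ)} ξ) *
          (if ξ ∈ B n then 1 else missFactor W ∅ (T n (loc n ξ)) ζ) := hκ.mono fun ζ hζ => by
      rw [Finset.prod_range_succ]
      have hlow : ∀ y : Site d, y (last d) < M n →
          glue {y | y (last d) < M n} ξ ζ y = ξ y := fun y hy => glue_of_mem hy ξ ζ
      congr 1
      · refine Finset.prod_congr rfl fun i hi => ?_
        have hi' : M (i + 1) ≤ M n := hM (by have := Finset.mem_range.1 hi; omega)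
        have h2 := hB i _ _ hξ (hξ.glue hζ) fun y hy =>
          hlow y (hy.trans_le ((hM i.le_succ).trans hi'))
        have h3 := hT i (loc i ξ) ξ (glue {y | y (last d) < M n} ξ ζ) fun y hy =>
          hlow y (hy.2.trans_le hi')
        refine missFactor_congr W h2.1 ?_
        rw [Set.mem_ofPred_eq, h2.2, h3, Set.mem_ofPred_eq]
      · have h2 := hB n _ _ hξ (hξ.glue hζ) hlow
        have h3 := hT n (loc n ξ) ζ (glue {y | y (last d) < M n} ξ ζ) fun y hy =>
          glue_of_notMem (S := {y | y (last d) < M n}) (not_lt.2 hy.1) ξ ζ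
        by_cases hb : ξ ∈ B n
        · rw [if_pos hb, missFactor_of_mem W (h2.1.2 hb)]
        · rw [if_neg hb]
          refine missFactor_congr W (by simp [h2.1, hb]) ?_
          rw [Set.mem_ofPred_eq, h2.2, h3]
    rw [lintegral_congr_ae h1]
    by_cases hb : ξ ∈ B n
    · simp [hb]
    · simp only [hb, if_false]
      rw [lintegral_const_mul _ (measurable_missFactor W MeasurableSet.empty (hTm n _))]
      exact mul_le_of_le_one_right bot_le (lintegral_missFactor_le (hTm n _) (hW n _))

theorem measurableSet_mem_of_countable {α : Type*} [Countable α] [MeasurableSpace α]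
    [MeasurableSingletonClass α] {f : Env d → α} (hf : Measurable f) {T : α → Set (Env d)}
    (hT : ∀ a, MeasurableSet (T a)) : MeasurableSet {ξ | ξ ∈ T (f ξ)} := by
  have : {ξ | ξ ∈ T (f ξ)} = ⋃ a, f ⁻¹' {a} ∩ T a := by
    ext ξ; simp
  rw [this]
  exact MeasurableSet.iUnion fun a => (hf (measurableSet_singleton a)).inter (hT a)

variable [NeZero d]

/-- The number of levels in a block of levels: it leaves room for a trap in which both paths make
`m + 1` up steps. -/
def blockHeight (d m : ℕ) : ℕ := 6 * d + m + 7

/-- The lowest level of the `i`-th block above the level `l`. -/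
def blockLevel (d m : ℕ) (l : ℤ) (i : ℕ) : ℤ := l + (i + 1) * blockHeight d m

/-- The sites at which the two paths enter the `i`-th block. -/
noncomputable def blockEntry (m : ℕ) (l : ℤ) (w : Fin 2 → Site d) (x : Pt d × Pt d) (i : ℕ)
    (ξ : Env d) (j : Fin 2) : Site d :=
  entrySite ξ (startPt x j) (w j) (blockLevel d m l i)

theorem blockLevel_succ (d m : ℕ) (l : ℤ) (i : ℕ) :
    blockLevel d m l (i + 1) = blockLevel d m l i + (6 * d + m + 7) := by
  simp only [blockLevel, blockHeight]; push_cast; ring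

theorem blockLevel_mono (d m : ℕ) (l : ℤ) : Monotone (blockLevel d m l) :=
  monotone_nat_of_le_succ fun i => by rw [blockLevel_succ]; omega

theorem add_le_blockLevel (d m : ℕ) (l : ℤ) (i : ℕ) : l + 7 ≤ blockLevel d m l i := by
  refine le_trans ?_ (blockLevel_mono d m l (Nat.zero_le i))
  simp only [blockLevel, blockHeight]; push_cast; omega

theorem IsStart.lt_blockLevel {l : ℤ} {w : Fin 2 → Site d} {x : Pt d × Pt d}
    (hx : IsStart l w x) (m i : ℕ) (j : Fin 2) : w j (last d) < blockLevel d m l i := by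
  have h1 := (abs_le.1 (hx.near j (last d))).1
  have h2 := hx.lt j
  have h3 : (w j (last d) : ℝ) < l + 2 := by linarith
  have h4 : w j (last d) < l + 2 := by exact_mod_cast h3
  have := add_le_blockLevel d m l i
  omega

theorem measurable_blockEntry (m : ℕ) (l : ℤ) (w : Fin 2 → Site d) (x : Pt d × Pt d) (i : ℕ) :
    Measurable (blockEntry m l w x i) :=
  measurable_pi_lambda _ fun _ => measurable_entrySite _ _ _

theorem blockEntry_congr (m : ℕ) (l : ℤ) (w : Fin 2 → Site d) (x : Pt d × Pt d) (i : ℕ)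
    {ξ ξ' : Env d} (h : Nice ξ) (h' : Nice ξ')
    (hag : ∀ y : Site d, y (last d) < blockLevel d m l i + (3 * d + 1) → ξ' y = ξ y) :
    blockEntry m l w x i ξ' = blockEntry m l w x i ξ :=
  funext fun _ => entrySite_congr h h' hag _ _

/-- A long chain starts at the entry of one of the two paths into the `i`-th block. -/
def LongChainAt (m n : ℕ) (l : ℤ) (i : ℕ) (a : Fin 2 → Site d) : Set (Env d) :=
  {ξ | ∃ j, ξ ∈ LongChain n (blockLevel d m l i) (a j)}

theorem measurableSet_longChainAt (m n : ℕ) (l : ℤ) (i : ℕ) (a : Fin 2 → Site d) :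
    MeasurableSet (LongChainAt m n l i a) := by
  unfold LongChainAt
  rw [Set.ofPred_exists]
  exact MeasurableSet.iUnion fun j => measurableSet_longChain _ _ _

/-- The trap in the `i`-th block. -/
def BlockTrap (δ : ℝ) (m ρ : ℕ) (l : ℤ) (i : ℕ) (a : Fin 2 → Site d) : Set (Env d) :=
  Trap δ (3 * d + m + 5) (blockLevel d m l i + (3 * d + 1)) ρ a

/-- The number of blocks with a long chain at the entry of one given path is rarely large. -/
theorem measure_longChain_blocks_le {l : ℤ} {w : Fin 2 → Site d} {x : Pt d × Pt d}
    {κ : Site d → Measure (Pt d)} [∀ y, IsProbabilityMeasure (κ y)] (hx : IsStart l w x)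
    (hκ : IsFresh l w κ) (m : ℕ) {t : ℝ≥0∞} (ht : 1 ≤ t) (htop : t ≠ ⊤) {n : ℕ}
    (htn : t * (ENNReal.ofReal (Real.exp (rate d * (3 * d + 1))) * 4⁻¹ ^ n) ≤ 1) (j : Fin 2)
    (T J : ℕ) :
    Measure.infinitePi κ {ξ | Nice ξ ∧ ∃ B : Finset ℕ, J ≤ B.card ∧ ∀ i ∈ B,
      ((blockLevel d m l i : ℤ) : ℝ) ≤ orb ξ (startPt x j) T (last d) ∧
      ξ ∈ LongChain n (blockLevel d m l i) (blockEntry m l w x i ξ j)} ≤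
      (3 * numSteps d : ℝ≥0∞) ^ T / t ^ J := by
  have hnice := ae_nice_infinitePi κ hκ.nice
  let D : ℕ → Site d → Set (Env d) := fun i a => LongChain n (blockLevel d m l i) a
  have hDm : ∀ i a, MeasurableSet (D i a) := fun i a => measurableSet_longChain _ _ _
  have hint := lintegral_blockWeight_le (t := t) (3 * d + 2) (D := D)
    (T := fun i => {y | blockLevel d m l i ≤ y (last d) ∧
      y (last d) < blockLevel d m l i + (3 * d + 1)}) hDm
    (fun i a ξ ξ' h => longChain_congr _ _ _ h)
    (fun i i' hii => Set.disjoint_left.2 fun y hy hy' => by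
      have h1 := blockLevel_mono d m l (show i + 1 ≤ i' by omega)
      have h2 := blockLevel_succ d m l i
      have h3 := hy.2
      have h4 := hy'.1
      omega) κ hnice
    (fun i a => hκ.measure_longChain_le (by have := add_le_blockLevel d m l i; omega)
      (hx.lt_blockLevel m i) n a)
    htn T 0 (w j)
  have hsub : {ξ : Env d | Nice ξ ∧ ∃ B : Finset ℕ, J ≤ B.card ∧ ∀ i ∈ B,
      ((blockLevel d m l i : ℤ) : ℝ) ≤ orb ξ (startPt x j) T (last d) ∧
      ξ ∈ LongChain n (blockLevel d m l i) (blockEntry m l w x i ξ j)} ⊆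
      {ξ | t ^ J ≤ blockWeight t (3 * d + 2) D T 0 (w j) ξ} := by
    rintro ξ ⟨hξ, B, hJ, hB⟩
    have hstart : ∀ i, startPt x j (last d) < blockLevel d m l i := fun i => by
      have h1 : l + 1 ≤ blockLevel d m l i := by
        have := add_le_blockLevel d m l i; omega
      have h2 : (l : ℝ) + 1 ≤ blockLevel d m l i := by exact_mod_cast h1
      linarith [hx.lt j]
    refine (pow_le_pow_right₀ ht hJ).trans (pow_card_le_blockWeight t D hξ (hx.near j)
      (lv := fun i => blockLevel d m l i) (fun i => ?_) T 0 0 B (hstart 0) fun i hi => ?_)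
    · have h1 : blockLevel d m l i + 3 * d ≤ blockLevel d m l (i + 1) := by
        rw [blockLevel_succ]; omega
      exact_mod_cast h1
    · obtain ⟨hT, hL⟩ := hB i hi
      obtain ⟨h1, h2⟩ := entry_entryTime hT
      refine ⟨Nat.zero_le _, _, Nat.pos_of_ne_zero fun h0 => ?_, by omega, h1, hL⟩
      have := h1.1
      rw [h0, orb_zero] at this
      exact absurd this (not_le.2 (hstart i))
  refine (measure_mono hsub).trans ((meas_ge_le_lintegral_div
    (measurable_blockWeight t _ hDm T 0 (w j)).aemeasurable
    (pow_ne_zero _ (zero_lt_one.trans_le ht).ne') (ENNReal.pow_ne_top htop)).trans ?_)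
  exact ENNReal.div_le_div_right hint _

theorem lintegral_block_missFactor_le {l : ℤ} {w : Fin 2 → Site d} {x : Pt d × Pt d}
    {κ : Site d → Measure (Pt d)} [∀ y, IsProbabilityMeasure (κ y)] (hx : IsStart l w x)
    (hκ : IsFresh l w κ) {δ : ℝ} (hδ : 0 < δ) (hδ' : δ < 1 / 8) (m n ρ : ℕ) {W : ℝ≥0∞}
    (hW : W * (1 - ENNReal.ofReal (trapProb d δ (3 * d + m + 5) ρ)) ≤ 1) (I : ℕ) :
    ∫⁻ ξ, ∏ i ∈ Finset.range I, missFactor W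
      {ξ | ξ ∈ LongChainAt m n l i (blockEntry m l w x i ξ)}
      {ξ | ξ ∈ BlockTrap δ m ρ l i (blockEntry m l w x i ξ)} ξ ∂Measure.infinitePi κ ≤ 1 := by
  refine lintegral_prod_missFactor_le κ (ae_nice_infinitePi κ hκ.nice)
    (M := fun i => blockLevel d m l i + (3 * d + 1))
    (B := fun i => {ξ | ξ ∈ LongChainAt m n l i (blockEntry m l w x i ξ)})
    (loc := blockEntry m l w x) (T := BlockTrap δ m ρ l) (W := W)
    (fun i i' h => add_le_add_left (blockLevel_mono d m l h) _)
    (fun i => measurableSet_mem_of_countable (measurable_blockEntry m l w x i)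
      (measurableSet_longChainAt m n l i))
    (measurable_blockEntry m l w x) (fun i ξ ξ' hξ hξ' h => ?_)
    (fun i a => measurableSet_trap _ _ _ _ _) (fun i a ξ ξ' h => ?_) (fun i a => ?_) I
  · have h1 := blockEntry_congr m l w x i hξ hξ' h
    refine ⟨?_, h1⟩
    rw [Set.mem_ofPred_eq, Set.mem_ofPred_eq, h1]
    exact exists_congr fun j => longChain_congr _ _ _ fun y hy => h y hy.2
  · refine trap_congr _ _ _ _ _ fun y hy => h y ⟨hy.1, ?_⟩
    have h1 := blockLevel_succ d m l i
    have h2 := hy.2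
    push_cast at h2
    omega
  · rw [prob_compl_eq_one_sub (s := BlockTrap δ m ρ l i a) (measurableSet_trap _ _ _ _ _)]
    refine le_trans (mul_le_mul_right (tsub_le_tsub_left ?_ _) _) hW
    have h1 := add_le_blockLevel d m l i
    exact hκ.trapProb_le hδ hδ' (by omega) (fun j => by
      have := hx.lt_blockLevel m i j; omega) _ _ _

/-- Many blocks without long chains, but all without a trap, are unlikely. -/
theorem measure_no_trap_blocks_le {l : ℤ} {w : Fin 2 → Site d} {x : Pt d × Pt d}
    {κ : Site d → Measure (Pt d)} [∀ y, IsProbabilityMeasure (κ y)] (hx : IsStart l w x)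
    (hκ : IsFresh l w κ) {δ : ℝ} (hδ : 0 < δ) (hδ' : δ < 1 / 8) (m n ρ : ℕ) {W : ℝ≥0∞}
    (hW1 : 1 ≤ W) (htop : W ≠ ⊤)
    (hW : W * (1 - ENNReal.ofReal (trapProb d δ (3 * d + m + 5) ρ)) ≤ 1) (I J : ℕ) :
    Measure.infinitePi κ {ξ | ∃ G ⊆ Finset.range I, J ≤ G.card ∧ ∀ i ∈ Finset.range I,
      (i ∈ G → ξ ∉ LongChainAt m n l i (blockEntry m l w x i ξ) ∧
        ξ ∉ BlockTrap δ m ρ l i (blockEntry m l w x i ξ)) ∧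
      (i ∉ G → ξ ∈ LongChainAt m n l i (blockEntry m l w x i ξ))} ≤ (W ^ J)⁻¹ := by
  classical
  have hm : Measurable fun ξ => ∏ i ∈ Finset.range I, missFactor W
      {ξ | ξ ∈ LongChainAt m n l i (blockEntry m l w x i ξ)}
      {ξ | ξ ∈ BlockTrap δ m ρ l i (blockEntry m l w x i ξ)} ξ :=
    Finset.measurable_prod _ fun i _ => measurable_missFactor W
      (measurableSet_mem_of_countable (measurable_blockEntry m l w x i)
        (measurableSet_longChainAt m n l i))
      (measurableSet_mem_of_countable (measurable_blockEntry m l w x i)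
        fun a => measurableSet_trap _ _ _ _ _)
  have hint := lintegral_block_missFactor_le hx hκ hδ hδ' m n ρ hW I
  refine (measure_mono ?_).trans ((meas_ge_le_lintegral_div hm.aemeasurable (ε := W ^ J)
    (pow_ne_zero _ (zero_lt_one.trans_le hW1).ne') (ENNReal.pow_ne_top htop)).trans ?_)
  · rintro ξ ⟨G, hG, hJ, h⟩
    calc W ^ J ≤ W ^ G.card := pow_le_pow_right₀ hW1 hJ
      _ = ∏ i ∈ Finset.range I, if i ∈ G then W else 1 := by
          rw [Finset.prod_ite_mem, Finset.inter_eq_right.2 hG, Finset.prod_const]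
      _ ≤ _ := Finset.prod_le_prod' fun i hi => ?_
    by_cases hiG : i ∈ G
    · obtain ⟨h1, h2⟩ := (h i hi).1 hiG
      rw [if_pos hiG]
      refine Eq.ge (missFactor_of_notMem W ?_ ?_)
      · rw [Set.mem_ofPred_eq]; exact h1
      · rw [Set.mem_ofPred_eq]; exact h2
    · rw [if_neg hiG]
      refine Eq.ge (missFactor_of_mem W ?_)
      rw [Set.mem_ofPred_eq]
      exact (h i hi).2 hiG
  · rw [← one_div]
    exact ENNReal.div_le_div_right hint _

end Tail

section TailBound

open scoped ENNReal

variable {d : ℕ} [NeZero d]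

/-- If both orbits climb fast and no renewal step occurs, then one of the two paths meets long
chains in many blocks, or many blocks without long chains contain no trap. -/
theorem blocks_of_not_endsRun {δ : ℝ} (hδ : 0 < δ) (hδ' : δ < 1 / 8) {m n ρ : ℕ} (hn : n ≠ 0)
    (hρ : (3 * d + 2) * n + 2 ≤ ρ) {l : ℤ} {w : Fin 2 → Site d} {x : Pt d × Pt d}
    (hx : IsStart l w x) {ξ : Env d} (hξ : Nice ξ) {T J : ℕ}
    (hT : ∀ j, l + ((4 * J + 2 : ℕ) : ℝ) * blockHeight d m ≤ orb ξ (startPt x j) T (last d))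
    (hno : ¬ ∃ n', m < n' ∧ n' ≤ 2 * T ∧ EndsRun ξ δ m (jointFrom x ξ) n') :
    (∃ j, ∃ B : Finset ℕ, J ≤ B.card ∧ ∀ i ∈ B,
      ((blockLevel d m l i : ℤ) : ℝ) ≤ orb ξ (startPt x j) T (last d) ∧
      ξ ∈ LongChain n (blockLevel d m l i) (blockEntry m l w x i ξ j)) ∨
    ∃ G ⊆ Finset.range (4 * J), 2 * J ≤ G.card ∧ ∀ i ∈ Finset.range (4 * J),
      (i ∈ G → ξ ∉ LongChainAt m n l i (blockEntry m l w x i ξ) ∧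
        ξ ∉ BlockTrap δ m ρ l i (blockEntry m l w x i ξ)) ∧
      (i ∉ G → ξ ∈ LongChainAt m n l i (blockEntry m l w x i ξ)) := by
  classical
  have hlev : ∀ i < 4 * J, (blockLevel d m l i : ℝ) + 2 * blockHeight d m ≤
      l + ((4 * J + 2 : ℕ) : ℝ) * blockHeight d m := fun i hi => by
    have h1 : (i : ℝ) + 1 ≤ (4 * J : ℕ) := by exact_mod_cast hi
    have h2 : (0 : ℝ) ≤ blockHeight d m := Nat.cast_nonneg _
    simp only [blockLevel]
    push_cast at *
    nlinarith
  have hH : (blockHeight d m : ℝ) = 6 * d + m + 7 := by simp [blockHeight]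
  have hent : ∀ i < 4 * J, ∀ j, (blockLevel d m l i : ℝ) ≤ orb ξ (startPt x j) T (last d) :=
    fun i hi j => by
      have h1 := hlev i hi
      have h2 := hT j
      have h3 : (0 : ℝ) ≤ blockHeight d m := Nat.cast_nonneg _
      linarith
  let B : Fin 2 → Finset ℕ := fun j => (Finset.range (4 * J)).filter fun i =>
    ξ ∈ LongChain n (blockLevel d m l i) (blockEntry m l w x i ξ j)
  by_cases hB : ∃ j, J ≤ (B j).card
  · obtain ⟨j, hj⟩ := hB
    refine Or.inl ⟨j, B j, hj, fun i hi => ?_⟩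
    obtain ⟨h1, h2⟩ := Finset.mem_filter.1 hi
    exact ⟨hent i (Finset.mem_range.1 h1) j, h2⟩
  push Not at hB
  have hLC : ∀ i, ξ ∈ LongChainAt m n l i (blockEntry m l w x i ξ) ↔
      ∃ j, ξ ∈ LongChain n (blockLevel d m l i) (blockEntry m l w x i ξ j) := fun i => Iff.rfl
  refine Or.inr ⟨Finset.range (4 * J) \ (B 0 ∪ B 1), Finset.sdiff_subset, ?_, fun i hi => ⟨?_, ?_⟩⟩
  · have h1 := Finset.le_card_sdiff (B 0 ∪ B 1) (Finset.range (4 * J))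
    have h2 := Finset.card_union_le (B 0) (B 1)
    have h3 := hB 0
    have h4 := hB 1
    rw [Finset.card_range] at h1
    omega
  · intro hiG
    have hi' := Finset.mem_range.1 hi
    have hnot : ∀ j, ξ ∉ LongChain n (blockLevel d m l i) (blockEntry m l w x i ξ j) :=
      fun j hj => by
        refine (Finset.mem_sdiff.1 hiG).2 (Finset.mem_union.2 ?_)
        have : i ∈ B j := Finset.mem_filter.2 ⟨hi, hj⟩
        fin_cases j
        · exact Or.inl this
        · exact Or.inr this
    refine ⟨fun h => ?_, fun htrap => hno ?_⟩
    · obtain ⟨j, hj⟩ := (hLC i).1 h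
      exact hnot j hj
    have hE := fun j => (entry_entryTime (hent i hi' j)).1
    refine exists_endsRun_of_trap hδ hδ' hξ (b := blockLevel d m l i) htrap hx.near
      (fun j => ?_) hE (fun j => rfl)
      (fun j => exists_exit hξ (hx.near j) hn (hE j).1 (hnot j)) hρ (by omega) fun j => ?_
    · have h1 := add_le_blockLevel d m l i
      have h2 : (l : ℝ) + 7 ≤ blockLevel d m l i := by exact_mod_cast h1
      linarith [hx.lt j]
    · -- at time `2 T` one of the paths has made at least `T` moves
      obtain ⟨c, hc, -, hc2⟩ := exists_jointFrom_eq_orb x ξ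
      obtain ⟨j', hj'⟩ : ∃ j', T ≤ c j' (2 * T) := by
        by_contra hcon
        push Not at hcon
        have := hcon 0
        have := hcon 1
        have := hc2 (2 * T)
        omega
      have h1 : orb ξ (startPt x j') T (last d) ≤ jointFrom x ξ j' (2 * T) (last d) := by
        rw [hc]
        exact (orb_strictMono hξ _).monotone hj'
      have h2 := jointFrom_le_add hξ (x := x) (fun a b => by
        rw [jointFrom_zero, jointFrom_zero]
        linarith [hx.lt a, hx.le b]) (2 * T) j' j
      have h3 := hlev i hi'
      have h4 := hT j'
      have h5 : (0 : ℝ) ≤ m := Nat.cast_nonneg m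
      linarith
  · intro hiG
    by_contra hcon
    refine hiG (Finset.mem_sdiff.2 ⟨hi, fun hmem => hcon ((hLC i).2 ?_)⟩)
    rcases Finset.mem_union.1 hmem with h | h
    · exact ⟨0, (Finset.mem_filter.1 h).2⟩
    · exact ⟨1, (Finset.mem_filter.1 h).2⟩

/-- The waiting time for a renewal step has a geometric tail along multiples of a suitable
number of steps. -/
theorem exists_geometric_tail (d : ℕ) [NeZero d] {δ : ℝ} (hδ : 0 < δ) (hδ' : δ < 1 / 8) (m : ℕ) :
    ∃ A θ : ℝ, 0 < A ∧ 0 < θ ∧ θ < 1 ∧ ∃ M : ℕ, 0 < M ∧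
      ∀ (l : ℤ) (w : Fin 2 → Site d) (x : Pt d × Pt d) (κ : Site d → Measure (Pt d))
        [∀ y, IsProbabilityMeasure (κ y)], IsStart l w x → IsFresh l w κ → ∀ J : ℕ, 0 < J →
        Measure.infinitePi κ {ξ | Nice ξ ∧
          ¬ ∃ n', m < n' ∧ n' ≤ M * J ∧ EndsRun ξ δ m (jointFrom x ξ) n'} ≤
          ENNReal.ofReal (A * θ ^ J) := by
  set O : ℕ := numSteps d with hO
  have hO1 : (1 : ℝ) ≤ O := by exact_mod_cast numSteps_pos d
  set H : ℝ := (blockHeight d m : ℝ) with hH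
  have hH0 : 0 ≤ H := Nat.cast_nonneg _
  -- `K` makes the orbits climb fast, `t` makes many long chains unlikely, and `n` makes
  -- a single long chain unlikely
  obtain ⟨K, hK⟩ := pow_unbounded_of_one_lt (2 * Real.exp (rate d * H)) (by norm_num : (1 : ℝ) < 4)
  have hexp1 : 1 ≤ Real.exp (rate d * H) := Real.one_le_exp (mul_nonneg (rate_pos d).le hH0)
  have hK0 : 0 < K := Nat.pos_of_ne_zero fun h => by
    rw [h, pow_zero] at hK; linarith
  set t : ℝ := 2 * (3 * O) ^ (6 * K) with ht
  have ht1 : 1 ≤ t := by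
    have : (1 : ℝ) ≤ (3 * O) ^ (6 * K) := one_le_pow₀ (by linarith)
    linarith
  obtain ⟨n', hn'⟩ := pow_unbounded_of_one_lt (t * Real.exp (rate d * (3 * d + 1)))
    (by norm_num : (1 : ℝ) < 4)
  set n := n' + 1 with hn
  have hn4 : t * Real.exp (rate d * (3 * d + 1)) ≤ 4 ^ n := by
    refine hn'.le.trans (pow_le_pow_right₀ (by norm_num) (by omega))
  set ρ := (3 * d + 2) * n + 2 with hρ
  -- half of the trap probability, so that `1 - p ≥ 1 / 2`
  set p : ℝ := min (trapProb d δ (3 * d + m + 5) ρ) 1 / 2 with hp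
  have htp := trapProb_pos d hδ (3 * d + m + 5) ρ
  have hp0 : 0 < p := by rw [hp]; positivity
  have hp1 : p ≤ 1 / 2 := by rw [hp]; linarith [min_le_right (trapProb d δ (3 * d + m + 5) ρ) 1]
  have hp2 : 2 * p ≤ trapProb d δ (3 * d + m + 5) ρ := by
    rw [hp]; linarith [min_le_left (trapProb d δ (3 * d + m + 5) ρ) 1]
  refine ⟨2 * (16 * O ^ 2) + 2 + 1, 1 - p, by positivity, by linarith, by linarith, 12 * K,
    by positivity, fun l w x κ _ hx hκ J hJ => ?_⟩
  set T := 6 * K * J with hT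
  have hKJ : 1 ≤ K * J := Nat.mul_pos hK0 hJ
  have hT2 : 2 ≤ T := by rw [hT, mul_assoc]; omega
  set s : ℝ := ((4 * J + 2 : ℕ) : ℝ) * H with hs
  -- slow climb
  have hE2 : ∀ j, Measure.infinitePi κ
      {ξ | Nice ξ ∧ orb ξ (startPt x j) T (last d) < l + s} ≤
        ENNReal.ofReal (16 * O ^ 2 * (1 - p) ^ J) := fun j => by
    refine (measure_orb_lt_le hx hκ j hT2 s).trans ?_
    rw [← hO, ← ENNReal.ofReal_natCast O, ← ENNReal.ofReal_pow (by positivity),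
      show (4 : ℝ≥0∞)⁻¹ = ENNReal.ofReal (4⁻¹ : ℝ) by
        rw [ENNReal.ofReal_inv_of_pos (by norm_num)]; norm_num,
      ← ENNReal.ofReal_pow (by positivity), ← ENNReal.ofReal_mul (by positivity),
      ← ENNReal.ofReal_mul (by positivity)]
    refine ENNReal.ofReal_le_ofReal ?_
    have h1 : Real.exp (rate d * s) ≤ Real.exp (rate d * H) ^ (6 * J) := by
      rw [← Real.exp_nat_mul, Real.exp_le_exp, hs]
      have : ((4 * J + 2 : ℕ) : ℝ) ≤ ((6 * J : ℕ) : ℝ) := by exact_mod_cast (by omega)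
      have h2 : 0 ≤ rate d * H := mul_nonneg (rate_pos d).le hH0
      nlinarith
    have h2 : (4⁻¹ : ℝ) ^ (T - 2) = 16 * (4⁻¹ ^ K) ^ (6 * J) := by
      have : (4⁻¹ : ℝ) ^ T = 4⁻¹ ^ (T - 2) * 4⁻¹ ^ 2 := by
        rw [← pow_add, Nat.sub_add_cancel hT2]
      rw [← pow_mul, show K * (6 * J) = T by rw [hT]; ring, this]
      norm_num
      ring
    have h3 : Real.exp (rate d * H) * 4⁻¹ ^ K ≤ 1 / 2 := by
      rw [inv_pow, ← div_eq_mul_inv, div_le_iff₀ (by positivity)]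
      linarith
    calc Real.exp (rate d * s) * ((O : ℝ) ^ 2 * 4⁻¹ ^ (T - 2))
        ≤ Real.exp (rate d * H) ^ (6 * J) * ((O : ℝ) ^ 2 * (16 * (4⁻¹ ^ K) ^ (6 * J))) := by
          rw [h2]; gcongr
      _ = 16 * O ^ 2 * (Real.exp (rate d * H) * 4⁻¹ ^ K) ^ (6 * J) := by rw [mul_pow]; ring
      _ ≤ 16 * O ^ 2 * (1 - p) ^ J := by
          refine mul_le_mul_of_nonneg_left ?_ (by positivity)
          calc _ ≤ (1 / 2 : ℝ) ^ (6 * J) := by gcongr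
            _ ≤ (1 / 2 : ℝ) ^ J := pow_le_pow_of_le_one (by norm_num) (by norm_num) (by omega)
            _ ≤ (1 - p) ^ J := by gcongr; linarith
  -- many long chains
  have hE3 : ∀ j, Measure.infinitePi κ {ξ | Nice ξ ∧ ∃ B : Finset ℕ, J ≤ B.card ∧ ∀ i ∈ B,
      ((blockLevel d m l i : ℤ) : ℝ) ≤ orb ξ (startPt x j) T (last d) ∧
      ξ ∈ LongChain n (blockLevel d m l i) (blockEntry m l w x i ξ j)} ≤
        ENNReal.ofReal ((1 - p) ^ J) := fun j => by
    refine (measure_longChain_blocks_le hx hκ m (t := ENNReal.ofReal t) (n := n)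
      (by rw [ENNReal.one_le_ofReal]; exact ht1) ENNReal.ofReal_ne_top ?_ j T J).trans ?_
    · rw [show (4 : ℝ≥0∞)⁻¹ = ENNReal.ofReal (4⁻¹ : ℝ) by
          rw [ENNReal.ofReal_inv_of_pos (by norm_num)]; norm_num,
        ← ENNReal.ofReal_pow (by positivity), ← ENNReal.ofReal_mul (by positivity),
        ← ENNReal.ofReal_mul (by positivity), ENNReal.ofReal_le_one, ← mul_assoc, inv_pow,
        ← div_eq_mul_inv, div_le_one (by positivity)]
      exact hn4
    · rw [← hO, show (3 * (O : ℝ≥0∞)) = ENNReal.ofReal (3 * O) by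
          rw [ENNReal.ofReal_mul (by norm_num), ENNReal.ofReal_natCast]; norm_num,
        ← ENNReal.ofReal_pow (by positivity), ← ENNReal.ofReal_pow (by positivity),
        ← ENNReal.ofReal_div_of_pos (by positivity)]
      refine ENNReal.ofReal_le_ofReal ?_
      rw [div_le_iff₀ (by positivity), ht, mul_pow 2 ((3 * (O : ℝ)) ^ (6 * K)) J,
        ← pow_mul, ← hT, ← mul_assoc, ← mul_pow]
      have : (1 : ℝ) ≤ ((1 - p) * 2) ^ J := one_le_pow₀ (by linarith)
      exact le_mul_of_one_le_left (by positivity) this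
  -- many blocks without a trap
  have hE4 : Measure.infinitePi κ {ξ | ∃ G ⊆ Finset.range (4 * J), 2 * J ≤ G.card ∧
      ∀ i ∈ Finset.range (4 * J),
      (i ∈ G → ξ ∉ LongChainAt m n l i (blockEntry m l w x i ξ) ∧
        ξ ∉ BlockTrap δ m ρ l i (blockEntry m l w x i ξ)) ∧
      (i ∉ G → ξ ∈ LongChainAt m n l i (blockEntry m l w x i ξ))} ≤
        ENNReal.ofReal ((1 - p) ^ J) := by
    have hp3 : 0 < 1 - p := by linarith
    refine (measure_no_trap_blocks_le hx hκ hδ hδ' m n ρ (W := ENNReal.ofReal (1 - p)⁻¹)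
      ?_ ENNReal.ofReal_ne_top ?_ (4 * J) (2 * J)).trans ?_
    · rw [ENNReal.one_le_ofReal]
      exact (one_le_inv₀ hp3).2 (by linarith)
    · rw [← ENNReal.ofReal_one, ← ENNReal.ofReal_sub _ htp.le,
        ← ENNReal.ofReal_mul (by positivity)]
      refine ENNReal.ofReal_le_ofReal ?_
      rw [inv_mul_le_iff₀ hp3]
      linarith
    · rw [← ENNReal.ofReal_pow (by positivity), ← ENNReal.ofReal_inv_of_pos (by positivity),
        ← inv_pow, inv_inv]
      refine ENNReal.ofReal_le_ofReal (pow_le_pow_of_le_one hp3.le (by linarith) (by omega))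
  refine (measure_mono (t := (⋃ j, ({ξ | Nice ξ ∧ orb ξ (startPt x j) T (last d) < l + s} ∪
    {ξ | Nice ξ ∧ ∃ B : Finset ℕ, J ≤ B.card ∧ ∀ i ∈ B,
      ((blockLevel d m l i : ℤ) : ℝ) ≤ orb ξ (startPt x j) T (last d) ∧
      ξ ∈ LongChain n (blockLevel d m l i) (blockEntry m l w x i ξ j)})) ∪
    {ξ | ∃ G ⊆ Finset.range (4 * J), 2 * J ≤ G.card ∧
      ∀ i ∈ Finset.range (4 * J),
      (i ∈ G → ξ ∉ LongChainAt m n l i (blockEntry m l w x i ξ) ∧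
        ξ ∉ BlockTrap δ m ρ l i (blockEntry m l w x i ξ)) ∧
      (i ∉ G → ξ ∈ LongChainAt m n l i (blockEntry m l w x i ξ))}) ?_).trans ?_
  · rintro ξ ⟨hξ, hno⟩
    by_cases hslow : ∃ j, orb ξ (startPt x j) T (last d) < l + s
    · obtain ⟨j, hj⟩ := hslow
      exact Set.mem_union_left _ (Set.mem_iUnion.2 ⟨j, Set.mem_union_left _ ⟨hξ, hj⟩⟩)
    push Not at hslow
    rw [show 12 * K * J = 2 * T by rw [hT]; ring] at hno
    rcases blocks_of_not_endsRun hδ hδ' (n := n) (ρ := ρ) (by omega) le_rfl hx hξ hslow hno with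
      ⟨j, hj⟩ | h
    · exact Set.mem_union_left _ (Set.mem_iUnion.2 ⟨j, Set.mem_union_right _ ⟨hξ, hj⟩⟩)
    · exact Set.mem_union_right _ h
  · have hp3 : 0 ≤ 1 - p := by linarith
    refine (measure_union_le _ _).trans ((add_le_add ((measure_iUnion_le _).trans
      (ENNReal.tsum_le_tsum fun j => (measure_union_le _ _).trans (add_le_add (hE2 j) (hE3 j))))
      hE4).trans ?_)
    rw [tsum_fintype, Fin.sum_univ_two, ← ENNReal.ofReal_add (by positivity) (by positivity),
      ← ENNReal.ofReal_add (by positivity) (by positivity),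
      ← ENNReal.ofReal_add (by positivity) (by positivity)]
    refine ENNReal.ofReal_le_ofReal (le_of_eq ?_)
    ring

/-- The waiting time for a renewal step in a fresh environment has an exponential tail. -/
theorem exists_exponential_tail (d : ℕ) [NeZero d] {δ : ℝ} (hδ : 0 < δ) (hδ' : δ < 1 / 8)
    (m : ℕ) : ∃ C c : ℝ, 0 < C ∧ 0 < c ∧
      ∀ (l : ℤ) (w : Fin 2 → Site d) (x : Pt d × Pt d) (κ : Site d → Measure (Pt d))
        [∀ y, IsProbabilityMeasure (κ y)], IsStart l w x → IsFresh l w κ → ∀ n : ℕ,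
        Measure.infinitePi κ {ξ | Nice ξ ∧
          ¬ ∃ n', m < n' ∧ n' < n ∧ EndsRun ξ δ m (jointFrom x ξ) n'} ≤
          ENNReal.ofReal (C * Real.exp (-c * n)) := by
  obtain ⟨A, θ, hA, hθ0, hθ1, M, hM, h⟩ := exists_geometric_tail d hδ hδ' m
  have hM' : (0 : ℝ) < M := by exact_mod_cast hM
  set a := -Real.log θ with ha
  have ha0 : 0 < a := by rw [ha]; linarith [Real.log_neg hθ0 hθ1]
  refine ⟨(A + 1) * Real.exp (2 * a), a / M, by positivity, by positivity,
    fun l w x κ _ hx hκ n => ?_⟩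
  have key : ∀ J : ℕ, (n : ℝ) ≤ M * (J + 2) →
      (A + 1) * θ ^ J ≤ (A + 1) * Real.exp (2 * a) * Real.exp (-(a / M) * n) := fun J hJ => by
    rw [mul_assoc, ← Real.exp_add]
    refine mul_le_mul_of_nonneg_left ?_ (by positivity)
    rw [← Real.exp_log hθ0, ← Real.exp_nat_mul, Real.exp_le_exp]
    have h1 : (n : ℝ) / M ≤ J + 2 := by rw [div_le_iff₀ hM']; linarith
    have h2 : a / M * n = a * (n / M) := by ring
    have h3 : Real.log θ = -a := by rw [ha]; ring
    rw [neg_mul, h2, h3]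
    nlinarith
  obtain ⟨J, hJ1, hJ2⟩ : ∃ J : ℕ, M * J < n + 1 ∧ n ≤ M * (J + 1) := by
    refine ⟨n / M, ?_, ?_⟩
    · have := Nat.mul_div_le n M; omega
    · exact (Nat.lt_mul_div_succ n hM).le
  rcases Nat.eq_zero_or_pos (J - 1) with hJ | hJ
  · have h1 := key 0 (by
      have : n ≤ M * 2 := hJ2.trans (Nat.mul_le_mul_left _ (by omega))
      have h3 : (n : ℝ) ≤ M * 2 := by exact_mod_cast this
      simpa using h3)
    refine prob_le_one.trans ?_
    rw [ENNReal.one_le_ofReal]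
    rw [pow_zero] at h1
    linarith
  · have h1 := key (J - 1) (by
      have : n ≤ M * (J - 1 + 2) := hJ2.trans (Nat.mul_le_mul_left _ (by omega))
      exact_mod_cast this)
    refine (measure_mono ?_).trans ((h l w x κ hx hκ (J - 1) hJ).trans
      (ENNReal.ofReal_le_ofReal (le_trans ?_ h1)))
    · rintro ξ ⟨hξ, hno⟩
      refine ⟨hξ, fun ⟨n', h1, h2, h3⟩ => hno ⟨n', h1, h2.trans_lt ?_, h3⟩⟩
      have : M * J = M * (J - 1) + M := by rw [← Nat.mul_succ]; congr 1; omega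
      omega
    · exact mul_le_mul_of_nonneg_right (by linarith) (by positivity)

end TailBound

/-! ### The environment above a renewal step -/

section Run

variable {d : ℕ} [NeZero d]

theorem mem_upperBall_bounds {δ : ℝ} {W : Site d} {p : Pt d} (hp : p ∈ upperBall (toPt W) δ) :
    (W (last d) : ℝ) ≤ p (last d) ∧ p (last d) ≤ W (last d) + δ ∧ ∀ i, |p i - W i| ≤ δ := by
  have h : ∀ i, |p i - W i| ≤ δ := fun i =>
    (abs_sub_le_l1Dist p (toPt W) i).trans hp.2.1
  exact ⟨hp.2.2, by have := (abs_le.1 (h (last d))).2; linarith, h⟩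

theorem upArrow_of_mem_upperBall {δ : ℝ} (hδ' : δ < 1 / 8) {W : Site d} {p : Pt d}
    (hp : p ∈ upperBall (toPt W) δ) : upArrow p = upSite W 1 := by
  obtain ⟨h1, h2, h3⟩ := mem_upperBall_bounds hp
  exact upArrow_eq h1 (by linarith) fun i _ => by linarith [h3 i]

/-- A point within `δ` of `W`, or of a site below `W`, comes from a site near the vertical line
through `W`. -/
theorem abs_sub_le_one_of_perturbed_mem {δ : ℝ} (hδ' : δ < 1 / 8) {ξ : Env d} (hξ : Nice ξ)
    {W z : Site d} {q : ℤ} (hz : perturbed ξ z ∈ upperBall (toPt (upSite W q)) δ) {i : Fin d}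
    (hi : i ≠ last d) : |z i - W i| ≤ 1 := by
  have h1 := (mem_upperBall_bounds hz).2.2 i
  rw [upSite_of_ne _ _ hi] at h1
  have h2 := hξ.abs_perturbed_sub_lt z i
  have h3 := abs_sub_le (z i : ℝ) (perturbed ξ z i) (W i)
  rw [abs_sub_comm (z i : ℝ) (perturbed ξ z i)] at h3
  have h4 : |(z i : ℝ) - W i| < 2 := by linarith
  have h5 : |z i - W i| < 2 := by exact_mod_cast h4
  omega

theorem eq_of_perturbed_mem_upperBall {δ : ℝ} (hδ' : δ < 1 / 8) {ξ : Env d} (hξ : Nice ξ)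
    {W z : Site d} (hW : GoodAt ξ δ W) (hz : perturbed ξ z ∈ upperBall (toPt W) δ) : z = W := by
  obtain ⟨h1, h2, h3⟩ := mem_upperBall_bounds hz
  have hz1 := hξ.lt_perturbed z
  have hz2 := hξ.perturbed_lt z
  have h4 : W (last d) ≤ z (last d) := by
    have : (W (last d) : ℝ) < z (last d) + 1 := by linarith
    have : W (last d) < z (last d) + 1 := by exact_mod_cast this
    omega
  have h5 : z (last d) ≤ W (last d) + 1 := by
    have : (z (last d) : ℝ) < W (last d) + 2 := by linarith
    have : z (last d) < W (last d) + 2 := by exact_mod_cast this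
    omega
  have hn : z ∈ nbhd W := ⟨h4, fun i => by
    by_cases hi : i = last d
    · rw [hi, abs_le]; constructor <;> omega
    · refine abs_sub_le_one_of_perturbed_mem hδ' hξ (W := W) (q := 0) ?_ hi
      simpa [upSite] using hz⟩
  obtain ⟨-, -, h6⟩ := mem_upperBall_bounds (hW z hn)
  funext i
  have h7 := abs_sub_le (z i : ℝ) (perturbed ξ z i) (W i)
  rw [abs_sub_comm (z i : ℝ) (perturbed ξ z i)] at h7
  have h8 : |(z i : ℝ) - W i| < 1 := by linarith [h3 i, h6 i]
  have h9 : |z i - W i| < 1 := by exact_mod_cast h8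
  have := Int.abs_lt_one_iff.1 h9
  omega

/-- If `A(W)` occurs, then the points near the vertical line through `W` and below `W` come from
sites of lower levels. -/
theorem level_lt_of_perturbed_mem {δ : ℝ} (hδ' : δ < 1 / 8) {ξ : Env d} (hξ : Nice ξ)
    {W z : Site d} (hW : GoodAt ξ δ W) {q : ℤ} (hq : q < 0)
    (hz : perturbed ξ z ∈ upperBall (toPt (upSite W q)) δ) : z (last d) < W (last d) := by
  by_contra hcon
  have h4 := not_lt.1 hcon
  obtain ⟨-, h2, -⟩ := mem_upperBall_bounds hz
  rw [upSite_last] at h2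
  have hq' : (q : ℝ) + 1 ≤ 0 := by exact_mod_cast hq
  push_cast at h2
  have h5 : z (last d) ≤ W (last d) + 1 := by
    have : (z (last d) : ℝ) < W (last d) + 2 := by linarith [hξ.lt_perturbed z]
    have : z (last d) < W (last d) + 2 := by exact_mod_cast this
    omega
  have hn : z ∈ nbhd W := ⟨h4, fun i => by
    by_cases hi : i = last d
    · rw [hi, abs_le]; constructor <;> omega
    · exact abs_sub_le_one_of_perturbed_mem hδ' hξ hz hi⟩
  have h6 := (mem_upperBall_bounds (hW z hn)).1
  have h7 : (W (last d) : ℝ) ≤ z (last d) := by exact_mod_cast h4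
  linarith

/-- The points of the sites near `W` on its level and the next one are good. -/
def GoodNear (ξ : Env d) (δ : ℝ) (W : Site d) : Prop :=
  ∀ z : Site d, W (last d) ≤ z (last d) → z (last d) ≤ W (last d) + 1 →
    (∀ i, i ≠ last d → |z i - W i| ≤ 2) → perturbed ξ z ∈ upperBall (toPt z) δ

theorem GoodNear.goodAt {ξ : Env d} {δ : ℝ} {W : Site d} (h : GoodNear ξ δ W) :
    GoodAt ξ δ W := fun z hz => by
  have h1 := (abs_le.1 (hz.2 (last d))).2
  exact h z hz.1 (by omega) fun i _ => (hz.2 i).trans (by norm_num)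

/-- Seen from a point below `W`, the sites of the half space above `W`, except `W` itself, are
not competitive. -/
theorem GoodNear.lt_l1Dist {ξ : Env d} (hξ : Nice ξ) {δ : ℝ} (hδ' : δ < 1 / 8) {W : Site d}
    (h : GoodNear ξ δ W) {p : Pt d} {q : ℤ} (hq : q < 0)
    (hp : p ∈ upperBall (toPt (upSite W q)) δ) {z : Site d} (hz : W (last d) ≤ z (last d))
    (hzW : z ≠ W) : 1 + 2 * δ < l1Dist (perturbed ξ z) p := by
  obtain ⟨-, hp2, hp3⟩ := mem_upperBall_bounds hp
  rw [upSite_last] at hp2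
  have hq' : (q : ℝ) + 1 ≤ 0 := by exact_mod_cast hq
  push_cast at hp2
  have hv := abs_sub_le_l1Dist (perturbed ξ z) p (last d)
  have hv' := le_abs_self (perturbed ξ z (last d) - p (last d))
  by_cases h2 : z (last d) ≤ W (last d) + 1
  swap
  · have h3 : W (last d) + 2 ≤ z (last d) := by omega
    have h4 : (W (last d) : ℝ) + 2 ≤ z (last d) := by exact_mod_cast h3
    linarith [hξ.lt_perturbed z]
  by_cases h3 : ∀ i, i ≠ last d → |z i - W i| ≤ 2
  swap
  · push Not at h3
    obtain ⟨i, hi, h3⟩ := h3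
    have h4 : (3 : ℝ) ≤ |(z i : ℝ) - W i| := by exact_mod_cast h3
    have h5 := hp3 i
    rw [upSite_of_ne _ _ hi] at h5
    have h6 := (hξ.abs_perturbed_sub_lt z i).le
    have h7 := abs_sub_le_l1Dist (perturbed ξ z) p i
    have h8 : |(z i : ℝ) - W i| ≤ |perturbed ξ z i - z i| + |perturbed ξ z i - p i| +
        |p i - W i| := by
      rw [abs_sub_comm (perturbed ξ z i) (z i : ℝ)]
      exact (abs_sub_le _ (p i) _).trans (add_le_add_left (abs_sub_le _ _ _) _)
    linarith
  obtain ⟨h4, -, h5⟩ := mem_upperBall_bounds (h z hz h2 h3)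
  rcases hz.lt_or_eq with hlt | heq
  · have h6 : (W (last d) : ℝ) + 1 ≤ z (last d) := by exact_mod_cast hlt
    linarith
  · have : ∃ i, i ≠ last d ∧ z i ≠ W i := by
      by_contra hcon
      push Not at hcon
      refine hzW (funext fun i => ?_)
      by_cases hi : i = last d
      · rw [hi, heq]
      · exact hcon i hi
    obtain ⟨i, hi, hne⟩ := this
    have h6 : (1 : ℝ) ≤ |(z i : ℝ) - W i| := by
      exact_mod_cast Int.one_le_abs (sub_ne_zero.2 hne)
    have h7 := hp3 i
    rw [upSite_of_ne _ _ hi] at h7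
    have h8 : |(z i : ℝ) - W i| ≤ |perturbed ξ z i - z i| + |perturbed ξ z i - p i| +
        |p i - W i| := by
      rw [abs_sub_comm (perturbed ξ z i) (z i : ℝ)]
      exact (abs_sub_le _ (p i) _).trans (add_le_add_left (abs_sub_le _ _ _) _)
    have h9 := abs_sub_add_abs_sub_le_l1Dist (perturbed ξ z) p hi
    have h10 : (W (last d) : ℝ) = z (last d) := by exact_mod_cast heq
    linarith [h5 i]

variable {δ : ℝ} {m t : ℕ} {ξ : Env d} {x : Pt d × Pt d}

/-- During the up steps before a renewal step, each path follows a vertical line. -/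
theorem EndsRun.upArrow_eq (hδ' : δ < 1 / 8) (hmt : m < t)
    (hE : EndsRun ξ δ m (jointFrom x ξ) t) (i : Fin 2) (k : ℕ) (hk : k < m) :
    upArrow (jointFrom x ξ i (t - 1 - k)) = upSite (upArrow (jointFrom x ξ i (t - 1))) (-k) := by
  induction k with
  | zero => simp [upSite]
  | succ k ih =>
    have h1 := (hE.1 (t - 1 - (k + 1)) (by omega) (by omega)).2 i
    rw [show t - 1 - (k + 1) + 1 = t - 1 - k by omega] at h1
    have h2 := upArrow_of_mem_upperBall hδ' h1
    rw [ih (by omega)] at h2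
    have h3 := congrArg (fun y => upSite y (-1)) h2
    simp only [upSite_upSite] at h3
    rw [show (1 : ℤ) + -1 = 0 by norm_num] at h3
    rw [show (-((k + 1 : ℕ) : ℤ)) = -(k : ℤ) + -1 by push_cast; ring, h3]
    simp [upSite]

theorem EndsRun.mem_upperBall (hδ' : δ < 1 / 8) (hmt : m < t)
    (hE : EndsRun ξ δ m (jointFrom x ξ) t) (i : Fin 2) (k : ℕ) (hk : k < m) :
    jointFrom x ξ i (t - k) ∈
      upperBall (toPt (upSite (upArrow (jointFrom x ξ i (t - 1))) (-k))) δ := by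
  have h1 := (hE.1 (t - 1 - k) (by omega) (by omega)).2 i
  rwa [hE.upArrow_eq hδ' hmt i k hk, show t - 1 - k + 1 = t - k by omega] at h1

theorem EndsRun.level_eq (hmt : m < t) (hm : 0 < m)
    (hE : EndsRun ξ δ m (jointFrom x ξ) t) (i j : Fin 2) :
    upArrow (jointFrom x ξ i (t - 1)) (last d) = upArrow (jointFrom x ξ j (t - 1)) (last d) := by
  have h := (hE.1 (t - 1) (by omega) (by omega)).1 i j
  simp [upArrow, h]

theorem EndsRun.eq_perturbed (hξ : Nice ξ) (hδ' : δ < 1 / 8) (hm : 0 < m) (hmt : m < t)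
    (hE : EndsRun ξ δ m (jointFrom x ξ) t) (i : Fin 2) :
    jointFrom x ξ i t = perturbed ξ (upArrow (jointFrom x ξ i (t - 1))) := by
  have h1 := hE.mem_upperBall hδ' hmt i 0 hm
  have hlow : Lowest (jointFrom x ξ) i (t - 1) := fun j =>
    ((hE.1 (t - 1) (by omega) (by omega)).1 i j).le
  have hex : ∃ z, jointFrom x ξ i t = perturbed ξ z := by
    have h2 := jointFrom_succ_of_lowest hlow
    rw [show t - 1 + 1 = t by omega] at h2
    rcases h2 with h2 | ⟨j, -, -, h2⟩
    · exact ⟨_, h2.trans (next_eq_perturbed _ _)⟩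
    · exact ⟨_, h2.trans (next_eq_perturbed _ _)⟩
  obtain ⟨z, hz⟩ := hex
  have h3 : perturbed ξ z ∈ upperBall (toPt (upArrow (jointFrom x ξ i (t - 1)))) δ := by
    rw [← hz]
    simpa [upSite] using h1
  rw [hz, eq_of_perturbed_mem_upperBall hδ' hξ (hE.2.2 i) h3]

/-! ### The explored region below a renewal step -/

theorem iInf_mono_fin_two {f g : Fin 2 → ℝ} (h : ∀ i, f i ≤ g i) : ⨅ i, f i ≤ ⨅ i, g i :=
  ciInf_mono (Set.finite_range f).bddBelow h

theorem mem_history_of_step (hξ : Nice ξ) {i : Fin 2} {s n : ℕ} (hi : Lowest (jointFrom x ξ) i s)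
    (hsn : s < n) {y : Pt d}
    (hy : y ∈ upperBall (jointFrom x ξ i s) (l1Dist (next ξ (jointFrom x ξ i s))
      (jointFrom x ξ i s)))
    (hn : (⨅ j, jointFrom x ξ j n (last d)) ≤ y (last d)) :
    y ∈ history ξ (jointFrom x ξ) n := by
  induction n with
  | zero => omega
  | succ n ih =>
    refine ⟨?_, hn⟩
    rcases (Nat.lt_succ_iff.1 hsn).lt_or_eq with h | rfl
    · exact Or.inr (ih h ((iInf_mono_fin_two fun j => jointFrom_le_succ hξ x j n).trans hn))
    · exact Or.inl ⟨i, hi, hy⟩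

theorem l1Dist_next_pos (hξ : Nice ξ) (p : Pt d) : 0 < l1Dist (next ξ p) p := by
  have h1 := hξ.lt_next p
  have h2 := abs_sub_le_l1Dist (next ξ p) p (last d)
  have h3 := le_abs_self (next ξ p (last d) - p (last d))
  linarith

/-- The half balls of the steps up to time `n` reach at most `c` above the positions after the
step at time `n`. This is the information about the explored region that the resampling needs, in
a form that is plainly measurable. -/
def TopBound (ξ : Env d) (x : Pt d × Pt d) (c : ℝ) : Prop :=
  ∀ n : ℕ, ∀ s ≤ n, ∀ i i₀, Lowest (jointFrom x ξ) i s → Lowest (jointFrom x ξ) i₀ n →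
    jointFrom x ξ i s (last d) + l1Dist (next ξ (jointFrom x ξ i s)) (jointFrom x ξ i s) ≤
      jointFrom x ξ i₀ (n + 1) (last d) + c

theorem topBound_of_height_le (hξ : Nice ξ) {c : ℝ} (hc : 0 ≤ c)
    (hH : ∀ n, height (history ξ (jointFrom x ξ) n) ≤ c) : TopBound ξ x c := by
  classical
  intro n s hs i i₀ hi hi₀
  set r := l1Dist (next ξ (jointFrom x ξ i s)) (jointFrom x ξ i s) with hr
  have hr0 : 0 < r := l1Dist_next_pos hξ _
  -- the top of the half ball
  let y : Pt d := Function.update (jointFrom x ξ i s) (last d) (jointFrom x ξ i s (last d) + r)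
  have hyl : y (last d) = jointFrom x ξ i s (last d) + r := by simp [y]
  have hyd : l1Dist y (jointFrom x ξ i s) = r := by
    rw [l1Dist, Finset.sum_eq_single (last d)]
    · rw [hyl, add_sub_cancel_left, abs_of_pos hr0]
    · intro b _ hb
      simp [y, hb]
    · simp
  have hinf : (⨅ i', jointFrom x ξ i' (n + 1) (last d)) ≤ jointFrom x ξ i₀ (n + 1) (last d) :=
    ciInf_le (Set.finite_range _).bddBelow i₀
  rw [← hyl]
  by_cases hcut : (⨅ i', jointFrom x ξ i' (n + 1) (last d)) ≤ y (last d)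
  swap
  · linarith
  have hyH := mem_history_of_step hξ hi (show s < n + 1 by omega) (y := y)
    ⟨hr0, hyd.le, by rw [hyl]; linarith⟩ hcut
  have hz : jointFrom x ξ i₀ (n + 1) ∈ history ξ (jointFrom x ξ) (n + 1) := by
    rcases jointFrom_succ_of_lowest hi₀ with h1 | ⟨j', hj', -, h1⟩
    · exact mem_history_of_step hξ hi₀ (by omega)
        ⟨l1Dist_next_pos hξ _, by rw [h1], by rw [h1]; exact (hξ.lt_next _).le⟩ hinf
    · exact mem_history_of_step hξ hj' (by omega)
        ⟨l1Dist_next_pos hξ _, by rw [h1], by rw [h1]; exact (hξ.lt_next _).le⟩ hinf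
  linarith [(sub_le_height_history hξ x hyH hz).trans (hH (n + 1))]

/-- The half balls of the steps before the last `m` up steps stay below the level of the new
lattice sites. -/
theorem EndsRun.ball_le (hδ' : δ < 1 / 8) (hm : 4 ≤ m) (hmt : m < t)
    (hE : EndsRun ξ δ m (jointFrom x ξ) t)
    (hH : TopBound ξ x ((m : ℝ) - 4)) {s : ℕ} (hs : s ≤ t - m)
    {i : Fin 2} (hi : Lowest (jointFrom x ξ) i s) (j : Fin 2) :
    jointFrom x ξ i s (last d) + l1Dist (next ξ (jointFrom x ξ i s)) (jointFrom x ξ i s) ≤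
      upArrow (jointFrom x ξ j (t - 1)) (last d) - 1 := by
  have h1 := (mem_upperBall_bounds (hE.mem_upperBall hδ' hmt j (m - 1) (by omega))).2.1
  rw [upSite_last, show t - (m - 1) = t - m + 1 by omega] at h1
  push_cast [Nat.cast_sub (show 1 ≤ m by omega)] at h1
  have hlow : Lowest (jointFrom x ξ) j (t - m) := fun j' =>
    ((hE.1 (t - m) (by omega) (by omega)).1 j j').le
  linarith [hH (t - m) s hs i j hi hlow]

/-! ### Resampling the environment above a renewal step -/

/-- The sites of the half space above the two paths at a renewal step, other than their next
lattice sites. -/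
def aboveSites (l : ℤ) (w : Fin 2 → Site d) : Set (Site d) :=
  {z | l ≤ z (last d) ∧ ∀ i, z ≠ w i}

/-- The two environments give the same value to everything that generates `𝒢_t`. -/
structure SameData (δ : ℝ) (x : Pt d × Pt d) (t : ℕ) (ξ ξ' : Env d) : Prop where
  path : ∀ s < t, ∀ i, jointFrom x ξ' i s = jointFrom x ξ i s
  site : ∀ s < t, ∀ i, latticeSite ξ' (jointFrom x ξ' i (s + 1)) =
    latticeSite ξ (jointFrom x ξ i (s + 1))
  good : ∀ s < t, (GoodStep ξ' δ (jointFrom x ξ') s ↔ GoodStep ξ δ (jointFrom x ξ) s)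

/-- A renewal step remains one, with the same past, when the environment above is changed, if
the new environment is good near the two paths. -/
theorem EndsRun.sameData (hδ : 0 < δ) (hδ' : δ < 1 / 8) (hm : 4 ≤ m) (hmt : m < t) (hξ : Nice ξ)
    (hH : TopBound ξ x ((m : ℝ) - 4))
    (hE : EndsRun ξ δ m (jointFrom x ξ) t) {l : ℤ} {w : Fin 2 → Site d}
    (hw : ∀ i, upArrow (jointFrom x ξ i (t - 1)) = w i) (hl : ∀ i, w i (last d) = l)
    {ξ' : Env d} (hξ' : Nice ξ') (hag : ∀ z, z ∉ aboveSites l w → ξ' z = ξ z)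
    (hgood : ∀ i, GoodNear ξ' δ (w i)) : SameData δ x t ξ ξ' := by
  have hA : ∀ i, GoodAt ξ δ (w i) := fun i => hw i ▸ hE.2.2 i
  have hB := fun i k hk => hw i ▸ hE.mem_upperBall hδ' hmt i k hk
  -- heights of sites above, in any nice environment
  have hab : ∀ {η : Env d}, Nice η → ∀ z ∈ aboveSites l w,
      (l : ℝ) - 1 < perturbed η z (last d) := fun hη z hz => by
    have h1 : (l : ℝ) ≤ z (last d) := by exact_mod_cast hz.1
    linarith [hη.lt_perturbed z]
  have hBl : ∀ i (k : ℕ), k < m → jointFrom x ξ i (t - k) (last d) ≤ l - k + δ := fun i k hk => by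
    have h1 := (mem_upperBall_bounds (hB i k hk)).2.1
    rw [upSite_last, hl] at h1
    push_cast at h1
    linarith
  -- the position of a path before time `t` is not a point of a site above
  have hnot : ∀ {η : Env d}, Nice η → (∀ i, GoodAt η δ (w i)) → ∀ s < t, ∀ i,
      ∀ z ∈ aboveSites l w, perturbed η z ≠ jointFrom x ξ i s := by
    intro η hη hηA s hs i z hz heq
    rcases (show s ≤ t - 2 ∨ s = t - 1 by omega) with h2 | rfl
    · have h3 := jointFrom_mono hξ x i h2
      have h4 := hBl i 2 (by omega)
      have h5 := hab hη z hz
      rw [heq] at h5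
      push_cast at h4
      simp only at h3
      linarith
    · have h3 := hB i 1 (by omega)
      rw [← heq] at h3
      have h4 := level_lt_of_perturbed_mem hδ' hη (hηA i) (by norm_num) h3
      rw [hl] at h4
      exact absurd hz.1 (not_le.2 h4)
  have hA' : ∀ i, GoodAt ξ' δ (w i) := fun i => (hgood i).goodAt
  have hwξ : ∀ i, ξ' (w i) = ξ (w i) := fun i => hag _ fun h => h.2 i rfl
  have hend : ∀ i, jointFrom x ξ i t = perturbed ξ (w i) := fun i =>
    hw i ▸ hE.eq_perturbed hξ hδ' (by omega) hmt i
  -- the steps are the same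
  have hstep : ∀ s < t, ∀ i, Lowest (jointFrom x ξ) i s →
      next ξ' (jointFrom x ξ i s) = next ξ (jointFrom x ξ i s) := by
    intro s hs i hi
    rcases le_or_gt s (t - m) with hsm | hsm
    · have h1 := hE.ball_le hδ' hm hmt hH hsm hi 0
      rw [hw, hl] at h1
      have h2 := abs_sub_le_l1Dist (next ξ (jointFrom x ξ i s)) (jointFrom x ξ i s) (last d)
      have h3 := le_abs_self (next ξ (jointFrom x ξ i s) (last d) - jointFrom x ξ i s (last d))
      refine next_congr hξ (hag _ fun hz => ?_) fun z => ?_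
      · have h4 := hab hξ _ hz
        rw [← next_eq_perturbed] at h4
        linarith
      · by_cases hz : z ∈ aboveSites l w
        · right; right
          have h4 := hab hξ' z hz
          have h5 := abs_sub_le_l1Dist (perturbed ξ' z) (jointFrom x ξ i s) (last d)
          have h6 := le_abs_self (perturbed ξ' z (last d) - jointFrom x ξ i s (last d))
          linarith
        · exact Or.inl (hag z hz)
    · obtain ⟨k, hk1, hk2, rfl⟩ : ∃ k, 1 ≤ k ∧ k < m ∧ s = t - k :=
        ⟨t - s, by omega, by omega, by omega⟩
      have hp := hB i k hk2
      have hp' := hB i (k - 1) (by omega)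
      rw [show t - (k - 1) = t - k + 1 by omega] at hp'
      refine next_congr hξ (hag _ fun hz => ?_) fun z => ?_
      · rcases jointFrom_succ_of_lowest hi with h1 | ⟨j, -, h1, -⟩
        · rw [next_eq_perturbed] at h1
          rcases (show k = 1 ∨ t - k + 1 < t by omega) with rfl | h2
          · rw [show t - 1 + 1 = t by omega, hend] at h1
            have h3 := hB i 0 (by omega)
            rw [Nat.sub_zero, hend, h1] at h3
            refine hz.2 i (eq_of_perturbed_mem_upperBall hδ' hξ (hA i) ?_)
            simpa [upSite] using h3
          · exact hnot hξ hA _ h2 i _ hz h1.symm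
        · rw [next_eq_perturbed] at h1
          exact hnot hξ hA _ hs j _ hz h1
      · by_cases hz : z ∈ aboveSites l w
        swap
        · exact Or.inl (hag z hz)
        right; right
        refine lt_of_le_of_lt ?_ ((hgood i).lt_l1Dist hξ' hδ' (by omega) hp
          (by rw [hl]; exact hz.1) (hz.2 i))
        -- the position after the step is a candidate at distance at most `1 + 2 δ`
        have hcand : ∃ z', jointFrom x ξ i (t - k + 1) = perturbed ξ z' := by
          rcases jointFrom_succ_of_lowest hi with h1 | ⟨j, -, -, h1⟩
          · exact ⟨_, h1.trans (next_eq_perturbed _ _)⟩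
          · exact ⟨_, h1.trans (next_eq_perturbed _ _)⟩
        obtain ⟨z', hz'⟩ := hcand
        have h2 := jointFrom_lt_succ hξ x hi
        rw [hz'] at h2
        refine (hξ.l1Dist_next_le h2).trans ?_
        rw [← hz']
        have h3 := hp'.2.1
        have h4 := hp.2.1
        rw [l1Dist_comm] at h4
        have h5 : l1Dist (toPt (upSite (w i) (-((k - 1 : ℕ) : ℤ))))
            (toPt (upSite (w i) (-(k : ℤ)))) = 1 := by
          rw [l1Dist, Finset.sum_eq_single (last d)]
          · simp only [toPt, upSite_last]
            push_cast [Nat.cast_sub hk1]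
            norm_num
          · intro b _ hb
            simp [toPt, upSite_of_ne _ _ hb]
          · simp
        have h6 := l1Dist_triangle (jointFrom x ξ i (t - k + 1))
          (toPt (upSite (w i) (-((k - 1 : ℕ) : ℤ)))) (jointFrom x ξ i (t - k))
        have h7 := l1Dist_triangle (toPt (upSite (w i) (-((k - 1 : ℕ) : ℤ))))
          (toPt (upSite (w i) (-(k : ℤ)))) (jointFrom x ξ i (t - k))
        linarith
  have hpath : ∀ s ≤ t, ∀ i, jointFrom x ξ' i s = jointFrom x ξ i s := by
    intro s
    induction s with
    | zero => exact fun _ _ => rfl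
    | succ s ih =>
      exact fun hs => jointFrom_succ_congr (ih (by omega)) fun i hi => hstep s (by omega) i hi
  refine ⟨fun s hs => hpath s hs.le, fun s hs i => ?_, fun s hs => ?_⟩
  · rw [hpath (s + 1) hs]
    unfold latticeSite
    congr 1
    funext z
    refine propext ?_
    by_cases hz : z ∈ aboveSites l w
    · rcases (show s + 1 < t ∨ s + 1 = t by omega) with h1 | h1
      · exact iff_of_false (hnot hξ' hA' _ h1 i z hz) (hnot hξ hA _ h1 i z hz)
      · have h3 := hB i 0 (by omega)
        rw [Nat.sub_zero] at h3
        have h4 : jointFrom x ξ i t ∈ upperBall (toPt (w i)) δ := by simpa [upSite] using h3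
        rw [h1]
        refine iff_of_false (fun h => hz.2 i ?_) fun h => hz.2 i ?_
        · exact eq_of_perturbed_mem_upperBall hδ' hξ' (hA' i) (h ▸ h4)
        · exact eq_of_perturbed_mem_upperBall hδ' hξ (hA i) (h ▸ h4)
    · rw [perturbed_congr (hag z hz)]
  · refine forall_congr' fun i => ?_
    rw [hpath s hs.le i]
    refine forall_congr' fun z => forall_congr' fun hz => ?_
    by_cases hza : z ∈ aboveSites l w
    swap
    · rw [perturbed_congr (hag z hza)]
    -- only the last two steps involve sites above, and those are good in both environments
    rcases (show s ≤ t - 3 ∨ s = t - 2 ∨ s = t - 1 by omega) with h | rfl | rfl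
    · exfalso
      have h1 := jointFrom_mono hξ x i h
      have h2 := hBl i 3 (by omega)
      have h3 : ⌊jointFrom x ξ i s (last d)⌋ < l - 2 := by
        rw [Int.floor_lt]
        push_cast at h2 ⊢
        simp only at h1
        linarith
      have h4 := (abs_le.1 (hz.2 (last d))).2
      have h5 : upArrow (jointFrom x ξ i s) (last d) = ⌊jointFrom x ξ i s (last d)⌋ + 1 := by
        simp [upArrow]
      have h6 := hza.1
      omega
    · have h1 := hE.upArrow_eq hδ' hmt i 1 (by omega)
      rw [hw, show t - 1 - 1 = t - 2 by omega] at h1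
      rw [h1] at hz
      have hn : z ∈ nbhd (w i) := by
        refine ⟨by rw [hl]; exact hza.1, fun b => ?_⟩
        have h2 := hz.2 b
        by_cases hb : b = last d
        · have h3 := hza.1
          subst hb
          rw [upSite_last, hl] at h2
          rw [hl]
          rw [abs_le] at *
          push_cast at h2
          constructor <;> omega
        · rwa [upSite_of_ne _ _ hb] at h2
      exact iff_of_true (hA' i z hn) (hA i z hn)
    · rw [hw] at hz
      exact iff_of_true (hA' i z hz) (hA i z hz)

end Run

/-! ### The waiting time after a renewal step -/

section Conditioning

open scoped ENNReal

variable {d : ℕ}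

/-- The law of the environment: independent uniform perturbations. -/
noncomputable def envLaw (d : ℕ) : Measure (Env d) := Measure.infinitePi fun _ => cubeLaw d

instance : IsProbabilityMeasure (envLaw d) := by unfold envLaw; infer_instance

theorem ae_nice_envLaw : ∀ᵐ ξ ∂envLaw d, Nice ξ := ae_nice_infinitePi _ fun _ => ae_cubeLaw

open Classical in
/-- The laws of the perturbations when those of the sites of `S` are fixed. -/
noncomputable def fixedLaw (S : Set (Site d)) (ξ : Env d) (z : Site d) : Measure (Pt d) :=
  if z ∈ S then Measure.dirac (ξ z) else cubeLaw d

instance (S : Set (Site d)) (ξ : Env d) (z : Site d) :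
    IsProbabilityMeasure (fixedLaw S ξ z) := by
  unfold fixedLaw; split_ifs <;> infer_instance

theorem measurable_glue_right (S : Set (Site d)) (ξ : Env d) : Measurable (glue S ξ) :=
  (measurable_glue S).comp measurable_prodMk_left

theorem map_glue_envLaw (S : Set (Site d)) (ξ : Env d) :
    (envLaw d).map (glue S ξ) = Measure.infinitePi (fixedLaw S ξ) := by
  classical
  have h := Measure.infinitePi_map_pi (μ := fun _ : Site d => cubeLaw d)
    (f := fun z (p : Pt d) => if z ∈ S then ξ z else p) fun z => by
      by_cases hz : z ∈ S
      · simp only [hz, if_true]; exact measurable_const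
      · simp only [hz, if_false]; exact measurable_id
  refine h.trans ?_
  congr 1
  funext z
  by_cases hz : z ∈ S
  · simp only [hz, if_true, fixedLaw]
    rw [Measure.map_const, measure_univ, one_smul]
  · simp only [hz, if_false, fixedLaw]
    exact Measure.map_id

variable [NeZero d]

/-- The waiting time from the start of the exploration has an exponential tail. -/
theorem measure_start_le {δ : ℝ} {m : ℕ} {E : ℝ≥0∞} {n : ℕ}
    (htail : ∀ (l : ℤ) (w : Fin 2 → Site d) (x : Pt d × Pt d) (κ : Site d → Measure (Pt d))
      [∀ y, IsProbabilityMeasure (κ y)], IsStart l w x → IsFresh l w κ →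
      Measure.infinitePi κ {ξ | Nice ξ ∧
        ¬ ∃ n', m < n' ∧ n' < n ∧ EndsRun ξ δ m (jointFrom x ξ) n'} ≤ E)
    {u v : Site d} (huv : u (last d) = v (last d)) :
    envLaw d {ξ | ¬ ∃ n', m < n' ∧ n' < n ∧ EndsRun ξ δ m (jointPath u v ξ) n'} ≤ E := by
  refine (measure_mono_ae ?_).trans (htail (u (last d)) ![u, v] (toPt u, toPt v)
    (fun _ => cubeLaw d) ⟨fun j i => ?_, fun j => ?_, fun j => ?_⟩
    ⟨fun _ => ae_cubeLaw, fun _ _ _ => rfl⟩)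
  · filter_upwards [ae_nice_envLaw (d := d)] with ξ hξ h
    exact ⟨hξ, h⟩
  · fin_cases j <;> simp [startPt, toPt]
  · fin_cases j <;> simp [startPt, toPt, huv]
  · fin_cases j <;> simp [startPt, toPt, huv]

/-- No renewal step occurs within `n` steps after time `t`. -/
def NoRenewal (δ : ℝ) (m n t : ℕ) (x : Pt d × Pt d) : Set (Env d) :=
  {ξ | ¬ ∃ n', m < n' ∧ n' < n ∧
    EndsRun ξ δ m (jointFrom (jointFrom x ξ 0 t, jointFrom x ξ 1 t) ξ) n'}

/-- The estimate after a renewal step with given next lattice sites: the environment above is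
resampled. Given the rest of the environment, either the event `A` has probability `0`, or
it contains all environments that are good near the two paths, and so has probability
at least `q`. -/
theorem measure_inter_noRenewal_le_of_site {δ : ℝ} (hδ : 0 < δ) (hδ' : δ < 1 / 8) {m n t : ℕ}
    (hm : 4 ≤ m) (hmt : m < t) {E : ℝ≥0∞}
    (htail : ∀ (l : ℤ) (w : Fin 2 → Site d) (x : Pt d × Pt d) (κ : Site d → Measure (Pt d))
      [∀ y, IsProbabilityMeasure (κ y)], IsStart l w x → IsFresh l w κ →
      Measure.infinitePi κ {ξ | Nice ξ ∧
        ¬ ∃ n', m < n' ∧ n' < n ∧ EndsRun ξ δ m (jointFrom x ξ) n'} ≤ E)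
    {x : Pt d × Pt d}
    (hH : ∀ᵐ ξ ∂envLaw d, TopBound ξ x ((m : ℝ) - 4))
    {A B : Set (Env d)} (hA : MeasurableSet A) (hB : MeasurableSet B)
    (hBn : B ⊆ NoRenewal δ m n t x)
    (hinv : ∀ ξ ξ', SameData δ x t ξ ξ' → (ξ ∈ A ↔ ξ' ∈ A))
    (hE : ∀ᵐ ξ ∂envLaw d, ξ ∈ A → EndsRun ξ δ m (jointFrom x ξ) t) (w : Fin 2 → Site d)
    (hw : ∀ ξ ∈ A, ∀ i, upArrow (jointFrom x ξ i (t - 1)) = w i) :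
    envLaw d (A ∩ B) ≤ E / ENNReal.ofReal (trapProb d δ 1 2) * envLaw d A := by
  classical
  set l := w 0 (last d) with hl
  set S : Set (Site d) := (aboveSites l w)ᶜ with hS
  set q := ENNReal.ofReal (trapProb d δ 1 2) with hq
  have hq0 : q ≠ 0 := by
    rw [hq, Ne, ENNReal.ofReal_eq_zero, not_le]; exact trapProb_pos d hδ 1 2
  have hwS : ∀ i, w i ∈ S := fun i h => h.2 i rfl
  have hgl : ∀ ξ ζ : Env d, ∀ z, z ∉ aboveSites l w → glue S ξ ζ z = ξ z := fun ξ ζ z hz =>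
    glue_of_mem (S := S) hz ξ ζ
  have hga : ∀ ξ ζ : Env d, ∀ z ∈ aboveSites l w, glue S ξ ζ z = ζ z := fun ξ ζ z hz =>
    glue_of_notMem (S := S) (fun h => h hz) ξ ζ
  -- almost every resampled environment has all almost sure properties
  have hae : ∀ᵐ ξ ∂envLaw d, ∀ᵐ ζ ∂envLaw d, Nice (glue S ξ ζ) ∧
      TopBound (glue S ξ ζ) x ((m : ℝ) - 4) ∧
      (glue S ξ ζ ∈ A → EndsRun (glue S ξ ζ) δ m (jointFrom x (glue S ξ ζ)) t) := by
    have h1 : ∀ᵐ ξ ∂envLaw d, Nice ξ ∧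
        TopBound ξ x ((m : ℝ) - 4) ∧
        (ξ ∈ A → EndsRun ξ δ m (jointFrom x ξ) t) := by
      filter_upwards [ae_nice_envLaw (d := d), hH, hE] with ξ h1 h2 h3
      exact ⟨h1, h2, h3⟩
    rw [envLaw, ← map_glue_prod (fun _ => cubeLaw d) S] at h1
    exact Measure.ae_ae_of_ae_prod (ae_of_ae_map (measurable_glue S).aemeasurable h1)
  have hsec : ∀ D : Set (Env d), MeasurableSet D →
      envLaw d D = ∫⁻ ξ, envLaw d {ζ | glue S ξ ζ ∈ D} ∂envLaw d := fun D hD => by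
    have h1 := lintegral_eq_glue (fun _ => cubeLaw d) S (F := D.indicator 1)
      (measurable_one.indicator hD)
    rw [lintegral_indicator_one hD] at h1
    refine h1.trans (lintegral_congr fun ξ => ?_)
    have h2 : MeasurableSet {ζ | glue S ξ ζ ∈ D} := measurable_glue_right S ξ hD
    rw [← lintegral_indicator_one h2]
    rfl
  have hmA : Measurable fun ξ => envLaw d {ζ | glue S ξ ζ ∈ A} :=
    measurable_measure_prodMk_left (measurable_glue S hA)
  rw [hsec _ (hA.inter hB), hsec _ hA, ← lintegral_const_mul _ hmA]
  refine lintegral_mono_ae ?_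
  filter_upwards [hae, ae_nice_envLaw (d := d)] with ξ hξ hξn
  by_cases hex : ∃ ζ, glue S ξ ζ ∈ A ∧ Nice (glue S ξ ζ) ∧
      TopBound (glue S ξ ζ) x ((m : ℝ) - 4) ∧
      EndsRun (glue S ξ ζ) δ m (jointFrom x (glue S ξ ζ)) t
  swap
  · refine le_trans (le_of_eq ?_) bot_le
    refine measure_mono_null (t := {ζ | ¬ (Nice (glue S ξ ζ) ∧
      TopBound (glue S ξ ζ) x ((m : ℝ) - 4) ∧
      (glue S ξ ζ ∈ A → EndsRun (glue S ξ ζ) δ m (jointFrom x (glue S ξ ζ)) t))})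
      (fun ζ hζ h => ?_) hξ
    exact hex ⟨ζ, hζ.1, h.1, h.2.1, h.2.2 hζ.1⟩
  obtain ⟨ζ₀, hζA, hζn, hζH, hζE⟩ := hex
  have hwζ := hw _ hζA
  have hwl : ∀ i, w i (last d) = l := fun i => by
    have := hζE.level_eq hmt (by omega) i 0
    rwa [hwζ, hwζ] at this
  have hgood : ∀ i, GoodAt (glue S ξ ζ₀) δ (w i) := fun i => hwζ i ▸ hζE.2.2 i
  have hpw : ∀ i, perturbed ξ (w i) ∈ upperBall (toPt (w i)) δ := fun i => by
    have h1 := hgood i (w i) ⟨le_rfl, fun b => by simp⟩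
    rwa [perturbed_congr (hgl ξ ζ₀ _ (hwS i))] at h1
  -- a lower bound for the conditional probability of `A`
  have hlow : q ≤ envLaw d {ζ | glue S ξ ζ ∈ A} := by
    have h1 : IsFresh (l - 1) (fun _ _ => l - 1 : Fin 2 → Site d) fun _ => cubeLaw d :=
      ⟨fun _ => ae_cubeLaw, fun _ _ _ => rfl⟩
    refine (h1.trapProb_le hδ hδ' (L := l) (by omega) (fun _ => by simp) 1 2 w).trans
      (measure_mono_ae ?_)
    filter_upwards [ae_nice_envLaw (d := d)] with ζ hζ hT
    refine (hinv _ _ (hζE.sameData hδ hδ' hm hmt hζn hζH hwζ hwl (hξn.glue hζ)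
      (fun z hz => by rw [hgl ξ ζ z hz, hgl ξ ζ₀ z hz]) fun i z h2 h3 h4 => ?_)).1 hζA
    rw [hwl] at h2 h3
    by_cases hz : z ∈ aboveSites l w
    · have h5 := (hT z ⟨i, h2, by simpa using h3, by simpa using h4⟩).bounds hδ h2
        (by simpa using h3)
      rw [perturbed_congr (hga ξ ζ z hz)]
      exact ⟨hδ, h5.2.2, h5.1.le⟩
    · obtain ⟨j, rfl⟩ : ∃ j, z = w j := by
        by_contra hcon
        push Not at hcon
        exact hz ⟨h2, hcon⟩
      rw [perturbed_congr (hgl ξ ζ _ hz)]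
      exact hpw j
  -- an upper bound for the conditional probability that no renewal step follows
  have hup : envLaw d {ζ | glue S ξ ζ ∈ A ∩ B} ≤ E := by
    have hst : IsStart l w (perturbed ξ (w 0), perturbed ξ (w 1)) := by
      have hs : ∀ j, startPt (perturbed ξ (w 0), perturbed ξ (w 1)) j = perturbed ξ (w j) :=
        fun j => by fin_cases j <;> rfl
      refine ⟨fun j i => ?_, fun j => ?_, fun j => ?_⟩
      · rw [hs]; exact (hξn.abs_perturbed_sub_lt _ _).le
      · rw [hs]
        have := (mem_upperBall_bounds (hpw j)).1
        rwa [hwl] at this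
      · rw [hs]
        have := (mem_upperBall_bounds (hpw j)).2.1
        rw [hwl] at this
        linarith
    have hfr : IsFresh l w (fixedLaw S ξ) := by
      refine ⟨fun y => ?_, fun y hy hyw => if_neg fun h => h ⟨hy, hyw⟩⟩
      unfold fixedLaw
      split_ifs
      · rw [ae_dirac_eq]
        exact hξn y
      · exact ae_cubeLaw
    refine le_trans ?_ (htail l w _ _ hst hfr)
    rw [← map_glue_envLaw]
    refine le_trans (measure_mono_ae ?_)
      (Measure.le_map_apply (measurable_glue_right S ξ).aemeasurable _)
    filter_upwards [hξ] with ζ hζ hAB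
    refine ⟨hζ.1, ?_⟩
    have h1 := hBn hAB.2
    have h2 : ∀ i, jointFrom x (glue S ξ ζ) i t = perturbed ξ (w i) := fun i => by
      rw [(hζ.2.2 hAB.1).eq_perturbed hζ.1 hδ' (by omega) hmt i, hw _ hAB.1,
        perturbed_congr (hgl ξ ζ _ (hwS i))]
    rw [NoRenewal, Set.mem_ofPred_eq, h2, h2] at h1
    exact h1
  calc envLaw d {ζ | glue S ξ ζ ∈ A ∩ B} ≤ E := hup
    _ = E / q * q := (ENNReal.div_mul_cancel hq0 ENNReal.ofReal_ne_top).symm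
    _ ≤ E / q * envLaw d {ζ | glue S ξ ζ ∈ A} := mul_le_mul_right hlow _

theorem measurable_jointFrom_toPt (u v : Site d) (i : Fin 2) (n : ℕ) :
    Measurable fun ξ : Env d => jointFrom (toPt u, toPt v) ξ i n :=
  measurable_jointPath u v i n

/-- After a renewal step, the waiting time for the next one has an exponential tail,
conditionally on the past. -/
theorem measure_inter_noRenewal_le {δ : ℝ} (hδ : 0 < δ) (hδ' : δ < 1 / 8) {m n t : ℕ}
    (hm : 4 ≤ m) (hmt : m < t) {E : ℝ≥0∞}
    (htail : ∀ (l : ℤ) (w : Fin 2 → Site d) (x : Pt d × Pt d) (κ : Site d → Measure (Pt d))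
      [∀ y, IsProbabilityMeasure (κ y)], IsStart l w x → IsFresh l w κ →
      Measure.infinitePi κ {ξ | Nice ξ ∧
        ¬ ∃ n', m < n' ∧ n' < n ∧ EndsRun ξ δ m (jointFrom x ξ) n'} ≤ E)
    {u v : Site d}
    (hH : ∀ᵐ ξ ∂envLaw d, TopBound ξ (toPt u, toPt v) ((m : ℝ) - 4))
    {A B : Set (Env d)} (hA : MeasurableSet A) (hB : MeasurableSet B)
    (hBn : B ⊆ NoRenewal δ m n t (toPt u, toPt v))
    (hinv : ∀ ξ ξ', SameData δ (toPt u, toPt v) t ξ ξ' → (ξ ∈ A ↔ ξ' ∈ A))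
    (hE : ∀ᵐ ξ ∂envLaw d, ξ ∈ A → EndsRun ξ δ m (jointPath u v ξ) t) :
    envLaw d (A ∩ B) ≤ E / ENNReal.ofReal (trapProb d δ 1 2) * envLaw d A := by
  let f : Env d → Fin 2 → Site d := fun ξ i =>
    upArrow (jointFrom (toPt u, toPt v) ξ i (t - 1))
  have hf : Measurable f := measurable_pi_lambda _ fun i =>
    measurable_upArrow.comp (measurable_jointFrom_toPt u v i (t - 1))
  have hAw : ∀ w, MeasurableSet (A ∩ f ⁻¹' {w}) := fun w =>
    hA.inter (hf (measurableSet_singleton w))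
  have hAU : A = ⋃ w, A ∩ f ⁻¹' {w} := by
    ext ξ; simp
  have hmain : ∀ w, envLaw d (A ∩ f ⁻¹' {w} ∩ B) ≤
      E / ENNReal.ofReal (trapProb d δ 1 2) * envLaw d (A ∩ f ⁻¹' {w}) := fun w => by
    refine measure_inter_noRenewal_le_of_site hδ hδ' hm hmt htail hH (hAw w) hB hBn
      (fun ξ ξ' h => ?_) (hE.mono fun ξ h h' => h h'.1) w fun ξ hξ i => congrFun hξ.2 i
    have h1 : f ξ' = f ξ := funext fun i => by
      simp only [f]
      rw [h.path (t - 1) (by omega)]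
    simp only [Set.mem_inter_iff, Set.mem_preimage, Set.mem_singleton_iff, h1, hinv ξ ξ' h]
  calc envLaw d (A ∩ B) = envLaw d (⋃ w, A ∩ f ⁻¹' {w} ∩ B) := by
        rw [← Set.iUnion_inter, ← hAU]
    _ ≤ ∑' w, envLaw d (A ∩ f ⁻¹' {w} ∩ B) := measure_iUnion_le _
    _ ≤ ∑' w, E / ENNReal.ofReal (trapProb d δ 1 2) * envLaw d (A ∩ f ⁻¹' {w}) :=
        ENNReal.tsum_le_tsum hmain
    _ = E / ENNReal.ofReal (trapProb d δ 1 2) * envLaw d A := by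
        rw [ENNReal.tsum_mul_left, ← measure_iUnion _ hAw, ← hAU]
        intro w w' hww
        refine Set.disjoint_left.2 fun ξ h h' => hww ?_
        exact (h.2 : f ξ = w).symm.trans h'.2

end Conditioning

/-! ### The generators of the filtration -/

theorem perturbed_latticeSite {d : ℕ} (ξ : Env d) (z : Site d) :
    perturbed ξ (latticeSite ξ (perturbed ξ z)) = perturbed ξ z :=
  firstSite_spec (p := fun w => perturbed ξ w = perturbed ξ z) ⟨z, rfl⟩

section Filtration

open scoped ENNReal

variable {d : ℕ} [NeZero d] {Ω : Type*} [mΩ : MeasurableSpace Ω] {P : Measure Ω}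
  {U : Ω → Env d} {k : ℕ} {δ : ℝ} {γ : Env d → Fin k → ℕ → Pt d}

theorem measurable_path_gAlgebra {j n : ℕ} (hj : j < n) (i : Fin k) :
    Measurable[gAlgebra P U δ γ n] fun ω => γ (U ω) i j := by
  refine Measurable.mono (comap_measurable fun ω => γ (U ω) i j) ?_ le_rfl
  refine le_sup_of_le_right (le_iSup_of_le j (le_iSup_of_le hj ?_))
  exact le_sup_of_le_left (le_sup_of_le_left
    (le_iSup (fun i => MeasurableSpace.comap (fun ω => γ (U ω) i j) inferInstance) i))

theorem measurable_site_gAlgebra {j n : ℕ} (hj : j < n) (i : Fin k) :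
    Measurable[gAlgebra P U δ γ n] fun ω => latticeSite (U ω) (γ (U ω) i (j + 1)) := by
  refine Measurable.mono (comap_measurable fun ω => latticeSite (U ω) (γ (U ω) i (j + 1))) ?_ le_rfl
  refine le_sup_of_le_right (le_iSup_of_le j (le_iSup_of_le hj ?_))
  exact le_sup_of_le_left (le_sup_of_le_right
    (le_iSup (fun i => MeasurableSpace.comap
      (fun ω => latticeSite (U ω) (γ (U ω) i (j + 1))) inferInstance) i))

theorem measurableSet_goodStep_gAlgebra {j n : ℕ} (hj : j < n) :
    MeasurableSet[gAlgebra P U δ γ n] {ω | GoodStep (U ω) δ (γ (U ω)) j} := by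
  have h : MeasurableSpace.generateFrom {{ω | GoodStep (U ω) δ (γ (U ω)) j}} ≤
      gAlgebra P U δ γ n :=
    le_sup_of_le_right (le_iSup_of_le j (le_iSup_of_le hj le_sup_right))
  exact h _ (MeasurableSpace.measurableSet_generateFrom rfl)

/-- The `σ`-algebra `𝒢_n` is complete with respect to measurable events. -/
theorem measurableSet_gAlgebra_of_ae_eq {n : ℕ} {s t : Set Ω} (hs : MeasurableSet s)
    (ht : MeasurableSet t) (ht' : MeasurableSet[gAlgebra P U δ γ n] t) (h : s =ᵐ[P] t) :
    MeasurableSet[gAlgebra P U δ γ n] s := by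
  have hnull : ∀ a : Set Ω, MeasurableSet a → P a = 0 → MeasurableSet[gAlgebra P U δ γ n] a :=
    fun a ha ha' => (le_sup_left : _ ≤ gAlgebra P U δ γ n) _
      (MeasurableSpace.measurableSet_generateFrom ⟨ha, ha'⟩)
  have h1 := hnull _ (hs.diff ht) (ae_le_set.1 h.le)
  have h2 := hnull _ (ht.diff hs) (ae_le_set.1 h.symm.le)
  have h3 : s = (t \ (t \ s)) ∪ (s \ t) := by
    ext ω; simp only [Set.mem_union, Set.mem_sdiff]; tauto
  rw [h3]
  exact MeasurableSet.union (MeasurableSet.diff ht' h2) h1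

theorem measurableSet_upStep {α : Type*} [MeasurableSpace α] {g : α → Fin k → ℕ → Pt d} {s : ℕ}
    (h : ∀ i, Measurable fun a => g a i s) (h' : ∀ i, Measurable fun a => g a i (s + 1)) :
    MeasurableSet {a | UpStep δ (g a) s} := by
  have hfl : ∀ i, Measurable fun a => ⌊g a i s (last d)⌋ := fun i =>
    Int.measurable_floor.comp ((measurable_pi_apply _).comp (h i))
  have hup : ∀ (i : Fin k) (b : Fin d), Measurable fun a => (upArrow (g a i s) b : ℝ) :=
    fun i b => (measurable_of_countable (fun z : ℤ => (z : ℝ))).comp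
      ((measurable_pi_apply b).comp (measurable_upArrow.comp (h i)))
  have hc : ∀ (i : Fin k) (b : Fin d), Measurable fun a => g a i (s + 1) b := fun i b =>
    (measurable_pi_apply b).comp (h' i)
  have hset : {a | UpStep δ (g a) s} =
      (⋂ i, ⋂ j, {a | ⌊g a i s (last d)⌋ = ⌊g a j s (last d)⌋}) ∩
        ⋂ i, {a | 0 < δ} ∩ ({a | ∑ b, |g a i (s + 1) b - upArrow (g a i s) b| ≤ δ} ∩
          {a | (upArrow (g a i s) (last d) : ℝ) ≤ g a i (s + 1) (last d)}) := by
    ext a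
    simp only [UpStep, upperBall, l1Dist, toPt, Set.mem_ofPred_eq, Set.mem_inter_iff,
      Set.mem_iInter]
  rw [hset]
  refine MeasurableSet.inter (MeasurableSet.iInter fun i => MeasurableSet.iInter fun j =>
    measurableSet_eq_fun (hfl i) (hfl j)) (MeasurableSet.iInter fun i =>
    (MeasurableSet.const _).inter (MeasurableSet.inter (measurableSet_le
      (Finset.measurable_sum _ fun b _ => ?_) measurable_const) ?_))
  · exact ((hc i b).sub (hup i b)).norm
  · exact measurableSet_le (hup i _) (hc i _)

end Filtration

section Joint

open scoped ENNReal

variable {d : ℕ} [NeZero d] {δ : ℝ} {m : ℕ} {u v : Site d}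

theorem measurableSet_endsRun (δ : ℝ) (m : ℕ) (u v : Site d) (n : ℕ) :
    MeasurableSet {ξ : Env d | EndsRun ξ δ m (jointPath u v ξ) n} := by
  have hset : {ξ : Env d | EndsRun ξ δ m (jointPath u v ξ) n} =
      (⋂ s, ⋂ (_ : n ≤ s + m), ⋂ (_ : s < n), {ξ | UpStep δ (jointPath u v ξ) s}) ∩
        ({ξ | UpStep δ (jointPath u v ξ) (n - 1)} ∩
          {ξ | GoodStep ξ δ (jointPath u v ξ) (n - 1)}) := by
    ext ξ
    simp only [EndsRun, SpecialUpStep, Set.mem_ofPred_eq, Set.mem_inter_iff, Set.mem_iInter]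
  have hup : ∀ s, MeasurableSet {ξ : Env d | UpStep δ (jointPath u v ξ) s} := fun s =>
    measurableSet_upStep (fun i => measurable_jointPath u v i s)
      fun i => measurable_jointPath u v i (s + 1)
  rw [hset]
  exact (MeasurableSet.iInter fun s => MeasurableSet.iInter fun _ => MeasurableSet.iInter fun _ =>
    hup s).inter ((hup _).inter (measurableSet_goodStep δ (measurable_jointPath u v) _))

theorem measurableSet_topBound (u v : Site d) (c : ℝ) :
    MeasurableSet {ξ : Env d | TopBound ξ (toPt u, toPt v) c} := by
  have hlow : ∀ i n, MeasurableSet {ξ : Env d | Lowest (jointFrom (toPt u, toPt v) ξ) i n} := by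
    intro i n
    simp only [Lowest, Set.ofPred_forall]
    exact MeasurableSet.iInter fun j => measurableSet_le
      (Int.measurable_floor.comp ((measurable_pi_apply _).comp (measurable_jointPath u v i n)))
      (Int.measurable_floor.comp ((measurable_pi_apply _).comp (measurable_jointPath u v j n)))
  simp only [TopBound, Set.ofPred_forall]
  refine MeasurableSet.iInter fun n => MeasurableSet.iInter fun s => MeasurableSet.iInter fun _ =>
    MeasurableSet.iInter fun i => MeasurableSet.iInter fun i₀ => ?_
  have hle := measurableSet_le
    (((measurable_pi_apply (last d)).comp (measurable_jointPath u v i s)).add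
      (measurable_l1Dist (measurable_next (measurable_jointPath u v i s))
        (measurable_jointPath u v i s)))
    (((measurable_pi_apply (last d)).comp (measurable_jointPath u v i₀ (n + 1))).add_const c)
  exact (hlow i s).imp ((hlow i₀ n).imp hle)

/-- That step `n` completes a run, expressed by the data that generate `𝒢_n`: the lattice site of
the last position replaces the position itself. -/
def EndsRunData (ξ : Env d) (δ : ℝ) (m : ℕ) (g : Fin 2 → ℕ → Pt d) (n : ℕ) : Prop :=
  (∀ s, n ≤ s + m → s + 1 < n → UpStep δ g s) ∧
    (∀ i j, ⌊g i (n - 1) (last d)⌋ = ⌊g j (n - 1) (last d)⌋) ∧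
    (∀ i, latticeSite ξ (g i (n - 1 + 1)) = upArrow (g i (n - 1))) ∧ GoodStep ξ δ g (n - 1)

/-- If `A(W)` occurs, then the point of `V` near `W` is that of `W`: this decides from lattice
sites whether a step is an up step. -/
theorem endsRun_iff_endsRunData (hδ' : δ < 1 / 8) {ξ : Env d} (hξ : Nice ξ) (hm : 0 < m) {n : ℕ}
    (hmn : m < n) {x : Pt d × Pt d} :
    EndsRun ξ δ m (jointFrom x ξ) n ↔ EndsRunData ξ δ m (jointFrom x ξ) n := by
  have hn : n - 1 + 1 = n := by omega
  constructor
  · intro h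
    refine ⟨fun s h1 h2 => h.1 s h1 (by omega), h.2.1.1, fun i => ?_, h.2.2⟩
    have h1 := h.eq_perturbed hξ hδ' hm hmn i
    have h2 := h.2.1.2 i
    rw [hn] at h2 ⊢
    rw [h1] at h2 ⊢
    refine eq_of_perturbed_mem_upperBall hδ' hξ (h.2.2 i) ?_
    rwa [perturbed_latticeSite]
  · rintro ⟨h1, h2, h3, h4⟩
    have hup : UpStep δ (jointFrom x ξ) (n - 1) := by
      refine ⟨h2, fun i => ?_⟩
      have hlow : Lowest (jointFrom x ξ) i (n - 1) := fun j => (h2 i j).le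
      have hex : ∃ z, jointFrom x ξ i (n - 1 + 1) = perturbed ξ z := by
        rcases jointFrom_succ_of_lowest hlow with h | ⟨j, -, -, h⟩
        · exact ⟨_, h.trans (next_eq_perturbed _ _)⟩
        · exact ⟨_, h.trans (next_eq_perturbed _ _)⟩
      obtain ⟨z, hz⟩ := hex
      have h5 := perturbed_latticeSite ξ z
      rw [← hz, h3] at h5
      rw [← h5]
      exact h4 i _ ⟨le_rfl, fun b => by simp⟩
    refine ⟨fun s hs hs' => ?_, hup, h4⟩
    rcases (show s + 1 < n ∨ s = n - 1 by omega) with h | rfl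
    · exact h1 s hs h
    · exact hup

theorem EndsRun.congr {ξ : Env d} {g g' : Fin 2 → ℕ → Pt d} {t n : ℕ} (hmn : m < n)
    (h : ∀ i s, g i (t + s) = g' i s) : EndsRun ξ δ m g (t + n) ↔ EndsRun ξ δ m g' n := by
  have hup : ∀ s, UpStep δ g (t + s) ↔ UpStep δ g' s := fun s => by
    simp only [UpStep, add_assoc, h]
  have hg : GoodStep ξ δ g (t + n - 1) ↔ GoodStep ξ δ g' (n - 1) := by
    rw [show t + n - 1 = t + (n - 1) by omega]
    simp only [GoodStep, h]
  have hu : UpStep δ g (t + n - 1) ↔ UpStep δ g' (n - 1) := by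
    rw [show t + n - 1 = t + (n - 1) by omega, hup]
  unfold EndsRun SpecialUpStep
  rw [hg, hu]
  refine and_congr_left fun _ => ⟨fun H s h1 h2 => ?_, fun H s h1 h2 => ?_⟩
  · exact (hup s).1 (H (t + s) (by omega) (by omega))
  · obtain ⟨s, rfl⟩ : ∃ s', s = t + s' := ⟨s - t, by omega⟩
    exact (hup s).2 (H s (by omega) (by omega))

theorem noRenewal_eq (δ : ℝ) (m n t : ℕ) (u v : Site d) :
    NoRenewal δ m n t (toPt u, toPt v) =
      {ξ | ∀ n', m < n' → n' < n → ¬ EndsRun ξ δ m (jointPath u v ξ) (t + n')} := by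
  ext ξ
  simp only [NoRenewal, Set.mem_ofPred_eq, not_exists, not_and]
  refine forall_congr' fun n' => forall_congr' fun hn' => ?_
  rw [jointPath_eq_jointFrom,
    EndsRun.congr (δ := δ) (ξ := ξ) hn' fun i s => (jointFrom_add (toPt u, toPt v) ξ i t s)]

theorem measurableSet_noRenewal (δ : ℝ) (m n t : ℕ) (u v : Site d) :
    MeasurableSet (NoRenewal δ m n t (toPt u, toPt v)) := by
  rw [noRenewal_eq]
  simp only [Set.ofPred_forall]
  exact MeasurableSet.iInter fun n' => MeasurableSet.iInter fun _ => MeasurableSet.iInter fun _ =>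
    (measurableSet_endsRun δ m u v (t + n')).compl

/-! ### Renewal steps -/

theorem renewal_succ_le_iff (ξ : Env d) (δ : ℝ) (m : ℕ) (g : Fin 2 → ℕ → Pt d) (j n : ℕ) :
    renewal ξ δ m g (j + 1) ≤ n ↔
      ∃ k ≤ n, renewal ξ δ m g j + (m : ℕ∞) < (k : ℕ∞) ∧ EndsRun ξ δ m g k := by
  let S : Set ℕ∞ := {t | ∃ n : ℕ, t = (n : ℕ∞) ∧ renewal ξ δ m g j + (m : ℕ∞) < (n : ℕ∞) ∧
    (∀ s, n ≤ s + m → s < n → UpStep δ g s) ∧ SpecialUpStep ξ δ g (n - 1)}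
  change sInf S ≤ n ↔ _
  constructor
  · intro h
    have hne : S.Nonempty := by
      by_contra hcon
      rw [Set.not_nonempty_iff_eq_empty] at hcon
      rw [hcon, sInf_empty] at h
      exact absurd h (not_le.2 (ENat.natCast_lt_top n))
    obtain ⟨k, hk, hk1, hk2⟩ : ∃ k : ℕ, sInf S = (k : ℕ∞) ∧
        renewal ξ δ m g j + (m : ℕ∞) < (k : ℕ∞) ∧ EndsRun ξ δ m g k := csInf_mem hne
    rw [hk] at h
    exact ⟨k, by exact_mod_cast h, hk1, hk2⟩
  · rintro ⟨k, hk, hk1, hk2⟩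
    have h1 : (k : ℕ∞) ∈ S := ⟨k, rfl, hk1, hk2⟩
    refine (sInf_le h1).trans ?_
    exact_mod_cast hk

theorem endsRun_of_renewal_eq {ξ : Env d} {g : Fin 2 → ℕ → Pt d} {j t : ℕ}
    (h : renewal ξ δ m g (j + 1) = t) : m < t ∧ EndsRun ξ δ m g t := by
  obtain ⟨k, hk, hk1, hk2⟩ := (renewal_succ_le_iff ξ δ m g j t).1 h.le
  have h1 := (renewal_succ_le_iff ξ δ m g j k).2 ⟨k, le_rfl, hk1, hk2⟩
  rw [h] at h1
  have h2 : k = t := le_antisymm hk (by exact_mod_cast h1)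
  subst h2
  refine ⟨?_, hk2⟩
  have h3 : (m : ℕ∞) < k := lt_of_le_of_lt le_add_self hk1
  exact_mod_cast h3

end Joint

/-! ### Conditional probabilities at stopping times -/

section CondExp

open scoped ENNReal

variable {Ω : Type*} [mΩ : MeasurableSpace Ω] {P : Measure Ω} [IsProbabilityMeasure P]

theorem condProb_le_of_measure_inter_le {m₀ : MeasurableSpace Ω} (hm : m₀ ≤ mΩ) {B : Set Ω}
    (hB : MeasurableSet[mΩ] B) {c : ℝ} (hc : 0 ≤ c)
    (h : ∀ s, MeasurableSet[m₀] s → P (s ∩ B) ≤ ENNReal.ofReal c * P s) :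
    P⟦B | m₀⟧ ≤ᵐ[P] fun _ => c := by
  have hint : Integrable (B.indicator fun _ => (1 : ℝ)) P :=
    (integrable_const 1).indicator hB
  refine ae_le_of_ae_le_trim (hm := hm) ?_
  refine ae_le_of_forall_setIntegral_le
    (integrable_condExp.trim hm stronglyMeasurable_condExp) (integrable_const c) fun s hs _ => ?_
  rw [← setIntegral_trim hm stronglyMeasurable_condExp hs, setIntegral_condExp hm hint hs,
    setIntegral_indicator hB, setIntegral_const, setIntegral_const, smul_eq_mul, smul_eq_mul,
    mul_one, measureReal_def, measureReal_def, trim_measurableSet_eq hm hs, mul_comm]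
  have h1 := ENNReal.toReal_mono (ENNReal.mul_ne_top ENNReal.ofReal_ne_top (measure_ne_top P s))
    (h s hs)
  rwa [ENNReal.toReal_mul, ENNReal.toReal_ofReal hc] at h1

/-- A bound for the conditional probability at a stopping time follows from bounds on the events
where the stopping time has a given finite value. -/
theorem condProb_stoppingTime_le {F : Filtration ℕ mΩ} {τ : Ω → ℕ∞}
    (hτ : IsStoppingTime F τ) (htop : P {ω | τ ω = ⊤} = 0) {B : Set Ω}
    (hB : MeasurableSet B) {c : ℝ} (hc : 0 ≤ c)
    (h : ∀ t : ℕ, ∀ s, MeasurableSet[F t] s → s ⊆ {ω | τ ω = t} →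
      P (s ∩ B) ≤ ENNReal.ofReal c * P s) :
    P⟦B | hτ.measurableSpace⟧ ≤ᵐ[P] fun _ => c := by
  refine condProb_le_of_measure_inter_le hτ.measurableSpace_le hB hc fun s hs => ?_
  have heq : ∀ t : ℕ, MeasurableSet[F t] {ω | τ ω = (t : ℕ∞)} := fun t => hτ.measurableSet_eq t
  have hst : ∀ t : ℕ, MeasurableSet[F t] (s ∩ {ω | τ ω = (t : ℕ∞)}) := fun t => by
    have h1 : MeasurableSet[F t] (s ∩ {ω | τ ω ≤ (t : ℕ∞)}) := hs.2 t
    have h2 : s ∩ {ω | τ ω = (t : ℕ∞)} = s ∩ {ω | τ ω ≤ (t : ℕ∞)} ∩ {ω | τ ω = (t : ℕ∞)} := by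
      ext ω
      simp only [Set.mem_inter_iff, Set.mem_ofPred_eq]
      exact ⟨fun h => ⟨⟨h.1, h.2.le⟩, h.2⟩, fun h => ⟨h.1.1, h.2⟩⟩
    rw [h2]
    exact MeasurableSet.inter h1 (heq t)
  have hdisj : Pairwise (Function.onFun Disjoint fun t : ℕ => s ∩ {ω | τ ω = (t : ℕ∞)}) := by
    intro t t' htt
    refine Set.disjoint_left.2 fun ω h h' => htt ?_
    have h1 : (t : ℕ∞) = t' := h.2.symm.trans h'.2
    exact_mod_cast h1
  have hcov : s ∩ B ⊆ {ω | τ ω = ⊤} ∪ ⋃ t : ℕ, s ∩ {ω | τ ω = (t : ℕ∞)} ∩ B := by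
    rintro ω ⟨h1, h2⟩
    rcases eq_or_ne (τ ω) ⊤ with h3 | h3
    · exact Or.inl h3
    · lift τ ω to ℕ using h3 with t ht
      exact Or.inr (Set.mem_iUnion.2 ⟨t, ⟨h1, ht.symm⟩, h2⟩)
  calc P (s ∩ B) ≤ P {ω | τ ω = ⊤} + P (⋃ t : ℕ, s ∩ {ω | τ ω = (t : ℕ∞)} ∩ B) :=
        (measure_mono hcov).trans (measure_union_le _ _)
    _ ≤ ∑' t : ℕ, P (s ∩ {ω | τ ω = (t : ℕ∞)} ∩ B) := by
        rw [htop, zero_add]; exact measure_iUnion_le _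
    _ ≤ ∑' t : ℕ, ENNReal.ofReal c * P (s ∩ {ω | τ ω = (t : ℕ∞)}) :=
        ENNReal.tsum_le_tsum fun t => h t _ (hst t) Set.inter_subset_right
    _ = ENNReal.ofReal c * P (⋃ t : ℕ, s ∩ {ω | τ ω = (t : ℕ∞)}) := by
        rw [ENNReal.tsum_mul_left, measure_iUnion hdisj fun t => F.le t _ (hst t)]
    _ ≤ ENNReal.ofReal c * P s :=
        mul_le_mul_right (measure_mono (Set.iUnion_subset fun t => Set.inter_subset_left)) _

end CondExp

/-! ### The model -/

theorem measurableSet_endsRunData {d : ℕ} [NeZero d] {α : Type*} [MeasurableSpace α]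
    {V : α → Env d} {g : α → Fin 2 → ℕ → Pt d} {δ : ℝ} {m n : ℕ} (hn : 0 < n)
    (hp : ∀ s < n, ∀ i, Measurable fun a => g a i s)
    (hl : ∀ i, Measurable fun a => latticeSite (V a) (g a i (n - 1 + 1)))
    (hG : MeasurableSet {a | GoodStep (V a) δ (g a) (n - 1)}) :
    MeasurableSet {a | EndsRunData (V a) δ m (g a) n} := by
  have hset : {a | EndsRunData (V a) δ m (g a) n} =
      (⋂ s, ⋂ (_ : n ≤ s + m), ⋂ (_ : s + 1 < n), {a | UpStep δ (g a) s}) ∩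
      ((⋂ i, ⋂ j, {a | ⌊g a i (n - 1) (last d)⌋ = ⌊g a j (n - 1) (last d)⌋}) ∩
        ((⋂ i, {a | latticeSite (V a) (g a i (n - 1 + 1)) = upArrow (g a i (n - 1))}) ∩
          {a | GoodStep (V a) δ (g a) (n - 1)})) := by
    ext a
    simp only [EndsRunData, Set.mem_ofPred_eq, Set.mem_inter_iff, Set.mem_iInter]
  have hfl : ∀ i, Measurable fun a => ⌊g a i (n - 1) (last d)⌋ := fun i =>
    Int.measurable_floor.comp ((measurable_pi_apply _).comp (hp _ (by omega) i))
  rw [hset]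
  exact MeasurableSet.inter (MeasurableSet.iInter fun s => MeasurableSet.iInter fun _ =>
    MeasurableSet.iInter fun hs => measurableSet_upStep (hp _ (by omega)) (hp _ hs))
    (MeasurableSet.inter (MeasurableSet.iInter fun i => MeasurableSet.iInter fun j =>
      measurableSet_eq_fun (hfl i) (hfl j)) (MeasurableSet.inter (MeasurableSet.iInter fun i =>
      measurableSet_eq_fun (hl i) (measurable_upArrow.comp (hp _ (by omega) i))) hG))

section Model

open scoped ENNReal

variable {d : ℕ} {Ω : Type*} [mΩ : MeasurableSpace Ω] {P : Measure Ω}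
  {U : Ω → Env d}

theorem IsModel.map_eq (hU : Measurable U) (hM : IsModel P U) : P.map U = envLaw d := by
  have h := hM.indep.map_fun_eq_infinitePi_map
    (fun w => (measurable_pi_apply w).comp hU)
  have h2 : ∀ w, P.map (fun ω => U ω w) = cubeLaw d := fun w => hM.uniform w
  exact h.trans (congrArg Measure.infinitePi (funext h2))

theorem IsModel.measure_preimage (hU : Measurable U) (hM : IsModel P U) {A : Set (Env d)}
    (hA : MeasurableSet A) : P (U ⁻¹' A) = envLaw d A := by
  rw [← hM.map_eq hU, Measure.map_apply hU hA]

theorem IsModel.ae_nice (hU : Measurable U) (hM : IsModel P U) : ∀ᵐ ω ∂P, Nice (U ω) := by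
  have h := ae_nice_envLaw (d := d)
  rw [← hM.map_eq hU] at h
  exact ae_of_ae_map hU.aemeasurable h

variable [NeZero d]

theorem IsModel.heightBound (hU : Measurable U) (hM : IsModel P U) :
    HeightBound P U (3 * d + 5) := fun u v _ n => by
  filter_upwards [hM.ae_nice hU] with ω hω
  refine (height_history_le hω (toPt u, toPt v) n).trans ?_
  push_cast
  linarith

/-- An admissible `m` is at least `4`, as the empty region has height `0`. -/
theorem HeightBound.four_le [IsProbabilityMeasure P] {m : ℕ} (h : HeightBound P U m) : 4 ≤ m := by
  obtain ⟨ω, hω⟩ := (h 0 0 rfl 0).exists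
  have h0 : height (∅ : Set (Pt d)) = 0 := by simp [height]
  simp only [history, h0] at hω
  have : (4 : ℝ) ≤ m := by linarith
  exact_mod_cast this

/-- Up to null events, the events in `𝒢_t` are determined by the data that generate `𝒢_t`. -/
theorem exists_sameData_invariant {δ : ℝ} {u v : Site d} {t : ℕ} {s : Set Ω}
    (hs : MeasurableSet[gAlgebra P U δ (jointPath u v) t] s) :
    ∃ A : Set (Env d), MeasurableSet A ∧
      (∀ ξ ξ', SameData δ (toPt u, toPt v) t ξ ξ' → (ξ ∈ A ↔ ξ' ∈ A)) ∧ s =ᵐ[P] U ⁻¹' A := by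
  let M : MeasurableSpace Ω :=
    { MeasurableSet' := fun s => ∃ A : Set (Env d), MeasurableSet A ∧
        (∀ ξ ξ', SameData δ (toPt u, toPt v) t ξ ξ' → (ξ ∈ A ↔ ξ' ∈ A)) ∧ s =ᵐ[P] U ⁻¹' A
      measurableSet_empty := ⟨∅, MeasurableSet.empty, fun _ _ _ => Iff.rfl, by rfl⟩
      measurableSet_compl := by
        rintro s ⟨A, h1, h2, h3⟩
        exact ⟨Aᶜ, h1.compl, fun ξ ξ' h => not_congr (h2 ξ ξ' h), h3.compl⟩
      measurableSet_iUnion := by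
        intro f hf
        choose A h1 h2 h3 using hf
        refine ⟨⋃ i, A i, MeasurableSet.iUnion h1, fun ξ ξ' h => ?_, ?_⟩
        · simp only [Set.mem_iUnion]
          exact exists_congr fun i => h2 i ξ ξ' h
        · rw [Set.preimage_iUnion]
          exact Filter.EventuallyEq.countable_iUnion h3 }
  suffices h : @gAlgebra d _ Ω mΩ 2 P U δ (jointPath u v) t ≤ M from h s hs
  refine sup_le (MeasurableSpace.generateFrom_le fun a ha => ?_) (iSup_le fun j => iSup_le fun hj =>
    sup_le (sup_le (iSup_le fun i => ?_) (iSup_le fun i => ?_))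
      (MeasurableSpace.generateFrom_le fun a ha => ?_))
  · exact ⟨∅, MeasurableSet.empty, fun _ _ _ => Iff.rfl, by
      simpa using ae_eq_empty.2 ha.2⟩
  · rintro a ⟨D, hD, rfl⟩
    refine ⟨{ξ | jointPath u v ξ i j ∈ D}, measurable_jointPath u v i j hD, fun ξ ξ' h => ?_, by rfl⟩
    have h1 := h.path j hj i
    rw [Set.mem_ofPred_eq, Set.mem_ofPred_eq, jointPath_eq_jointFrom, h1]
  · rintro a ⟨D, hD, rfl⟩
    refine ⟨{ξ | latticeSite ξ (jointPath u v ξ i (j + 1)) ∈ D},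
      measurable_latticeSite (measurable_jointPath u v i (j + 1)) hD, fun ξ ξ' h => ?_, by rfl⟩
    have h1 := h.site j hj i
    rw [Set.mem_ofPred_eq, Set.mem_ofPred_eq, jointPath_eq_jointFrom, h1]
  · rw [Set.mem_singleton_iff.1 ha]
    exact ⟨{ξ | GoodStep ξ δ (jointPath u v ξ) j},
      measurableSet_goodStep δ (measurable_jointPath u v) j, fun ξ ξ' h => (h.good j hj).symm, by rfl⟩

/-- Whether step `n` completes a run is known at time `n`. -/
theorem measurableSet_endsRun_gAlgebra (hU : Measurable U) (hM : IsModel P U) {δ : ℝ}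
    (hδ' : δ < 1 / 8) {m n : ℕ} (hm : 0 < m) (hmn : m < n) (u v : Site d) :
    MeasurableSet[gAlgebra P U δ (jointPath u v) n]
      {ω | EndsRun (U ω) δ m (jointPath u v (U ω)) n} := by
  have hdata : MeasurableSet[gAlgebra P U δ (jointPath u v) n]
      {ω | EndsRunData (U ω) δ m (jointPath u v (U ω)) n} :=
    @measurableSet_endsRunData d _ Ω (gAlgebra P U δ (jointPath u v) n) U _ δ m n (by omega)
      (fun s hs i => measurable_path_gAlgebra hs i)
      (fun i => measurable_site_gAlgebra (by omega) i) (measurableSet_goodStep_gAlgebra (by omega))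
  refine measurableSet_gAlgebra_of_ae_eq (hU (measurableSet_endsRun δ m u v n))
    ((gFiltration P U hU δ (jointPath u v) (measurable_jointPath u v)).le n _ hdata) hdata ?_
  filter_upwards [hM.ae_nice hU] with ω hω
  exact propext (endsRun_iff_endsRunData hδ' hω hm hmn)

/-- The renewal steps are stopping times. -/
theorem isStoppingTime_renewal (hU : Measurable U) (hM : IsModel P U) {δ : ℝ}
    (hδ' : δ < 1 / 8) {m : ℕ} (hm : 0 < m) (u v : Site d) (j : ℕ) :
    IsStoppingTime (gFiltration P U hU δ (jointPath u v) (measurable_jointPath u v))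
      fun ω => renewal (U ω) δ m (jointPath u v (U ω)) j := by
  set F := gFiltration P U hU δ (jointPath u v) (measurable_jointPath u v) with hF
  induction j with
  | zero =>
    intro n
    have h : {ω | renewal (U ω) δ m (jointPath u v (U ω)) 0 ≤ (n : ℕ∞)} = Set.univ := by
      ext ω; simp [renewal]
    change MeasurableSet[F n] {ω | renewal (U ω) δ m (jointPath u v (U ω)) 0 ≤ (n : ℕ∞)}
    rw [h]
    exact MeasurableSet.univ
  | succ j ih =>
    intro n
    change MeasurableSet[F n] {ω | renewal (U ω) δ m (jointPath u v (U ω)) (j + 1) ≤ (n : ℕ∞)}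
    have h : {ω | renewal (U ω) δ m (jointPath u v (U ω)) (j + 1) ≤ (n : ℕ∞)} =
        ⋃ k, ⋃ (_ : k ≤ n), ⋃ (_ : m < k),
          {ω | renewal (U ω) δ m (jointPath u v (U ω)) j ≤ ((k - m - 1 : ℕ) : ℕ∞)} ∩
            {ω | EndsRun (U ω) δ m (jointPath u v (U ω)) k} := by
      ext ω
      simp only [Set.mem_ofPred_eq, Set.mem_iUnion, Set.mem_inter_iff, renewal_succ_le_iff,
        exists_prop]
      refine exists_congr fun k => and_congr_right fun _ => ?_
      rw [← and_assoc]
      refine and_congr_left fun _ => ?_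
      generalize renewal (U ω) δ m (jointPath u v (U ω)) j = τ
      induction τ using ENat.recTopCoe with
      | top => simp
      | coe τ => norm_cast; omega
    rw [h]
    refine MeasurableSet.iUnion fun k => MeasurableSet.iUnion fun hk => MeasurableSet.iUnion
      fun hmk => MeasurableSet.inter ?_ ?_
    · exact F.mono (show k - m - 1 ≤ n by omega) _ (ih (k - m - 1))
    · exact F.mono hk _ (measurableSet_endsRun_gAlgebra hU hM hδ' hm hmk u v)

theorem measurable_renewal (hU : Measurable U) (hM : IsModel P U) {δ : ℝ}
    (hδ' : δ < 1 / 8) {m : ℕ} (hm : 0 < m) (u v : Site d) (j : ℕ) :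
    Measurable fun ω => renewal (U ω) δ m (jointPath u v (U ω)) j := by
  have hτ := isStoppingTime_renewal hU hM hδ' hm u v j
  have hn : ∀ n : ℕ, MeasurableSet {ω | renewal (U ω) δ m (jointPath u v (U ω)) j = (n : ℕ∞)} :=
    fun n => (gFiltration P U hU δ (jointPath u v) (measurable_jointPath u v)).le n _
      (hτ.measurableSet_eq n)
  refine measurable_to_countable' fun x => ?_
  induction x using ENat.recTopCoe with
  | top =>
    have h : (fun ω => renewal (U ω) δ m (jointPath u v (U ω)) j) ⁻¹' {⊤} =
        (⋃ n : ℕ, {ω | renewal (U ω) δ m (jointPath u v (U ω)) j = (n : ℕ∞)})ᶜ := by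
      ext ω
      simp only [Set.mem_preimage, Set.mem_singleton_iff, Set.mem_compl_iff, Set.mem_iUnion,
        Set.mem_ofPred_eq]
      generalize renewal (U ω) δ m (jointPath u v (U ω)) j = τ
      induction τ using ENat.recTopCoe with
      | top => simp
      | coe τ => simp
    rw [h]
    exact (MeasurableSet.iUnion hn).compl
  | coe n => exact hn n

end Model

/-! ### The conditional tail bound -/

section Tail

open scoped ENNReal

variable {d : ℕ} [NeZero d] {Ω : Type*} [mΩ : MeasurableSpace Ω] {P : Measure Ω}
  {U : Ω → Env d}

/-- If the next renewal step comes late, then no renewal step occurs in the meantime. -/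
theorem noRenewal_of_renewal_add_le {ξ : Env d} {δ : ℝ} {m n t j : ℕ} {u v : Site d}
    (ht : renewal ξ δ m (jointPath u v ξ) j = t)
    (h : renewal ξ δ m (jointPath u v ξ) j + (n : ℕ∞) ≤
      renewal ξ δ m (jointPath u v ξ) (j + 1)) : ξ ∈ NoRenewal δ m n t (toPt u, toPt v) := by
  rw [noRenewal_eq, Set.mem_ofPred_eq]
  intro n' h1 h2 h3
  have h4 := (renewal_succ_le_iff ξ δ m (jointPath u v ξ) j (t + n')).2
    ⟨t + n', le_rfl, by rw [ht]; norm_cast; omega, h3⟩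
  rw [ht] at h
  have h5 := h.trans h4
  norm_cast at h5
  omega

/-- The tail estimate on the events of `𝒢_t` on which `τ_j = t`. For `j ≥ 1` there is a renewal
step at time `t`; for `j = 0` the past is trivial. -/
theorem measure_inter_renewal_le [IsProbabilityMeasure P] (hU : Measurable U) (hM : IsModel P U)
    {δ : ℝ} (hδ : 0 < δ)
    (hδ' : δ < 1 / 8) {m n : ℕ} (hH : HeightBound P U m) {E E' : ℝ≥0∞} (hE : E ≤ E')
    (hE' : E / ENNReal.ofReal (trapProb d δ 1 2) ≤ E')
    (htail : ∀ (l : ℤ) (w : Fin 2 → Site d) (x : Pt d × Pt d) (κ : Site d → Measure (Pt d))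
      [∀ y, IsProbabilityMeasure (κ y)], IsStart l w x → IsFresh l w κ →
      Measure.infinitePi κ {ξ | Nice ξ ∧
        ¬ ∃ n', m < n' ∧ n' < n ∧ EndsRun ξ δ m (jointFrom x ξ) n'} ≤ E)
    {u v : Site d} (huv : u (last d) = v (last d)) {j t : ℕ} {s : Set Ω}
    (hs : MeasurableSet[gAlgebra P U δ (jointPath u v) t] s)
    (hst : s ⊆ {ω | renewal (U ω) δ m (jointPath u v (U ω)) j = t}) :
    P (s ∩ {ω | renewal (U ω) δ m (jointPath u v (U ω)) j + (n : ℕ∞) ≤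
      renewal (U ω) δ m (jointPath u v (U ω)) (j + 1)}) ≤ E' * P s := by
  obtain ⟨A, hA, hinv, hsA⟩ := exists_sameData_invariant hs
  set B := NoRenewal δ m n t (toPt u, toPt v) with hB
  have hBm : MeasurableSet B := measurableSet_noRenewal δ m n t u v
  have hPs : P s = envLaw d A := by rw [measure_congr hsA, hM.measure_preimage hU hA]
  have hle : P (s ∩ {ω | renewal (U ω) δ m (jointPath u v (U ω)) j + (n : ℕ∞) ≤
      renewal (U ω) δ m (jointPath u v (U ω)) (j + 1)}) ≤ envLaw d (A ∩ B) := by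
    rw [← hM.measure_preimage hU (hA.inter hBm), Set.preimage_inter,
      ← measure_congr (hsA.inter (ae_eq_refl (U ⁻¹' B)))]
    exact measure_mono fun ω hω => ⟨hω.1, noRenewal_of_renewal_add_le (hst hω.1) hω.2⟩
  refine hle.trans ?_
  rw [hPs]
  cases j with
  | zero =>
    by_cases ht : t = 0
    · -- at time `0` the past is trivial
      subst ht
      have hall : ∀ ξ ξ' : Env d, SameData δ (toPt u, toPt v) 0 ξ ξ' := fun ξ ξ' =>
        ⟨fun s hs => by omega, fun s hs => by omega, fun s hs => by omega⟩
      rcases A.eq_empty_or_nonempty with hA0 | ⟨ξ₀, hξ₀⟩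
      · simp [hA0]
      · have hA1 : A = Set.univ := Set.eq_univ_of_forall fun ξ => (hinv _ _ (hall ξ₀ ξ)).1 hξ₀
        rw [hA1, Set.univ_inter, measure_univ, mul_one]
        refine le_trans (measure_mono fun ξ hξ => ?_) ((measure_start_le htail huv).trans hE)
        rw [hB, noRenewal_eq, Set.mem_ofPred_eq] at hξ
        rw [Set.mem_ofPred_eq]
        rintro ⟨n', h1, h2, h3⟩
        refine hξ n' h1 h2 ?_
        rwa [zero_add]
    · have hs0 : s = ∅ := Set.eq_empty_of_forall_notMem fun ω hω => ht <| by
        have h1 : (0 : ℕ∞) = t := hst hω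
        exact_mod_cast h1.symm
      have hA0 : envLaw d A = 0 := by rw [← hPs, hs0, measure_empty]
      rw [measure_mono_null Set.inter_subset_left hA0]
      exact bot_le
  | succ j =>
    by_cases hmt : m < t
    · refine le_trans ?_ (mul_le_mul_left hE' _)
      refine measure_inter_noRenewal_le hδ hδ' hH.four_le hmt htail ?_ hA hBm subset_rfl hinv ?_
      · have h1 : ∀ᵐ ω ∂P, U ω ∈ {ξ : Env d | TopBound ξ (toPt u, toPt v) ((m : ℝ) - 4)} := by
          filter_upwards [hM.ae_nice hU, ae_all_iff.2 (hH u v huv)] with ω hω h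
          have hm : (4 : ℝ) ≤ m := by exact_mod_cast hH.four_le
          exact topBound_of_height_le hω (by linarith) h
        rw [← hM.map_eq hU]
        exact (ae_map_iff hU.aemeasurable (measurableSet_topBound u v _)).2 h1
      · have h1 : ∀ᵐ ω ∂P, U ω ∈ {ξ | ξ ∈ A → EndsRun ξ δ m (jointPath u v ξ) t} := by
          filter_upwards [hsA.mem_iff] with ω hω h
          exact (endsRun_of_renewal_eq (hst (hω.2 h))).2
        rw [← hM.map_eq hU]
        exact (ae_map_iff hU.aemeasurable (hA.imp (measurableSet_endsRun δ m u v t))).2 h1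
    · have hs0 : s = ∅ := Set.eq_empty_of_forall_notMem fun ω hω =>
        hmt (endsRun_of_renewal_eq (hst hω)).1
      have hA0 : envLaw d A = 0 := by rw [← hPs, hs0, measure_empty]
      rw [measure_mono_null Set.inter_subset_left hA0]
      exact bot_le

/-- Almost surely there are infinitely many renewal steps. -/
theorem measure_renewal_eq_top [IsProbabilityMeasure P] (hU : Measurable U) (hM : IsModel P U)
    {δ : ℝ} (hδ' : δ < 1 / 8) {m : ℕ} (hm : 0 < m) {u v : Site d} {E : ℕ → ℝ≥0∞}
    (hE : Filter.Tendsto E Filter.atTop (nhds 0))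
    (h : ∀ (n j t : ℕ) (s : Set Ω), MeasurableSet[gAlgebra P U δ (jointPath u v) t] s →
      s ⊆ {ω | renewal (U ω) δ m (jointPath u v (U ω)) j = t} →
      P (s ∩ {ω | renewal (U ω) δ m (jointPath u v (U ω)) j + (n : ℕ∞) ≤
        renewal (U ω) δ m (jointPath u v (U ω)) (j + 1)}) ≤ E n * P s) (j : ℕ) :
    P {ω | renewal (U ω) δ m (jointPath u v (U ω)) j = ⊤} = 0 := by
  induction j with
  | zero => simp [renewal]
  | succ j ih =>
    have hcov : {ω | renewal (U ω) δ m (jointPath u v (U ω)) (j + 1) = ⊤} ⊆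
        {ω | renewal (U ω) δ m (jointPath u v (U ω)) j = ⊤} ∪
          ⋃ t : ℕ, {ω | renewal (U ω) δ m (jointPath u v (U ω)) j = (t : ℕ∞)} ∩
            {ω | renewal (U ω) δ m (jointPath u v (U ω)) (j + 1) = ⊤} := by
      intro ω hω
      rcases eq_or_ne (renewal (U ω) δ m (jointPath u v (U ω)) j) ⊤ with h3 | h3
      · exact Or.inl h3
      · obtain ⟨t, ht⟩ := ENat.ne_top_iff_exists.1 h3
        exact Or.inr (Set.mem_iUnion.2 ⟨t, ht.symm, hω⟩)
    refine measure_mono_null hcov (measure_union_null ih (measure_iUnion_null fun t => ?_))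
    have ht := (isStoppingTime_renewal hU hM hδ' hm u v j).measurableSet_eq t
    refine le_antisymm (ge_of_tendsto' hE fun n => ?_) bot_le
    have hsub : {ω | renewal (U ω) δ m (jointPath u v (U ω)) j = (t : ℕ∞)} ∩
        {ω | renewal (U ω) δ m (jointPath u v (U ω)) (j + 1) = ⊤} ⊆
        {ω | renewal (U ω) δ m (jointPath u v (U ω)) j = (t : ℕ∞)} ∩
        {ω | renewal (U ω) δ m (jointPath u v (U ω)) j + (n : ℕ∞) ≤
          renewal (U ω) δ m (jointPath u v (U ω)) (j + 1)} := fun ω hω => by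
      refine ⟨hω.1, ?_⟩
      rw [Set.mem_ofPred_eq, show renewal (U ω) δ m (jointPath u v (U ω)) (j + 1) = ⊤ from hω.2]
      exact le_top
    calc P _ ≤ E n * P {ω | renewal (U ω) δ m (jointPath u v (U ω)) j = (t : ℕ∞)} :=
          (measure_mono hsub).trans (h n j t _ ht subset_rfl)
      _ ≤ E n * 1 := mul_le_mul_right prob_le_one _
      _ = E n := mul_one _

/-- The tail estimate passes from one family of paths to another with the same filtration and the
same renewal steps. -/
theorem RenewalTail.congr {k k' : ℕ} {hU : Measurable U} {δ C₀ C₁ : ℝ} {m : ℕ}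
    {γ : Env d → Fin k → ℕ → Pt d} {γ' : Env d → Fin k' → ℕ → Pt d}
    {hγ : ∀ i n, Measurable fun ξ => γ ξ i n} {hγ' : ∀ i n, Measurable fun ξ => γ' ξ i n}
    (halg : ∀ n, gAlgebra P U δ γ n = gAlgebra P U δ γ' n)
    (hren : ∀ ξ j, renewal ξ δ m (γ ξ) j = renewal ξ δ m (γ' ξ) j)
    (h : RenewalTail P U hU δ m γ hγ C₀ C₁) : RenewalTail P U hU δ m γ' hγ' C₀ C₁ := by
  have hF : gFiltration P U hU δ γ hγ = gFiltration P U hU δ γ' hγ' :=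
    Filtration.ext (funext halg)
  unfold RenewalTail at h ⊢
  rw [← hF]
  simpa only [hren] using h

/-- The single path is the joint exploration of two paths with the same starting point. -/
theorem RenewalTail.singlePath {hU : Measurable U} {δ C₀ C₁ : ℝ} {m : ℕ} {u : Site d}
    (h : RenewalTail P U hU δ m (jointPath u u) (measurable_jointPath u u) C₀ C₁) :
    RenewalTail P U hU δ m (singlePath u) (measurable_singlePath u) C₀ C₁ := by
  have hsub : ∀ ξ (i : Fin 1) n, DSF.singlePath u ξ i n = DSF.singlePath u ξ 0 n :=
    fun _ _ _ => rfl
  have hgood : ∀ ξ n, GoodStep ξ δ (jointPath u u ξ) n ↔ GoodStep ξ δ (DSF.singlePath u ξ) n :=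
    fun ξ n => by simp [GoodStep, jointPath_self, hsub]
  have hup : ∀ ξ n, UpStep δ (jointPath u u ξ) n ↔ UpStep δ (DSF.singlePath u ξ) n :=
    fun ξ n => by simp [UpStep, jointPath_self, hsub]
  refine h.congr (fun n => ?_) fun ξ j => ?_
  · simp only [gAlgebra, hgood, jointPath_self, hsub, iSup_const]
  · induction j with
    | zero => rfl
    | succ j ih => simp only [renewal, ih, hup, SpecialUpStep, hgood]

/-- The conditional tail bound for the joint exploration. The two terms of the constant come from
the start of the exploration and from the times after a renewal step. -/
theorem exists_renewalTail (d : ℕ) [NeZero d] {δ : ℝ} (hδ : 0 < δ) (hδ' : δ < 1 / 8) (m : ℕ) :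
    ∃ C₀ C₁ : ℝ, 0 < C₀ ∧ 0 < C₁ ∧
      ∀ (Ω : Type u) [MeasurableSpace Ω] (P : Measure Ω) [IsProbabilityMeasure P]
        (U : Ω → Env d) (hU : Measurable U), IsModel P U → HeightBound P U m →
        ∀ u v : Site d, u (last d) = v (last d) →
          RenewalTail P U hU δ m (jointPath u v) (measurable_jointPath u v) C₀ C₁ := by
  obtain ⟨C, c, hC, hc, htail⟩ := exists_exponential_tail d hδ hδ' m
  set q := trapProb d δ 1 2 with hq
  have hq0 : 0 < q := trapProb_pos d hδ 1 2
  refine ⟨C + C / q, c, by positivity, hc, fun Ω _ P _ U hU hM hH u v huv j => ?_⟩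
  have hm : 0 < m := lt_of_lt_of_le (by norm_num) hH.four_le
  have hkey : ∀ (n j t : ℕ) (s : Set Ω), MeasurableSet[gAlgebra P U δ (jointPath u v) t] s →
      s ⊆ {ω | renewal (U ω) δ m (jointPath u v (U ω)) j = t} →
      P (s ∩ {ω | renewal (U ω) δ m (jointPath u v (U ω)) j + (n : ℕ∞) ≤
        renewal (U ω) δ m (jointPath u v (U ω)) (j + 1)}) ≤
        ENNReal.ofReal ((C + C / q) * Real.exp (-c * n)) * P s := by
    intro n j t s hs hst
    have hexp := Real.exp_pos (-c * n)
    refine measure_inter_renewal_le hU hM hδ hδ' hH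
      (E := ENNReal.ofReal (C * Real.exp (-c * n))) ?_ ?_
      (fun l w x κ _ hx hκ => htail l w x κ hx hκ n) huv hs hst
    · refine ENNReal.ofReal_le_ofReal (mul_le_mul_of_nonneg_right ?_ hexp.le)
      linarith [div_pos hC hq0]
    · rw [← hq, ← ENNReal.ofReal_div_of_pos hq0]
      refine ENNReal.ofReal_le_ofReal ?_
      rw [mul_div_right_comm]
      exact mul_le_mul_of_nonneg_right (by linarith) hexp.le
  have hlim : Filter.Tendsto (fun n : ℕ => ENNReal.ofReal ((C + C / q) * Real.exp (-c * n)))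
      Filter.atTop (nhds 0) := by
    rw [← ENNReal.ofReal_zero]
    refine ENNReal.tendsto_ofReal ?_
    rw [← mul_zero (C + C / q)]
    refine Filter.Tendsto.const_mul _ (Real.tendsto_exp_atBot.comp ?_)
    exact (tendsto_natCast_atTop_atTop).const_mul_atTop_of_neg (by linarith)
  refine ⟨isStoppingTime_renewal hU hM hδ' hm u v j, fun n _ => ?_⟩
  have hB : MeasurableSet {ω | renewal (U ω) δ m (jointPath u v (U ω)) j + (n : ℕ∞) ≤
      renewal (U ω) δ m (jointPath u v (U ω)) (j + 1)} :=
    ((measurable_renewal hU hM hδ' hm u v j).prodMk (measurable_renewal hU hM hδ' hm u v (j + 1)))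
      (Set.to_countable {p : ℕ∞ × ℕ∞ | p.1 + (n : ℕ∞) ≤ p.2}).measurableSet
  exact condProb_stoppingTime_le _ (measure_renewal_eq_top hU hM hδ' hm hlim hkey j) hB
    (by positivity) fun t s hs hst => hkey n j t s hs hst

end Tail

end DSF

theorem mainTheorem5 (d : ℕ) [NeZero d] (hd : d = 2 ∨ d = 3) :
    -- admissible values of `m_d` exist
    (∃ m : ℕ, ∀ (Ω : Type u) [MeasurableSpace Ω] (P : Measure Ω) [IsProbabilityMeasure P]
      (U : Ω → DSF.Env d), Measurable U → DSF.IsModel P U → DSF.HeightBound P U m) ∧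
    -- the tail bound, for every small `δ` and every admissible `m`
    ∃ δ₀ : ℝ, 0 < δ₀ ∧ ∀ δ : ℝ, 0 < δ → δ < δ₀ → ∀ m : ℕ,
      ∃ C₀ C₁ : ℝ, 0 < C₀ ∧ 0 < C₁ ∧
        ∀ (Ω : Type u) [MeasurableSpace Ω] (P : Measure Ω) [IsProbabilityMeasure P]
          (U : Ω → DSF.Env d) (hU : Measurable U), DSF.IsModel P U → DSF.HeightBound P U m →
          (∀ u : DSF.Site d,
            DSF.RenewalTail P U hU δ m (DSF.singlePath u) (DSF.measurable_singlePath u) C₀ C₁) ∧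
          (∀ u v : DSF.Site d, u (DSF.last d) = v (DSF.last d) →
            DSF.RenewalTail P U hU δ m (DSF.jointPath u v) (DSF.measurable_jointPath u v) C₀ C₁)
  := by
  refine ⟨⟨3 * d + 5, fun Ω _ P _ U hU hM => hM.heightBound hU⟩, 1 / 8, by norm_num,
    fun δ hδ hδ' m => ?_⟩
  obtain ⟨C₀, C₁, h0, h1, h⟩ := DSF.exists_renewalTail.{u} d hδ hδ' m
  exact ⟨C₀, C₁, h0, h1, fun Ω _ P _ U hU hM hH =>
    ⟨fun u => (h Ω P U hU hM hH u u rfl).singlePath, h Ω P U hU hM hH⟩⟩
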